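/- Let $p$ be a prime, $k$ an even integer and $m\ge 0$ an integer. Let $$R(p)=\left\{\begin{pmatrix} a & b\sqrt p\\ c\sqrt p & d\end{pmatrix}\in \mathrm{SL}_2(\mathbb R): a,b,c,d\in\mathbb Z\right\}\cup\left\{\begin{pmatrix} a\sqrt p & b\\ c & d\sqrt p\end{pmatrix}\in \mathrm{SL}_2(\mathbb R): a,b,c,d\in\mathbb Z\right\}.$$ For $z=x+iy$ in the upper half plane $\mathbb H$ and $\Re(s)>1-\frac k2$ put $$G_{p,k}(z,s)=\frac12\sum_{(a,b)\in L}\frac{y^s}{|\sqrt p\,az+b|^{2s}(\sqrt p\,az+b)^k}+\frac12\sum_{(a,b)\in R}\frac{y^s}{|az+\sqrt p\,b|^{2s}(az+\sqrt p\,b)^k},$$ where $L$ (respectively $R$) is the set of $(a,b)\in\mathbb Z^2\setminus\{(0,0)\}$ such that $\gcd(pa,b)$ (respectively $\gcd(a,pb)$) divides both $a$ and $b$. Put $$f_p(s)=\frac{1-p^{s-1+k/2}}{1-p^{2s+k-2}},\qquad \widehat G_{p,k}(z,s)=\left(\frac{\pi}{\sqrt p}\right)^{-s-\frac k2}\Gamma\left(s+\frac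 k2+\frac{|k|}2\right)f_p(s)\,G_{p,k}(z,s),$$ $$\widetilde G_{p,k}(z,s)=\left(s+\frac k2\right)\left(s+\frac k2-1\right)\widehat G_{p,k}(z,s).$$ Then for every $z\in\mathbb H$ the function $s\mapsto\widetilde G_{p,k}(z,s)$ has a unique meromorphic continuation to $\mathbb C$, and the continuation is holomorphic at $s=0$. Let $T_{p,m,k}(z)$ be the coefficient of $s^m$ in its Taylor expansion at $s=0$. Then $T_{p,m,k}$ has moderate growth at $\infty$: there is $\alpha\in\mathbb R$ such that $T_{p,m,k}(x+iy)=O(y^\alpha)$ as $y\to\infty$, uniformly in $x\in\mathbb R$. Consequently $T_{p,m,k}$ is a polyharmonic Maass form of weight $k$ and depth $\le m+1$ for $R(p)$, that is: 1. $T_{p,m,k}$ is a smooth complex-valued function on $\mathbb H$; 2. $T_{p,m,k}|_k\gamma=T_{p,m,k}$ for all $\gamma\in R(p)$, where $(f|_k\gamma)(z)=(cz+d)^{-k}f\left(\frac{az+b}{cz+d}\right)$ for $\gamma=\begin{pmatrix} a&b\\ c&d\end{pmatrix}$; 3. $\Delta_k^{m+1}T_{p,m,k}=0$, where $\Delta_k=y^2\left(\frac{\partial^2}{\partial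 x^2}+\frac{\partial^2}{\partial y^2}\right)-iky\left(\frac{\partial}{\partial x}+i\frac{\partial}{\partial y}\right)$; 4. for every cusp $c\in\mathbb R\cup\{\infty\}$ of $R(p)$ and every $\sigma\in\mathrm{SL}_2(\mathbb R)$ with $\sigma c=\infty$ there is $\alpha\in\mathbb R$ such that $(T_{p,m,k}|_k\sigma^{-1})(x+iy)=O(y^\alpha)$ as $y\to\infty$, uniformly in $x$. -/

import Mathlib

open Complex UpperHalfPlane Matrix
open scoped MatrixGroups ModularForm ContDiff

noncomputable section

/-! ### The groups `R(N)` -/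

/-- The matrices `(a, b√N; c√N, d)` of determinant one with `a, b, c, d ∈ ℤ`. -/
def RPlus (N : ℕ) : Set SL(2, ℝ) :=
  {g | ∃ a b c d : ℤ, g 0 0 = a ∧ g 0 1 = b * √(N : ℝ) ∧ g 1 0 = c * √(N : ℝ) ∧ g 1 1 = d}

/-- The matrices `(a√N, b; c, d√N)` of determinant one with `a, b, c, d ∈ ℤ`. -/
def RMinus (N : ℕ) : Set SL(2, ℝ) :=
  {g | ∃ a b c d : ℤ, g 0 0 = a * √(N : ℝ) ∧ g 0 1 = b ∧ g 1 0 = c ∧ g 1 1 = d * √(N : ℝ)}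

/-- The group `R(N) = R(N)⁺ ∪ R(N)⁻`. -/
def RGroup (N : ℕ) : Subgroup SL(2, ℝ) where
  carrier := RPlus N ∪ RMinus N
  one_mem' := Or.inl ⟨1, 0, 0, 1, by simp, by simp, by simp, by simp⟩
  mul_mem' := by
    have hN : √(N : ℝ) * √(N : ℝ) = N := Real.mul_self_sqrt (Nat.cast_nonneg N)
    have hmul (g h : SL(2, ℝ)) (i j : Fin 2) :
        (g * h) i j = g i 0 * h 0 j + g i 1 * h 1 j := by
      simp [Matrix.mul_apply, Fin.sum_univ_two]
    rintro g h (⟨a, b, c, d, h1, h2, h3, h4⟩ | ⟨a, b, c, d, h1, h2, h3, h4⟩)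
      (⟨a', b', c', d', h1', h2', h3', h4'⟩ | ⟨a', b', c', d', h1', h2', h3', h4'⟩)
    · refine Or.inl ⟨a * a' + N * (b * c'), a * b' + b * d',
        c * a' + d * c', N * (c * b') + d * d', ?_, ?_, ?_, ?_⟩ <;>
      simp only [hmul, h1, h2, h3, h4, h1', h2', h3', h4'] <;> push_cast
      · linear_combination (b * c' : ℝ) * hN
      · ring
      · ring
      · linear_combination (c * b' : ℝ) * hN
    · refine Or.inr ⟨a * a' + b * c', a * b' + N * (b * d'),
        N * (c * a') + d * c', c * b' + d * d', ?_, ?_, ?_, ?_⟩ <;>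
      simp only [hmul, h1, h2, h3, h4, h1', h2', h3', h4'] <;> push_cast
      · ring
      · linear_combination (b * d' : ℝ) * hN
      · linear_combination (c * a' : ℝ) * hN
      · ring
    · refine Or.inr ⟨a * a' + b * c', N * (a * b') + b * d',
        c * a' + N * (d * c'), c * b' + d * d', ?_, ?_, ?_, ?_⟩ <;>
      simp only [hmul, h1, h2, h3, h4, h1', h2', h3', h4'] <;> push_cast
      · ring
      · linear_combination (a * b' : ℝ) * hN
      · linear_combination (d * c' : ℝ) * hN
      · ring
    · refine Or.inl ⟨N * (a * a') + b * c', a * b' + b * d',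
        c * a' + d * c', c * b' + N * (d * d'), ?_, ?_, ?_, ?_⟩ <;>
      simp only [hmul, h1, h2, h3, h4, h1', h2', h3', h4'] <;> push_cast
      · linear_combination (a * a' : ℝ) * hN
      · ring
      · ring
      · linear_combination (d * d' : ℝ) * hN
  inv_mem' := by
    rintro g (⟨a, b, c, d, h1, h2, h3, h4⟩ | ⟨a, b, c, d, h1, h2, h3, h4⟩)
    · exact Or.inl ⟨d, -b, -c, a, by simp [adjugate_fin_two, h4],
        by simp [adjugate_fin_two, h2],
        by simp [adjugate_fin_two, h3],
        by simp [adjugate_fin_two, h1]⟩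
    · exact Or.inr ⟨d, -b, -c, a, by simp [adjugate_fin_two, h4],
        by simp [adjugate_fin_two, h2],
        by simp [adjugate_fin_two, h3],
        by simp [adjugate_fin_two, h1]⟩

/-! ### The Eisenstein series of `R(N)` -/

/-- The index set `(ℤ × ℤ)_{N,L}`. -/
def eisSetL (N : ℕ) : Set (ℤ × ℤ) :=
  {v | ∃ t : ℕ, 0 < t ∧ (t : ℤ) ∣ v.1 ∧ (t : ℤ) ∣ v.2 ∧ Int.gcd (N * v.1) v.2 = t}

/-- The index set `(ℤ × ℤ)_{N,R}`. -/
def eisSetR (N : ℕ) : Set (ℤ × ℤ) :=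
  {v | ∃ t : ℕ, 0 < t ∧ (t : ℤ) ∣ v.1 ∧ (t : ℤ) ∣ v.2 ∧ Int.gcd v.1 (N * v.2) = t}

/-- `y^s / (|w|^{2s} w^k)`, the summand of the Eisenstein series. -/
def eisTerm (k : ℤ) (y : ℝ) (w s : ℂ) : ℂ :=
  (y : ℂ) ^ s / (((‖w‖ : ℝ) : ℂ) ^ (2 * s) * w ^ k)

/-- `G_{N,k,L}(z,s)`; the series converges absolutely for `Re s > 1 - k/2`. -/
def eisGL (N : ℕ) (k : ℤ) (z : ℍ) (s : ℂ) : ℂ :=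
  1 / 2 * ∑' v : eisSetL N, eisTerm k z.im ((√(N : ℝ) : ℂ) * v.1.1 * z + v.1.2) s

/-- `G_{N,k,R}(z,s)`; the series converges absolutely for `Re s > 1 - k/2`. -/
def eisGR (N : ℕ) (k : ℤ) (z : ℍ) (s : ℂ) : ℂ :=
  1 / 2 * ∑' v : eisSetR N, eisTerm k z.im ((v.1.1 : ℂ) * z + (√(N : ℝ) : ℂ) * v.1.2) s

/-- The non-holomorphic Eisenstein series `G_{N,k}(z,s)`, for `Re s > 1 - k/2`. -/
def eisG (N : ℕ) (k : ℤ) (z : ℍ) (s : ℂ) : ℂ := eisGL N k z s + eisGR N k z s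

/-- The factor `f_N(s)` (which depends on `k`), for square-free `N`. -/
def eisF (N : ℕ) (k : ℤ) (s : ℂ) : ℂ :=
  ((-1) ^ N.primeFactors.card * (N : ℂ) ^ ((s - 1) + (k : ℂ) / 2) + 1) *
    ∏ p ∈ N.primeFactors, (1 - (p : ℂ) ^ (2 * s + (k : ℂ) - 2))⁻¹

/-- The completed Eisenstein series `Ĝ_{N,k}(z,s)`, for `Re s > 1 - k/2`. -/
def eisGHat (N : ℕ) (k : ℤ) (z : ℍ) (s : ℂ) : ℂ :=
  ((Real.pi / √(N : ℝ) : ℝ) : ℂ) ^ (-s - (k : ℂ) / 2) *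
    Complex.Gamma (s + (k : ℂ) / 2 + ((|k| : ℤ) : ℂ) / 2) * eisF N k s * eisG N k z s

/-- The doubly-completed Eisenstein series `G̃_{N,k}(z,s)`, for `Re s > 1 - k/2`. -/
def eisGTilde (N : ℕ) (k : ℤ) (z : ℍ) (s : ℂ) : ℂ :=
  (s + (k : ℂ) / 2) * (s + (k : ℂ) / 2 - 1) * eisGHat N k z s

/-- `F` is a meromorphic function on `ℂ` that agrees with `f` on the half plane `Re s > c`.
Normal form means that `F` takes its true (limit) value at every point where it is regular, and
the value `0` at its poles, so that such an `F` is unique. -/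
def IsMeromorphicContinuation (c : ℝ) (f F : ℂ → ℂ) : Prop :=
  MeromorphicNFOn F Set.univ ∧ ∀ s : ℂ, c < s.re → F s = f s

/-- The meromorphic continuation to `ℂ` of a function on `Re s > c` (an arbitrary function if there
is none). -/
def meromorphicContinuation (c : ℝ) (f : ℂ → ℂ) : ℂ → ℂ :=
  Classical.epsilon (IsMeromorphicContinuation c f)

/-- `s ↦ G̃_{N,k}(z,s)`, continued meromorphically from `Re s > 1 - k/2` to `ℂ`. -/
def eisGTildeCont (N : ℕ) (k : ℤ) (z : ℍ) : ℂ → ℂ :=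
  meromorphicContinuation (1 - (k : ℝ) / 2) (eisGTilde N k z)

/-- `T_{N,m,k}(z)`, the coefficient of `s ^ m` in the Taylor expansion of `G̃_{N,k}(z,s)` at
`s = 0`. -/
def eisTaylor (N m : ℕ) (k : ℤ) (z : ℍ) : ℂ :=
  iteratedDeriv m (eisGTildeCont N k z) 0 / (m.factorial : ℂ)

/-! ### Polyharmonic Maass forms -/

/-- `∂f/∂x` for a function on the upper half plane, `z = x + iy`. -/
def partialX (f : ℍ → ℂ) (z : ℍ) : ℂ := lineDeriv ℝ (f ∘ ofComplex) (z : ℂ) 1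

/-- `∂f/∂y` for a function on the upper half plane, `z = x + iy`. -/
def partialY (f : ℍ → ℂ) (z : ℍ) : ℂ := lineDeriv ℝ (f ∘ ofComplex) (z : ℂ) Complex.I

/-- The weight `k` hyperbolic Laplacian
`Δ_k = y² (∂²/∂x² + ∂²/∂y²) - i k y (∂/∂x + i ∂/∂y)`. -/
def hypLaplacian (k : ℤ) (f : ℍ → ℂ) (z : ℍ) : ℂ :=
  (z.im : ℂ) ^ 2 * (partialX (partialX f) z + partialY (partialY f) z) -
    Complex.I * k * z.im * (partialX f z + Complex.I * partialY f z)

/-- `f(x + iy) = O(y^α)` as `y → ∞`, uniformly in `x`, for some real `α`. -/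
def HasModerateGrowth (f : ℍ → ℂ) : Prop :=
  ∃ α : ℝ, f =O[atImInfty] fun z : ℍ => z.im ^ α

/-- `f` is a polyharmonic Maass form (with eigenvalue zero) of weight `k` and depth `≤ r` for the
subgroup `Γ` of `SL(2, ℝ)`. -/
structure IsPolyharmonicMaassForm (Γ : Subgroup SL(2, ℝ)) (k : ℤ) (r : ℕ) (f : ℍ → ℂ) :
    Prop where
  smooth : ContDiffOn ℝ ∞ (f ∘ ofComplex) {w : ℂ | 0 < w.im}
  slash_eq : ∀ γ ∈ Γ, f ∣[k] (γ : GL (Fin 2) ℝ) = f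
  polyharmonic : (hypLaplacian k)^[r] f = 0
  growth : ∀ c : OnePoint ℝ, IsCusp c (Γ.map SpecialLinearGroup.toGL) →
    ∀ σ : SL(2, ℝ), (σ : GL (Fin 2) ℝ) • c = OnePoint.infty →
      HasModerateGrowth (f ∣[k] ((σ⁻¹ : SL(2, ℝ)) : GL (Fin 2) ℝ))

end

/-! The series over the index sets `eisSetL` and `eisSetR` are linear combinations of two full
lattice sums, and lattice sums are Mellin transforms of theta series.

A nonzero integer vector outside `eisSetL p` is exactly some `(a, p b)` with `(a, b)` in `eisSetR
p`, and symmetrically. So the Eisenstein series of the lattices `ℤ √p z + ℤ` and `ℤ z + ℤ √p` are `2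
(G_L + p^(-(s+k/2)) G_R)` and `2 (G_R + p^(-(s+k/2)) G_L)`. Adding them, and using that `f_p` equals
`1 / (1 + p^(s+k/2-1))`, writes `f_p G` as half the sum of the two lattice series divided by
`eisDen` (`eisF_mul_eisG`). At `s = 0` both factors of `eisDen` have the form 1 plus a nonnegative
real number, so they do not vanish.

A lattice series times its Gamma factor is the Mellin transform of a theta series weighted by `w̄^k`
or `w^|k|`. The theta inversion formula (`thetaForm_inv`, differentiated in `tsum_qform_pow_inv`)
folds the integral onto `t > 1` (`hasSum_latSum`). The result is entire in `s` apart from simple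
poles at `s = 0, 1` when `k = 0`, and the polynomial factor in `G̃` removes these. Hence `G̃ =
eisEntire / eisDen` (`eisGTilde_eq`), where `eisEntire` is smooth in `(z, s)` and entire in `s`.

The properties of the Taylor coefficients are read off from this quotient. Invariance
(`eisEntire_smul`): up to the factor `cz + d`, elements of `RPlus` preserve both lattices and
elements of `RMinus` interchange them. Polyharmonicity: each term is an eigenfunction of `Δ_k` with
eigenvalue `s (s + k - 1)` (`cLaplacian_latEis`). The identity theorem extends this to all `s`
(`cLaplacian_eisEntire`). Since the eigenvalue is divisible by `s`, applying `Δ_k` `m + 1` times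
kills the coefficient of `s^m`. Growth: the folded integrals grow polynomially in `y` on vertical
strips (`norm_latSum_le`). Cauchy's estimate passes this to Taylor coefficients, and translation by
`√p` makes it uniform in `x`. Every cusp is equivalent to `∞` (`exists_smul_infty_eq_cusp`), so the
bound at `∞` is enough. -/

noncomputable section

/-! ### Smoothness of integrals of exponentials of linear forms -/

section ExpIntegral
open MeasureTheory Filter Topology

variable {Ω V F : Type} [MeasurableSpace Ω] [NormedAddCommGroup V] [NormedSpace ℂ V]
  [NormedAddCommGroup F] [NormedSpace ℂ F]

/-- The Laplace type integral `v ↦ ∫ exp (ℓ_a v) f(a) dμ(a)` of a family `ℓ` of linear forms. -/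
def expIntegral (μ : Measure Ω) (l : Ω → V →L[ℂ] ℂ) (f : Ω → F) (v : V) : F :=
  ∫ a, cexp (l a v) • f a ∂μ

/-- Local uniform absolute convergence of `expIntegral μ l f` around `v`. -/
def ExpAdm (μ : Measure Ω) (l : Ω → V →L[ℂ] ℂ) (f : Ω → F) (v : V) : Prop :=
  AEStronglyMeasurable l μ ∧ AEStronglyMeasurable f μ ∧ ∃ ε > 0,
    Integrable (fun a => Real.exp ((l a v).re + ε * ‖l a‖) * ‖f a‖) μ

variable {μ : Measure Ω} {l : Ω → V →L[ℂ] ℂ} {f : Ω → F} {v : V}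

lemma aestronglyMeasurable_cexp_smul (hl : AEStronglyMeasurable l μ)
    (hf : AEStronglyMeasurable f μ) (v : V) :
    AEStronglyMeasurable (fun a => cexp (l a v) • f a) μ :=
  (continuous_exp.comp_aestronglyMeasurable (hl.apply_continuousLinearMap v)).smul hf

lemma norm_cexp_apply_le (L : V →L[ℂ] ℂ) (v v' : V) :
    ‖cexp (L v')‖ ≤ Real.exp ((L v).re + ‖v' - v‖ * ‖L‖) := by
  rw [norm_exp]
  gcongr
  have h1 : (L v').re = (L v).re + (L (v' - v)).re := by simp
  have h2 : (L (v' - v)).re ≤ ‖L‖ * ‖v' - v‖ := (re_le_norm _).trans (L.le_opNorm _)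
  linarith [mul_comm ‖L‖ ‖v' - v‖]

lemma ExpAdm.integrable (h : ExpAdm μ l f v) : Integrable (fun a => cexp (l a v) • f a) μ := by
  obtain ⟨hl, hf, ε, hε, hi⟩ := h
  refine hi.mono' (aestronglyMeasurable_cexp_smul hl hf v) (Eventually.of_forall fun a => ?_)
  rw [norm_smul, norm_exp]
  gcongr
  have : 0 ≤ ε * ‖l a‖ := by positivity
  linarith

lemma ExpAdm.eventually (h : ExpAdm μ l f v) : ∀ᶠ v' in 𝓝 v, ExpAdm μ l f v' := by
  obtain ⟨hl, hf, ε, hε, hi⟩ := h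
  filter_upwards [Metric.ball_mem_nhds v (half_pos hε)] with v' hv'
  rw [mem_ball_iff_norm] at hv'
  refine ⟨hl, hf, ε / 2, half_pos hε, hi.mono' ?_ (Eventually.of_forall fun a => ?_)⟩
  · refine (Real.continuous_exp.comp_aestronglyMeasurable ?_).mul hf.norm
    exact (continuous_re.comp_aestronglyMeasurable (hl.apply_continuousLinearMap v')).add
      (hl.norm.const_mul _)
  · rw [Real.norm_of_nonneg (by positivity), Real.exp_add, ← norm_exp]
    gcongr
    calc ‖cexp (l a v')‖ * Real.exp (ε / 2 * ‖l a‖)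
        ≤ Real.exp ((l a v).re + ‖v' - v‖ * ‖l a‖) * Real.exp (ε / 2 * ‖l a‖) := by
          gcongr; exact norm_cexp_apply_le _ _ _
      _ ≤ _ := by
          rw [← Real.exp_add]
          refine Real.exp_le_exp.2 ?_
          nlinarith [norm_nonneg (l a)]

/-- Differentiation under the integral brings down a factor `l a`. Half of the margin `ε` absorbs
it, since `x ≤ (2/ε) exp (ε x / 2)`, so the class of admissible integrands is closed under
differentiation. -/
lemma ExpAdm.smulRight (h : ExpAdm μ l f v) :
    ExpAdm μ l (fun a => (l a).smulRight (f a)) v := by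
  obtain ⟨hl, hf, ε, hε, hi⟩ := h
  have hm : AEStronglyMeasurable (fun a => (l a).smulRight (f a)) μ :=
    (ContinuousLinearMap.smulRightL ℂ V F).continuous₂.comp_aestronglyMeasurable₂ hl hf
  refine ⟨hl, hm, ε / 2, half_pos hε,
    (hi.const_mul (2 / ε)).mono' ?_ (Eventually.of_forall fun a => ?_)⟩
  · refine (Real.continuous_exp.comp_aestronglyMeasurable ?_).mul hm.norm
    exact (continuous_re.comp_aestronglyMeasurable (hl.apply_continuousLinearMap v)).add
      (hl.norm.const_mul _)
  · rw [Real.norm_of_nonneg (by positivity), ContinuousLinearMap.norm_smulRight_apply]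
    have h1 : ε / 2 * ‖l a‖ ≤ Real.exp (ε / 2 * ‖l a‖) := by
      linarith [Real.add_one_le_exp (ε / 2 * ‖l a‖)]
    have h2 : ‖l a‖ ≤ 2 / ε * Real.exp (ε / 2 * ‖l a‖) := by
      rw [div_mul_eq_mul_div, le_div_iff₀ hε]; linarith
    calc Real.exp ((l a v).re + ε / 2 * ‖l a‖) * (‖l a‖ * ‖f a‖)
        ≤ Real.exp ((l a v).re + ε / 2 * ‖l a‖) *
          ((2 / ε * Real.exp (ε / 2 * ‖l a‖)) * ‖f a‖) := by gcongr
      _ = 2 / ε * (Real.exp ((l a v).re + ε * ‖l a‖) * ‖f a‖) := by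
          rw [show (l a v).re + ε * ‖l a‖ = ((l a v).re + ε / 2 * ‖l a‖) + ε / 2 * ‖l a‖ by ring,
            Real.exp_add (_ + _)]
          ring

lemma ExpAdm.hasFDerivAt [CompleteSpace F] (h : ExpAdm μ l f v) :
    HasFDerivAt (expIntegral μ l f) (expIntegral μ l (fun a => (l a).smulRight (f a)) v) v := by
  obtain ⟨hl, hf', ε, hε, hi⟩ := h.smulRight
  have hf := h.2.1
  refine hasFDerivAt_integral_of_dominated_of_fderiv_le
    (F' := fun v' a => cexp (l a v') • (l a).smulRight (f a))
    (bound := fun a => Real.exp ((l a v).re + ε * ‖l a‖) * ‖(l a).smulRight (f a)‖)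
    (Metric.ball_mem_nhds v hε)
    (Eventually.of_forall fun v' => aestronglyMeasurable_cexp_smul hl hf v') h.integrable
    (aestronglyMeasurable_cexp_smul hl hf' v) (Eventually.of_forall fun a v' hv' => ?_) hi
    (Eventually.of_forall fun a v' _ => ?_)
  · rw [mem_ball_iff_norm] at hv'
    rw [norm_smul]
    gcongr
    refine (norm_cexp_apply_le _ v _).trans ?_
    gcongr
  · have h1 := ((l a).hasFDerivAt (x := v')).cexp.smul_const (f a)
    convert h1 using 1
    ext x
    simp [smul_smul]

/-- The derivative is an integral of the same kind with values in `V →L[ℂ] F`. The induction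
therefore has to quantify over the target space. -/
lemma ExpAdm.contDiffAt_nat (n : ℕ) : ∀ (F : Type) [NormedAddCommGroup F] [NormedSpace ℂ F]
    [CompleteSpace F] (f : Ω → F) (v : V), ExpAdm μ l f v →
      ContDiffAt ℂ n (expIntegral μ l f) v := by
  induction n with
  | zero =>
    intro F _ _ _ f v h
    rw [Nat.cast_zero, contDiffAt_zero]
    obtain ⟨u, hu, hu'⟩ := h.eventually.exists_mem
    exact ⟨u, hu, fun x hx => (hu' x hx).hasFDerivAt.continuousAt.continuousWithinAt⟩
  | succ n ih =>
    intro F _ _ _ f v h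
    push_cast
    rw [contDiffAt_succ_iff_hasFDerivAt]
    refine ⟨_, ?_, ih _ _ _ h.smulRight⟩
    obtain ⟨u, hu, hu'⟩ := h.eventually.exists_mem
    exact ⟨u, hu, fun x hx => (hu' x hx).hasFDerivAt⟩

lemma ExpAdm.contDiffAt [CompleteSpace F] (h : ExpAdm μ l f v) :
    ContDiffAt ℂ ∞ (expIntegral μ l f) v :=
  contDiffAt_infty.2 fun n => ExpAdm.contDiffAt_nat n F f v h

/-- The scalar case in one variable: iterated derivatives are computed under the integral. -/
lemma iteratedDeriv_expIntegral {c : Ω → ℂ} {f : Ω → ℂ} {U : Set ℂ} (hU : IsOpen U)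
    (h : ∀ n : ℕ, ∀ x ∈ U, ExpAdm μ (fun a => c a • ContinuousLinearMap.id ℂ ℂ)
      (fun a => c a ^ n * f a) x) (n : ℕ) : ∀ x ∈ U,
    iteratedDeriv n (fun x => ∫ a, cexp (c a * x) * f a ∂μ) x =
      ∫ a, cexp (c a * x) * (c a ^ n * f a) ∂μ := by
  induction n with
  | zero => intro x hx; simp
  | succ n ih =>
    intro x hx
    rw [iteratedDeriv_succ]
    have h1 : iteratedDeriv n (fun x => ∫ a, cexp (c a * x) * f a ∂μ) =ᶠ[𝓝 x]
        expIntegral μ (fun a => c a • ContinuousLinearMap.id ℂ ℂ) (fun a => c a ^ n * f a) := by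
      filter_upwards [hU.mem_nhds hx] with y hy
      rw [ih y hy]
      simp [expIntegral]
    rw [h1.deriv_eq]
    have h2 := (h n x hx).hasFDerivAt.hasDerivAt.deriv
    rw [h2, expIntegral, ContinuousLinearMap.integral_apply (h n x hx).smulRight.integrable]
    congr 1; ext a
    simp [pow_succ]
    ring
end ExpIntegral

/-! ### The measure on nonzero lattice vectors times `(1, ∞)` -/

section LatticeMeasure
open MeasureTheory Filter Topology Set

/-- The square of the Euclidean norm of an integer vector. -/
def nrmSq (v : ℤ × ℤ) : ℝ := (v.1 : ℝ) ^ 2 + (v.2 : ℝ) ^ 2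

lemma nrmSq_nonneg (v : ℤ × ℤ) : 0 ≤ nrmSq v := by unfold nrmSq; positivity

lemma one_le_nrmSq {v : ℤ × ℤ} (hv : v ≠ 0) : 1 ≤ nrmSq v := by
  have h : (1 : ℤ) ≤ v.1 ^ 2 + v.2 ^ 2 := by
    by_contra! h
    have h1 : v.1 = 0 := by nlinarith [sq_nonneg v.1, sq_nonneg v.2]
    have h2 : v.2 = 0 := by nlinarith [sq_nonneg v.1, sq_nonneg v.2]
    exact hv (Prod.ext h1 h2)
  unfold nrmSq
  exact_mod_cast h

/-- The Euclidean norm dominates the sup norm, for which the summability of `‖v‖^(-2σ)` over `ℤ²` is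
known. -/
lemma summable_nrmSq_rpow {σ : ℝ} (hσ : 1 < σ) :
    Summable fun v : ℤ × ℤ => if v = 0 then 0 else nrmSq v ^ (-σ) := by
  have h := EisensteinSeries.summable_one_div_norm_rpow (k := 2 * σ) (by linarith)
  have h' := (finTwoArrowEquiv ℤ).symm.summable_iff.2 h
  refine h'.of_nonneg_of_le (fun v => ?_) (fun v => ?_)
  · split_ifs
    exacts [le_rfl, Real.rpow_nonneg (nrmSq_nonneg v) _]
  · split_ifs with hv
    · simp only [Function.comp]; positivity
    · have hw : ((finTwoArrowEquiv ℤ).symm v) ≠ 0 := by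
        rw [Ne, Equiv.symm_apply_eq]
        exact fun h => hv (h.trans rfl)
      have h0 : 0 < ‖(finTwoArrowEquiv ℤ).symm v‖ := norm_pos_iff.2 hw
      have h1 : ‖(finTwoArrowEquiv ℤ).symm v‖ ^ 2 ≤ nrmSq v := by
        rw [EisensteinSeries.norm_eq_max_natAbs]
        simp only [finTwoArrowEquiv_symm_apply, Matrix.cons_val_zero, Matrix.cons_val_one, nrmSq]
        rcases le_total v.1.natAbs v.2.natAbs with h | h
        · rw [max_eq_right (by exact_mod_cast h)]
          rw [Nat.cast_natAbs, Int.cast_abs, sq_abs]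
          nlinarith [sq_nonneg (v.1 : ℝ)]
        · rw [max_eq_left (by exact_mod_cast h)]
          rw [Nat.cast_natAbs, Int.cast_abs, sq_abs]
          nlinarith [sq_nonneg (v.2 : ℝ)]
      simp only [Function.comp]
      rw [show -(2 * σ) = (2 : ℕ) * (-σ) by push_cast; ring, Real.rpow_mul h0.le,
        Real.rpow_natCast]
      exact Real.rpow_le_rpow_of_nonpos (by positivity) h1 (by linarith)

lemma exp_neg_le_div_pow {c x : ℝ} (hc : 0 < c) (hx : 0 < x) (n : ℕ) :
    Real.exp (-(c * x)) ≤ n.factorial / c ^ n * (x ^ n)⁻¹ := by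
  have h := Real.pow_div_factorial_le_exp (x := c * x) (by positivity) n
  rw [Real.exp_neg]
  have h1 : 0 < (c * x) ^ n / n.factorial := by positivity
  refine (inv_anti₀ h1 h).trans (le_of_eq ?_)
  rw [mul_pow]
  field_simp

/-- Integration over `t > 1` and summation over the nonzero integer vectors. -/
def latMeas : Measure ((ℤ × ℤ) × ℝ) :=
  (Measure.count.restrict {0}ᶜ).prod (volume.restrict (Ioi 1))

lemma ae_latMeas : ∀ᵐ a ∂latMeas, a.1 ≠ 0 ∧ 1 < a.2 := by
  have h : latMeas = (Measure.count.prod volume).restrict ({0}ᶜ ×ˢ Ioi 1) :=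
    Measure.prod_restrict _ _
  rw [h]
  filter_upwards [ae_restrict_mem ((MeasurableSet.singleton (0 : ℤ × ℤ)).compl.prod
    measurableSet_Ioi)] with a ha
  exact ⟨ha.1, ha.2⟩

/-- The size function `t |v|²` on the domain of `latMeas`. -/
def latSize (a : (ℤ × ℤ) × ℝ) : ℝ := a.2 * nrmSq a.1

lemma one_le_latSize {a : (ℤ × ℤ) × ℝ} (h : a.1 ≠ 0 ∧ 1 < a.2) : 1 ≤ latSize a :=
  one_le_mul_of_one_le_of_one_le h.2.le (one_le_nrmSq h.1)

lemma integrable_latSize : Integrable (fun a => (latSize a ^ 2)⁻¹) latMeas := by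
  have h1 : Integrable (fun v : ℤ × ℤ => (nrmSq v ^ 2)⁻¹) (Measure.count.restrict {0}ᶜ) := by
    have h := summable_nrmSq_rpow (σ := 2) (by norm_num)
    have h' : Integrable (fun v : ℤ × ℤ => if v = 0 then 0 else nrmSq v ^ (-2 : ℝ))
      Measure.count := integrable_count_iff.2 h.norm
    refine (h'.restrict (s := {0}ᶜ)).congr ?_
    filter_upwards [ae_restrict_mem (MeasurableSet.singleton (0 : ℤ × ℤ)).compl] with v hv
    rw [if_neg (show v ≠ 0 from hv), Real.rpow_neg (nrmSq_nonneg v)]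
    norm_cast
  have h2 : Integrable (fun t : ℝ => (t ^ 2)⁻¹) (volume.restrict (Ioi 1)) := by
    have := integrableOn_Ioi_rpow_of_lt (a := -2) (by norm_num) (zero_lt_one' ℝ)
    refine this.congr_fun (fun t ht => ?_) measurableSet_Ioi
    simp only
    rw [Real.rpow_neg (zero_lt_one.trans ht).le]
    norm_cast
  refine (h1.mul_prod h2).congr (Eventually.of_forall fun a => ?_)
  simp only [latSize]
  rw [mul_pow, mul_inv, mul_comm]

/-- `(A, B, C, σ) ↦ -π t (m² A + m n B + n² C) + σ log t`. -/
def latForm (a : (ℤ × ℤ) × ℝ) : ℂ × ℂ × ℂ × ℂ →L[ℂ] ℂ :=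
  (-(Real.pi * a.2 * (a.1.1 : ℝ) ^ 2 : ℝ) : ℂ) • ContinuousLinearMap.fst ℂ ℂ (ℂ × ℂ × ℂ) +
  (ContinuousLinearMap.comp
    ((-(Real.pi * a.2 * ((a.1.1 : ℝ) * a.1.2) : ℝ) : ℂ) • ContinuousLinearMap.fst ℂ ℂ (ℂ × ℂ) +
    ContinuousLinearMap.comp
      ((-(Real.pi * a.2 * (a.1.2 : ℝ) ^ 2 : ℝ) : ℂ) • ContinuousLinearMap.fst ℂ ℂ ℂ +
        ((Real.log a.2 : ℝ) : ℂ) • ContinuousLinearMap.snd ℂ ℂ ℂ)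
      (ContinuousLinearMap.snd ℂ ℂ (ℂ × ℂ)))
    (ContinuousLinearMap.snd ℂ ℂ (ℂ × ℂ × ℂ)))

lemma latForm_apply (a : (ℤ × ℤ) × ℝ) (A B C σ : ℂ) :
    latForm a (A, B, C, σ) = -(Real.pi * a.2 *
      ((a.1.1 : ℂ) ^ 2 * A + (a.1.1 : ℂ) * a.1.2 * B + (a.1.2 : ℂ) ^ 2 * C)) +
      (Real.log a.2 : ℝ) * σ := by
  simp [latForm]
  ring

lemma measurable_latForm : AEStronglyMeasurable latForm latMeas := by
  have h1 : Measurable fun a : (ℤ × ℤ) × ℝ => (a.1.1 : ℝ) :=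
    (measurable_of_countable fun v : ℤ × ℤ => (v.1 : ℝ)).comp measurable_fst
  have h2 : Measurable fun a : (ℤ × ℤ) × ℝ => (a.1.2 : ℝ) :=
    (measurable_of_countable fun v : ℤ × ℤ => (v.2 : ℝ)).comp measurable_fst
  have hs (c : (ℤ × ℤ) × ℝ → ℂ) (hc : Measurable c) (L : ℂ × ℂ × ℂ × ℂ →L[ℂ] ℂ) :
      AEStronglyMeasurable (fun a => c a • L) latMeas := hc.aestronglyMeasurable.smul_const L
  have h : latForm = fun a => (-(Real.pi * a.2 * (a.1.1 : ℝ) ^ 2 : ℝ) : ℂ) •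
      ContinuousLinearMap.fst ℂ ℂ (ℂ × ℂ × ℂ) +
      (-(Real.pi * a.2 * ((a.1.1 : ℝ) * a.1.2) : ℝ) : ℂ) •
        (ContinuousLinearMap.fst ℂ ℂ (ℂ × ℂ)).comp (ContinuousLinearMap.snd ℂ ℂ (ℂ × ℂ × ℂ)) +
      (-(Real.pi * a.2 * (a.1.2 : ℝ) ^ 2 : ℝ) : ℂ) • ((ContinuousLinearMap.fst ℂ ℂ ℂ).comp
        (ContinuousLinearMap.snd ℂ ℂ (ℂ × ℂ))).comp (ContinuousLinearMap.snd ℂ ℂ (ℂ × ℂ × ℂ)) +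
      ((Real.log a.2 : ℝ) : ℂ) • ((ContinuousLinearMap.snd ℂ ℂ ℂ).comp
        (ContinuousLinearMap.snd ℂ ℂ (ℂ × ℂ))).comp
          (ContinuousLinearMap.snd ℂ ℂ (ℂ × ℂ × ℂ)) := by
    funext a
    refine ContinuousLinearMap.ext fun x => ?_
    simp [latForm]
    ring
  rw [h]
  refine (((hs _ ?_ _).add (hs _ ?_ _)).add (hs _ ?_ _)).add (hs _ ?_ _)
  all_goals fun_prop

lemma norm_latForm_le {a : (ℤ × ℤ) × ℝ} (h : a.1 ≠ 0 ∧ 1 < a.2) :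
    ‖latForm a‖ ≤ (3 * Real.pi + 1) * latSize a := by
  have hs := one_le_latSize h
  have ht : 0 < a.2 := zero_lt_one.trans h.2
  refine ContinuousLinearMap.opNorm_le_bound _ (by positivity) fun ⟨A, B, C, σ⟩ => ?_
  rw [latForm_apply]
  set M := ‖(A, B, C, σ)‖ with hM
  have hA : ‖A‖ ≤ M := le_max_left _ _
  have hB : ‖B‖ ≤ M := (le_max_left _ _).trans (le_max_right _ _)
  have hC : ‖C‖ ≤ M := (le_max_left _ _).trans ((le_max_right _ _).trans (le_max_right _ _))
  have hσ : ‖σ‖ ≤ M := (le_max_right _ _).trans ((le_max_right _ _).trans (le_max_right _ _))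
  have hM0 : 0 ≤ M := norm_nonneg _
  have hn : 1 ≤ nrmSq a.1 := one_le_nrmSq h.1
  have e1 : ‖(a.1.1 : ℂ) ^ 2 * A‖ ≤ nrmSq a.1 * M := by
    rw [norm_mul, norm_pow, norm_intCast, sq_abs]
    gcongr
    unfold nrmSq; nlinarith [sq_nonneg (a.1.2 : ℝ)]
  have e2 : ‖(a.1.1 : ℂ) * a.1.2 * B‖ ≤ nrmSq a.1 * M := by
    rw [norm_mul, norm_mul, norm_intCast, norm_intCast]
    gcongr
    unfold nrmSq
    nlinarith [sq_abs (a.1.1 : ℝ), sq_abs (a.1.2 : ℝ), sq_nonneg (|(a.1.1 : ℝ)| - |(a.1.2 : ℝ)|),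
      abs_nonneg (a.1.1 : ℝ), abs_nonneg (a.1.2 : ℝ)]
  have e3 : ‖(a.1.2 : ℂ) ^ 2 * C‖ ≤ nrmSq a.1 * M := by
    rw [norm_mul, norm_pow, norm_intCast, sq_abs]
    gcongr
    unfold nrmSq; nlinarith [sq_nonneg (a.1.1 : ℝ)]
  have e4 : ‖((Real.log a.2 : ℝ) : ℂ) * σ‖ ≤ latSize a * M := by
    rw [norm_mul, norm_real, Real.norm_of_nonneg (Real.log_nonneg h.2.le)]
    gcongr
    have := Real.log_le_sub_one_of_pos ht
    unfold latSize
    nlinarith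
  have e5 : ‖(Real.pi * a.2 : ℂ)‖ = Real.pi * a.2 := by
    rw [← ofReal_mul, norm_real, Real.norm_of_nonneg (by positivity)]
  refine (norm_add_le _ _).trans ?_
  rw [norm_neg, norm_mul, e5]
  have e6 := (norm_add₃_le (a := (a.1.1 : ℂ) ^ 2 * A) (b := (a.1.1 : ℂ) * a.1.2 * B)
    (c := (a.1.2 : ℂ) ^ 2 * C)).trans (add_le_add (add_le_add e1 e2) e3)
  have e7 := mul_le_mul_of_nonneg_left e6 (by positivity : (0 : ℝ) ≤ Real.pi * a.2)
  unfold latSize at *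
  linarith

/-- Dominance of a quadratic form by the standard one. -/
def FormBound (δ A B C : ℝ) : Prop :=
  ∀ x y : ℝ, δ * (x ^ 2 + y ^ 2) ≤ A * x ^ 2 + B * (x * y) + C * y ^ 2

lemma latForm_re_le {δ : ℝ} {A B C σ : ℂ} (h : FormBound δ A.re B.re C.re) {a : (ℤ × ℤ) × ℝ}
    (ha : a.1 ≠ 0 ∧ 1 < a.2) {M : ℕ} (hM : σ.re ≤ M) :
    Real.exp ((latForm a (A, B, C, σ)).re) ≤
      Real.exp (-(Real.pi * δ * latSize a)) * latSize a ^ M := by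
  have hs := one_le_latSize ha
  have ht : 0 < a.2 := zero_lt_one.trans ha.2
  have h1 : (latForm a (A, B, C, σ)).re = -(Real.pi * a.2 * (A.re * (a.1.1 : ℝ) ^ 2 +
      B.re * ((a.1.1 : ℝ) * a.1.2) + C.re * (a.1.2 : ℝ) ^ 2)) + Real.log a.2 * σ.re := by
    rw [latForm_apply]
    have : (Real.pi * a.2 * ((a.1.1 : ℂ) ^ 2 * A + (a.1.1 : ℂ) * a.1.2 * B +
      (a.1.2 : ℂ) ^ 2 * C)) = ((Real.pi * a.2 * (a.1.1 : ℝ) ^ 2 : ℝ) : ℂ) * A +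
        ((Real.pi * a.2 * ((a.1.1 : ℝ) * a.1.2) : ℝ) : ℂ) * B +
        ((Real.pi * a.2 * (a.1.2 : ℝ) ^ 2 : ℝ) : ℂ) * C := by push_cast; ring
    rw [this, add_re, neg_re, add_re, add_re, re_ofReal_mul, re_ofReal_mul, re_ofReal_mul,
      re_ofReal_mul]
    ring
  rw [h1, Real.exp_add]
  refine mul_le_mul (Real.exp_le_exp.2 ?_) ?_ (Real.exp_nonneg _) (Real.exp_nonneg _)
  · have := mul_le_mul_of_nonneg_left (h a.1.1 a.1.2)
      (by positivity : (0 : ℝ) ≤ Real.pi * a.2)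
    unfold latSize nrmSq
    linarith
  · rw [← Real.rpow_def_of_pos ht]
    calc a.2 ^ σ.re ≤ a.2 ^ (M : ℝ) := Real.rpow_le_rpow_of_exponent_le ha.2.le hM
      _ = a.2 ^ M := Real.rpow_natCast _ _
      _ ≤ _ := by
        gcongr
        unfold latSize
        nlinarith [one_le_nrmSq ha.1]

/-- The Gaussian decay `exp (-π δ t |v|²)` is split in two halves. One pays for the margin `ε ‖l
a‖`, which is at most linear in `t |v|²`; the other beats all polynomial weights and leaves the
integrable `(t |v|²)⁻²`. -/
lemma expAdm_lat {δ : ℝ} (hδ : 0 < δ) {A B C : ℂ} (σ : ℂ) (h : FormBound δ A.re B.re C.re)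
    {f : (ℤ × ℤ) × ℝ → ℂ} (hf : AEStronglyMeasurable f latMeas) {N : ℕ}
    (hN : ∀ a, a.1 ≠ 0 ∧ 1 < a.2 → ‖f a‖ ≤ latSize a ^ N) :
    ExpAdm latMeas latForm f (A, B, C, σ) := by
  set K : ℝ := 3 * Real.pi + 1
  have hK : 0 < K := by positivity
  obtain ⟨M, hM⟩ := exists_nat_ge σ.re
  set c : ℝ := Real.pi * δ / 2
  have hc : 0 < c := by positivity
  refine ⟨measurable_latForm, hf, c / K, by positivity,
    (integrable_latSize.const_mul ((M + N + 2).factorial / c ^ (M + N + 2))).mono' ?_ ?_⟩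
  · refine (Real.continuous_exp.comp_aestronglyMeasurable ?_).mul hf.norm
    exact (continuous_re.comp_aestronglyMeasurable
      (measurable_latForm.apply_continuousLinearMap _)).add
      (measurable_latForm.norm.const_mul _)
  · filter_upwards [ae_latMeas] with a ha
    have hs := one_le_latSize ha
    have hs0 : 0 < latSize a := by linarith
    rw [Real.norm_of_nonneg (by positivity), Real.exp_add]
    have h1 : c / K * ‖latForm a‖ ≤ c * latSize a := by
      calc c / K * ‖latForm a‖ ≤ c / K * (K * latSize a) := by
            gcongr; exact norm_latForm_le ha
        _ = _ := by field_simp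
    calc Real.exp ((latForm a (A, B, C, σ)).re) * Real.exp (c / K * ‖latForm a‖) * ‖f a‖
        ≤ (Real.exp (-(Real.pi * δ * latSize a)) * latSize a ^ M) * Real.exp (c * latSize a) *
          latSize a ^ N := by
          gcongr
          exacts [latForm_re_le h ha hM, hN a ha]
      _ = Real.exp (-(c * latSize a)) * latSize a ^ (M + N) := by
          rw [show -(Real.pi * δ * latSize a) = -(c * latSize a) + -(c * latSize a) by ring,
            Real.exp_add, Real.exp_neg (c * latSize a), pow_add]
          field_simp
      _ ≤ ((M + N + 2).factorial / c ^ (M + N + 2) * (latSize a ^ (M + N + 2))⁻¹) *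
          latSize a ^ (M + N) := by
          gcongr
          exact exp_neg_le_div_pow hc hs0 _
      _ = _ := by
          rw [pow_add (latSize a)]
          field_simp

lemma integral_latMeas {g : (ℤ × ℤ) × ℝ → ℂ} (hg : Integrable g latMeas) :
    ∫ a, g a ∂latMeas = ∑' v : ℤ × ℤ, if v = 0 then 0 else ∫ t in Ioi 1, g (v, t) := by
  unfold latMeas at *
  rw [integral_prod _ hg, integral_countable hg.integral_prod_left]
  congr 1
  ext v
  rw [measureReal_def, Measure.restrict_apply (MeasurableSet.singleton v)]
  split_ifs with hv
  · simp [hv]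
  · rw [show ({v} ∩ {0}ᶜ : Set (ℤ × ℤ)) = {v} by ext; simp; rintro rfl; exact hv]
    simp

/-- Together with `integral_latMeas` this gives both orders of Fubini: one yields a lattice sum of
incomplete Gamma functions, the other the integral of a theta series. -/
lemma integral_latMeas' {g : (ℤ × ℤ) × ℝ → ℂ} (hg : Integrable g latMeas) :
    ∫ a, g a ∂latMeas = ∫ t in Ioi 1, ∑' v : ℤ × ℤ, if v = 0 then 0 else g (v, t) := by
  unfold latMeas at *
  rw [integral_prod_symm _ hg]
  refine integral_congr_ae ?_
  filter_upwards [hg.prod_left_ae] with t ht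
  rw [integral_countable ht]
  congr 1
  ext v
  rw [measureReal_def, Measure.restrict_apply (MeasurableSet.singleton v)]
  split_ifs with hv
  · simp [hv]
  · rw [show ({v} ∩ {0}ᶜ : Set (ℤ × ℤ)) = {v} by ext; simp; rintro rfl; exact hv]
    simp

lemma integrableOn_latMeas {g : (ℤ × ℤ) × ℝ → ℂ} (hg : Integrable g latMeas) :
    IntegrableOn (fun t => ∑' v : ℤ × ℤ, if v = 0 then 0 else g (v, t)) (Ioi 1) := by
  unfold latMeas at *
  refine hg.integral_prod_right.congr ?_
  filter_upwards [hg.prod_left_ae] with t ht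
  rw [integral_countable ht]
  congr 1
  ext v
  rw [measureReal_def, Measure.restrict_apply (MeasurableSet.singleton v)]
  split_ifs with hv
  · simp [hv]
  · rw [show ({v} ∩ {0}ᶜ : Set (ℤ × ℤ)) = {v} by ext; simp; rintro rfl; exact hv]
    simp
end LatticeMeasure

/-! ### Theta series of complex binary quadratic forms and their inversion -/

section Theta
open MeasureTheory Filter Topology Set

lemma summable_nrmSq_pow_mul_exp {c : ℝ} (hc : 0 < c) (N : ℕ) :
    Summable fun v : ℤ × ℤ => nrmSq v ^ N * Real.exp (-(c * nrmSq v)) := by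
  have h := ((summable_nrmSq_rpow (σ := 2) (by norm_num)).mul_left
    ((N + 2).factorial / c ^ (N + 2) : ℝ)).add
      (hasSum_ite_eq (0 : ℤ × ℤ) (nrmSq 0 ^ N * Real.exp (-(c * nrmSq 0)))).summable
  refine h.of_nonneg_of_le (fun v => mul_nonneg (pow_nonneg (nrmSq_nonneg v) _)
    (Real.exp_nonneg _)) (fun v => ?_)
  by_cases hv : v = 0
  · simp [hv]
  · have h0 : 0 < nrmSq v := zero_lt_one.trans_le (one_le_nrmSq hv)
    rw [if_neg hv, if_neg hv, add_zero, Real.rpow_neg h0.le]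
    calc nrmSq v ^ N * Real.exp (-(c * nrmSq v))
        ≤ nrmSq v ^ N * ((N + 2).factorial / c ^ (N + 2) * (nrmSq v ^ (N + 2))⁻¹) := by
          gcongr
          exact exp_neg_le_div_pow hc h0 _
      _ = _ := by
          rw [pow_add (nrmSq v)]
          field_simp
          norm_cast

lemma FormBound.right_pos {δ A B C : ℝ} (h : FormBound δ A B C) (hδ : 0 < δ) : 0 < C := by
  have := h 0 1
  linarith

lemma FormBound.disc_pos {δ A B C : ℝ} (h : FormBound δ A B C) (hδ : 0 < δ) :
    0 < 4 * A * C - B ^ 2 := by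
  have hC := h.right_pos hδ
  have h1 := h (2 * C) (-B)
  have h2 : 0 < C * (4 * A * C - B ^ 2) := by
    have : 0 < δ * ((2 * C) ^ 2 + (-B) ^ 2) := by positivity
    nlinarith
  exact pos_of_mul_pos_right h2 hC.le

/-- The constant is determinant over trace of the symmetric matrix of the form, which never exceeds
its smaller eigenvalue. -/
lemma formBound_of_disc {A B C : ℝ} (hC : 0 < C) (h : 0 < 4 * A * C - B ^ 2) :
    0 < A ∧ FormBound ((4 * A * C - B ^ 2) / (4 * (A + C))) A B C := by
  have hA : 0 < A := by
    have : 0 < A * C := by nlinarith [sq_nonneg B]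
    exact pos_of_mul_pos_left this hC.le
  refine ⟨hA, fun x y => ?_⟩
  set δ := (4 * A * C - B ^ 2) / (4 * (A + C)) with hδ
  have h1 : δ * (4 * (A + C)) = 4 * A * C - B ^ 2 := by rw [hδ]; field_simp
  have h2 : 0 < A - δ := by
    have : 0 < (A - δ) * (4 * (A + C)) := by nlinarith [sq_nonneg B]
    exact pos_of_mul_pos_left this (by positivity)
  have h3 : 0 ≤ 4 * (A - δ) * ((A - δ) * x ^ 2 + B * (x * y) + (C - δ) * y ^ 2) := by
    have : 4 * (A - δ) * ((A - δ) * x ^ 2 + B * (x * y) + (C - δ) * y ^ 2) =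
      (2 * (A - δ) * x + B * y) ^ 2 + (2 * δ * y) ^ 2 := by linear_combination (-y ^ 2) * h1
    rw [this]; positivity
  have h4 := nonneg_of_mul_nonneg_right h3 (by positivity)
  linarith

lemma exists_formBound {A B C : ℝ} (hC : 0 < C) (h : 0 < 4 * A * C - B ^ 2) :
    ∃ δ > 0, FormBound δ A B C := by
  obtain ⟨hA, hb⟩ := formBound_of_disc hC h
  exact ⟨_, by positivity, hb⟩

lemma FormBound.symm {δ A B C : ℝ} (h : FormBound δ A B C) : FormBound δ C B A := fun x y => by
  have := h y x
  linarith

/-- The complex binary quadratic form `A m² + B m n + C n²`. -/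
def qform (A B C : ℂ) (v : ℤ × ℤ) : ℂ := (v.1 : ℂ) ^ 2 * A + (v.1 : ℂ) * v.2 * B + (v.2 : ℂ) ^ 2 * C

/-- The theta series of a complex binary quadratic form. -/
def thetaForm (A B C : ℂ) : ℂ := ∑' v : ℤ × ℤ, cexp (-(Real.pi * qform A B C v))

lemma qform_re (A B C : ℂ) (v : ℤ × ℤ) : (qform A B C v).re =
    A.re * (v.1 : ℝ) ^ 2 + B.re * ((v.1 : ℝ) * v.2) + C.re * (v.2 : ℝ) ^ 2 := by
  have : qform A B C v = (((v.1 : ℝ) ^ 2 : ℝ) : ℂ) * A + (((v.1 : ℝ) * v.2 : ℝ) : ℂ) * B +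
      (((v.2 : ℝ) ^ 2 : ℝ) : ℂ) * C := by unfold qform; push_cast; ring
  rw [this, add_re, add_re, re_ofReal_mul, re_ofReal_mul, re_ofReal_mul]
  ring

lemma norm_exp_qform_le {δ : ℝ} {A B C : ℂ} (h : FormBound δ A.re B.re C.re) {t : ℝ} (ht : 0 < t)
    (v : ℤ × ℤ) : ‖cexp (-(Real.pi * t * qform A B C v))‖ ≤
      Real.exp (-(Real.pi * t * δ * nrmSq v)) := by
  rw [norm_exp]
  refine Real.exp_le_exp.2 ?_
  have h1 := mul_le_mul_of_nonneg_left (h v.1 v.2) (by positivity : (0 : ℝ) ≤ Real.pi * t)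
  rw [← ofReal_mul, neg_re, re_ofReal_mul, qform_re]
  unfold nrmSq
  linarith

lemma summable_exp_qform {δ : ℝ} (hδ : 0 < δ) {A B C : ℂ} (h : FormBound δ A.re B.re C.re) :
    Summable fun v : ℤ × ℤ => cexp (-(Real.pi * qform A B C v)) := by
  refine Summable.of_norm_bounded
    (summable_nrmSq_pow_mul_exp (by positivity : 0 < Real.pi * δ) 0) fun v => ?_
  have := norm_exp_qform_le h zero_lt_one v
  simpa using this

lemma thetaForm_swap (A B C : ℂ) : thetaForm A B C = thetaForm C B A := by
  unfold thetaForm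
  rw [← (Equiv.prodComm ℤ ℤ).tsum_eq]
  congr 1; ext v
  simp only [Equiv.prodComm_apply, qform, Prod.fst_swap, Prod.snd_swap]
  congr 3
  ring

lemma thetaForm_neg (A B C : ℂ) : thetaForm A (-B) C = thetaForm A B C := by
  unfold thetaForm
  rw [← ((Equiv.refl ℤ).prodCongr (Equiv.neg ℤ)).tsum_eq]
  congr 1; ext v
  simp only [Equiv.prodCongr_apply, Equiv.coe_refl, Prod.map, qform, id, Equiv.neg_apply]
  push_cast
  congr 3
  ring

/-- Poisson summation in the second variable. -/
lemma thetaForm_partial {δ : ℝ} (hδ : 0 < δ) {A B C : ℂ} (h : FormBound δ A.re B.re C.re)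
    {δ' : ℝ} (hδ' : 0 < δ')
    (h' : FormBound δ' (A - B ^ 2 / (4 * C)).re (-Complex.I * B / C).re (1 / C).re) :
    thetaForm A B C = 1 / C ^ (1 / 2 : ℂ) * thetaForm (A - B ^ 2 / (4 * C)) (-Complex.I * B / C) (1 / C) := by
  have hC := h.right_pos hδ
  have hC0 : C ≠ 0 := fun h => by simp [h] at hC
  have hC' := h'.right_pos hδ'
  unfold thetaForm
  rw [(summable_exp_qform hδ h).tsum_prod, (summable_exp_qform hδ' h').tsum_prod, ← tsum_mul_left]
  congr 1; ext m
  have hτ : 0 < (Complex.I * C).im := by simpa using hC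
  -- For fixed `m` the sum over `n` is a Jacobi theta function with `τ = iC` and elliptic variable
  -- `i m B / 2`.
  have h1 (n : ℤ) : cexp (-(Real.pi * qform A B C (m, n))) = cexp (-(Real.pi * m ^ 2 * A)) *
      jacobiTheta₂_term n (Complex.I * m * B / 2) (Complex.I * C) := by
    rw [jacobiTheta₂_term, ← Complex.exp_add]
    congr 1
    simp only [qform]
    linear_combination (-(Real.pi * m * n * B + Real.pi * n ^ 2 * C) : ℂ) * Complex.I_sq
  have hmI : -Complex.I * (Complex.I * C) = C := by linear_combination (-C) * Complex.I_sq
  have h2 (n : ℤ) : cexp (-(Real.pi * qform (A - B ^ 2 / (4 * C)) (-Complex.I * B / C) (1 / C) (m, n))) =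
      cexp (-(Real.pi * m ^ 2 * (A - B ^ 2 / (4 * C)))) *
      jacobiTheta₂_term n ((Complex.I * m * B / 2) / (Complex.I * C)) (-1 / (Complex.I * C)) := by
    rw [jacobiTheta₂_term, ← Complex.exp_add]
    congr 1
    have : -1 / (Complex.I * C) = Complex.I / C := by field_simp; linear_combination -Complex.I_sq
    rw [this]
    simp only [qform]
    field_simp
    linear_combination (-4 * (n : ℂ) ^ 2) * Complex.I_sq
  simp_rw [h1, h2, tsum_mul_left]
  change _ * jacobiTheta₂ _ _ = _ * (_ * jacobiTheta₂ _ _)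
  rw [jacobiTheta₂_functional_equation, hmI]
  have h3 : cexp (-(Real.pi * m ^ 2 * (A - B ^ 2 / (4 * C)))) = cexp (-(Real.pi * m ^ 2 * A)) *
      cexp (-Real.pi * Complex.I * (Complex.I * m * B / 2) ^ 2 / (Complex.I * C)) := by
    rw [← Complex.exp_add]
    congr 1
    field_simp
    linear_combination 4 * (m : ℂ) ^ 2 * B ^ 2 * Complex.I_sq
  rw [h3]
  ring

/-- The form produced by one partial Poisson summation has complex coefficients even when the
original is real, so positivity of its real part needs a proof. By the discriminant condition, the
discriminant of the new real part is that of the old one divided by `|C|²`. -/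
lemma formBound_partial {δ : ℝ} (hδ : 0 < δ) {A B C : ℂ} (h : FormBound δ A.re B.re C.re)
    (hd : 4 * A * C - B ^ 2 = 4) {t : ℝ} (ht : 0 < t) :
    ∃ δ' > 0, FormBound δ' ((t : ℂ) / C).re (-Complex.I * B / C).re (1 / (t * C)).re := by
  have hC := h.right_pos hδ
  have hC0 : C ≠ 0 := fun h => by simp [h] at hC
  have hdisc := h.disc_pos hδ
  have hN : 0 < C.re * C.re + C.im * C.im := by nlinarith [sq_nonneg C.im]
  have e1 : ((t : ℂ) / C).re = t * (C.re / normSq C) := by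
    rw [div_eq_mul_inv, re_ofReal_mul, inv_re]
  have e2 : (1 / (t * C)).re = t⁻¹ * (C.re / normSq C) := by
    rw [one_div, mul_inv, ← ofReal_inv, re_ofReal_mul, inv_re]
  have e3 : (-Complex.I * B / C).re = (B.im * C.re - B.re * C.im) / normSq C := by
    rw [div_re]; simp; ring
  have hA : A.re * normSq C = C.re + ((B.re ^ 2 - B.im ^ 2) * C.re + 2 * B.re * B.im * C.im) / 4 := by
    have h1 := congrArg Complex.re hd
    have h2 := congrArg Complex.im hd
    simp [sq] at h1 h2
    rw [normSq_apply]
    linear_combination (C.re / 4) * h1 + (C.im / 4) * h2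
  have hkey : 0 < 4 * C.re ^ 2 - (B.im * C.re - B.re * C.im) ^ 2 := by
    have h3 : (4 * A.re * C.re - B.re ^ 2) * normSq C =
      4 * C.re ^ 2 - (B.im * C.re - B.re * C.im) ^ 2 := by
      rw [sub_mul, show 4 * A.re * C.re * normSq C = 4 * C.re * (A.re * normSq C) by ring, hA,
        normSq_apply]
      ring
    rw [← h3]
    exact mul_pos hdisc (normSq_pos.2 hC0)
  have hNp := normSq_pos.2 hC0
  refine exists_formBound (by rw [e2]; positivity) ?_
  rw [e1, e2, e3]
  have : 4 * (t * (C.re / normSq C)) * (t⁻¹ * (C.re / normSq C)) -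
      ((B.im * C.re - B.re * C.im) / normSq C) ^ 2 =
      (4 * C.re ^ 2 - (B.im * C.re - B.re * C.im) ^ 2) / normSq C ^ 2 := by
    field_simp
  rw [this]
  positivity

lemma FormBound.smul {δ A B C t : ℝ} (h : FormBound δ A B C) (ht : 0 < t) :
    FormBound (t * δ) (t * A) (t * B) (t * C) := fun x y => by
  have := mul_le_mul_of_nonneg_left (h x y) ht.le
  linarith

lemma FormBound.neg {δ A B C : ℝ} (h : FormBound δ A B C) : FormBound δ A (-B) C := fun x y => by
  have := h x (-y)
  linarith

/-- The transformation formula of the theta series of a form of discriminant `-4`. -/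
lemma thetaForm_inv {δ : ℝ} (hδ : 0 < δ) {A B C : ℂ} (h : FormBound δ A.re B.re C.re)
    (hd : 4 * A * C - B ^ 2 = 4) {t : ℝ} (ht : 0 < t) :
    thetaForm ((t⁻¹ : ℝ) * A) ((t⁻¹ : ℝ) * B) ((t⁻¹ : ℝ) * C) =
      t * thetaForm (t * A) (t * B) (t * C) := by
  have hC := h.right_pos hδ
  have hC0 : C ≠ 0 := fun h => by simp [h] at hC
  have ht0 : (t : ℂ) ≠ 0 := by exact_mod_cast ht.ne'
  have hti : 0 < t⁻¹ := inv_pos.2 ht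
  obtain ⟨δ', hδ', h'⟩ := formBound_partial hδ h hd ht
  -- Poisson summation is applied in one variable, the variables are swapped, and it is applied
  -- again. The discriminant `-4` makes the outcome the original form with `t` replaced by `t⁻¹`, up
  -- to the sign of `B`.
  have e1 : (t : ℂ) * A - (t * B) ^ 2 / (4 * (t * C)) = t / C := by
    field_simp
    linear_combination hd
  have e2 : -Complex.I * (t * B) / (t * C) = -Complex.I * B / C := by field_simp
  have f1 : FormBound (t * δ) ((t : ℂ) * A).re ((t : ℂ) * B).re ((t : ℂ) * C).re := by
    simp_rw [re_ofReal_mul]; exact h.smul ht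
  have s1 := thetaForm_partial (mul_pos ht hδ) f1 hδ' (by rw [e1, e2]; exact h')
  rw [e1, e2, thetaForm_swap (t / C)] at s1
  have e3 : 1 / (t * C) - (-Complex.I * B / C) ^ 2 / (4 * (t / C)) = (t⁻¹ : ℝ) * A := by
    push_cast
    field_simp
    linear_combination -hd + (- B ^ 2) * Complex.I_sq
  have e4 : -Complex.I * (-Complex.I * B / C) / (t / C) = -((t⁻¹ : ℝ) * B) := by
    push_cast
    field_simp
    linear_combination B * Complex.I_sq
  have e5 : 1 / (t / C) = (t⁻¹ : ℝ) * C := by push_cast; field_simp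
  have f2 : FormBound (t⁻¹ * δ) (((t⁻¹ : ℝ) : ℂ) * A).re (-(((t⁻¹ : ℝ) : ℂ) * B)).re
      (((t⁻¹ : ℝ) : ℂ) * C).re := by
    rw [neg_re]
    simp_rw [re_ofReal_mul]; exact (h.smul hti).neg
  have s2 := thetaForm_partial hδ' h'.symm (mul_pos hti hδ) (by rw [e3, e4, e5]; exact f2)
  rw [e3, e4, e5, thetaForm_neg] at s2
  rw [s1, s2]
  -- The two square roots multiply without a sign because `Re C > 0` keeps `log C⁻¹ = -log C` on the
  -- principal branch.
  have e6 : ((t : ℂ) * C) ^ (1 / 2 : ℂ) * ((t : ℂ) / C) ^ (1 / 2 : ℂ) = t := by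
    have hx : |arg C| < Real.pi / 2 := abs_arg_lt_pi_div_two_iff.2 (Or.inl hC)
    have harg : arg C ≠ Real.pi := by
      intro h; rw [h, abs_of_pos Real.pi_pos] at hx; linarith [Real.pi_pos]
    have hCi : C⁻¹ ≠ 0 := inv_ne_zero hC0
    rw [cpow_def_of_ne_zero (mul_ne_zero ht0 hC0), cpow_def_of_ne_zero (div_ne_zero ht0 hC0),
      div_eq_mul_inv (t : ℂ) C, log_ofReal_mul ht hC0, log_ofReal_mul ht hCi, log_inv _ harg,
      ← Complex.exp_add]
    have : (((Real.log t : ℝ) : ℂ) + log C) * (1 / 2) +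
      (((Real.log t : ℝ) : ℂ) + -log C) * (1 / 2) = (Real.log t : ℝ) := by ring
    rw [this, ← ofReal_exp, Real.exp_log ht]
  have h7 : ((t : ℂ) * C) ^ (1 / 2 : ℂ) ≠ 0 := left_ne_zero_of_mul (e6 ▸ ht0)
  have h8 : ((t : ℂ) / C) ^ (1 / 2 : ℂ) ≠ 0 := right_ne_zero_of_mul (e6 ▸ ht0)
  rw [eq_comm, ← mul_assoc, ← mul_assoc]
  refine (congrArg (· * _) ?_).trans (one_mul _)
  rw [mul_one_div, mul_one_div, div_div, e6, div_self ht0]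

lemma norm_qform_le (A B C : ℂ) (v : ℤ × ℤ) :
    ‖qform A B C v‖ ≤ (‖A‖ + ‖B‖ + ‖C‖) * nrmSq v := by
  have e1 : ‖(v.1 : ℂ) ^ 2 * A‖ ≤ nrmSq v * ‖A‖ := by
    rw [norm_mul, norm_pow, norm_intCast, sq_abs]
    gcongr
    unfold nrmSq; nlinarith [sq_nonneg (v.2 : ℝ)]
  have e2 : ‖(v.1 : ℂ) * v.2 * B‖ ≤ nrmSq v * ‖B‖ := by
    rw [norm_mul, norm_mul, norm_intCast, norm_intCast]
    gcongr
    unfold nrmSq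
    nlinarith [sq_abs (v.1 : ℝ), sq_abs (v.2 : ℝ), sq_nonneg (|(v.1 : ℝ)| - |(v.2 : ℝ)|),
      abs_nonneg (v.1 : ℝ), abs_nonneg (v.2 : ℝ)]
  have e3 : ‖(v.2 : ℂ) ^ 2 * C‖ ≤ nrmSq v * ‖C‖ := by
    rw [norm_mul, norm_pow, norm_intCast, sq_abs]
    gcongr
    unfold nrmSq; nlinarith [sq_nonneg (v.1 : ℝ)]
  have e6 := (norm_add₃_le (a := (v.1 : ℂ) ^ 2 * A) (b := (v.1 : ℂ) * v.2 * B)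
    (c := (v.2 : ℂ) ^ 2 * C)).trans (add_le_add (add_le_add e1 e2) e3)
  unfold qform
  linarith

/-- Weighting a theta series with the powers of a second quadratic form. -/
lemma iteratedDeriv_thetaForm {δ : ℝ} (hδ : 0 < δ) {A B C : ℂ} (h : FormBound δ A.re B.re C.re)
    (A' B' C' : ℂ) {t : ℝ} (ht : 0 < t) (n : ℕ) :
    iteratedDeriv n (fun x => thetaForm (t * (A + x * A')) (t * (B + x * B')) (t * (C + x * C'))) 0
      = (-(Real.pi * t)) ^ n *
        ∑' v, qform A' B' C' v ^ n * cexp (-(Real.pi * t * qform A B C v)) := by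
  set c : ℤ × ℤ → ℂ := fun v => -(Real.pi * t * qform A' B' C' v) with hc
  set f : ℤ × ℤ → ℂ := fun v => cexp (-(Real.pi * t * qform A B C v)) with hf
  set K : ℝ := Real.pi * t * (‖A'‖ + ‖B'‖ + ‖C'‖) + 1 with hK
  have hK0 : 0 < K := by positivity
  have hcK (v : ℤ × ℤ) : ‖c v‖ ≤ K * nrmSq v := by
    have h1 := norm_qform_le A' B' C' v
    have h2 := nrmSq_nonneg v
    rw [hc, norm_neg, norm_mul, ← ofReal_mul, norm_real, Real.norm_of_nonneg (by positivity)]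
    calc _ ≤ Real.pi * t * ((‖A'‖ + ‖B'‖ + ‖C'‖) * nrmSq v) := by gcongr
      _ ≤ _ := by rw [hK]; nlinarith
  -- With this radius the displacement `x` and the admissibility margin each cost a quarter of the
  -- Gaussian rate `π t δ`, leaving half of it.
  set r : ℝ := Real.pi * t * δ / 4 / K with hr
  have hr0 : 0 < r := by positivity
  have hrK : r * K = Real.pi * t * δ / 4 := by rw [hr]; field_simp
  have hadm : ∀ n : ℕ, ∀ x ∈ Metric.ball (0 : ℂ) r, ExpAdm Measure.count
      (fun v => c v • ContinuousLinearMap.id ℂ ℂ) (fun v => c v ^ n * f v) x := by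
    intro n x hx
    rw [mem_ball_zero_iff] at hx
    refine ⟨(measurable_of_countable _).aestronglyMeasurable.smul_const _,
      (measurable_of_countable _).aestronglyMeasurable, r, hr0, ?_⟩
    rw [integrable_count_iff]
    refine Summable.of_norm_bounded ((summable_nrmSq_pow_mul_exp
      (by positivity : 0 < Real.pi * t * δ / 2) n).mul_left (K ^ n)) fun v => ?_
    have hn := nrmSq_nonneg v
    rw [norm_norm, Real.norm_of_nonneg (by positivity), norm_mul, norm_pow]
    have e1 : ‖c v • ContinuousLinearMap.id ℂ ℂ‖ ≤ K * nrmSq v := by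
      rw [norm_smul, ContinuousLinearMap.norm_id, mul_one]; exact hcK v
    have e2 : ((c v • ContinuousLinearMap.id ℂ ℂ) x).re ≤ r * (K * nrmSq v) := by
      refine (re_le_norm _).trans ?_
      simp only [_root_.smul_apply, ContinuousLinearMap.id_apply, norm_smul]
      rw [mul_comm]
      exact mul_le_mul hx.le (hcK v) (norm_nonneg _) hr0.le
    calc Real.exp (((c v • ContinuousLinearMap.id ℂ ℂ) x).re +
          r * ‖c v • ContinuousLinearMap.id ℂ ℂ‖) * (‖c v‖ ^ n * ‖f v‖)
        ≤ Real.exp (r * (K * nrmSq v) + r * (K * nrmSq v)) * ((K * nrmSq v) ^ n *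
          Real.exp (-(Real.pi * t * δ * nrmSq v))) := by
          gcongr
          exacts [hcK v, norm_exp_qform_le h ht v]
      _ = K ^ n * (nrmSq v ^ n * (Real.exp (r * (K * nrmSq v) + r * (K * nrmSq v)) *
          Real.exp (-(Real.pi * t * δ * nrmSq v)))) := by rw [mul_pow]; ring
      _ = _ := by
          rw [← Real.exp_add]
          congr 3
          linear_combination 2 * nrmSq v * hrK
  have h1 := iteratedDeriv_expIntegral (μ := Measure.count) Metric.isOpen_ball hadm n 0
    (Metric.mem_ball_self hr0)
  have h2 : (fun x => thetaForm (t * (A + x * A')) (t * (B + x * B')) (t * (C + x * C'))) =ᶠ[𝓝 0]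
      fun x => ∫ v, cexp (c v * x) * f v ∂Measure.count := by
    filter_upwards [Metric.ball_mem_nhds (0 : ℂ) hr0] with x hx
    have hi := (hadm 0 x hx).integrable
    rw [integral_countable (by simpa using hi)]
    unfold thetaForm
    refine tsum_congr fun v => ?_
    simp only [hc, hf, measureReal_def, Measure.count_singleton, ENNReal.toReal_one, one_smul]
    rw [← Complex.exp_add]
    congr 1
    unfold qform
    ring
  rw [h2.iteratedDeriv_eq, h1]
  have hi := (hadm n 0 (Metric.mem_ball_self hr0)).integrable
  rw [integral_countable (by simpa using hi), ← tsum_mul_left]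
  refine tsum_congr fun v => ?_
  simp only [hc, hf, measureReal_def, Measure.count_singleton, ENNReal.toReal_one, one_smul,
    mul_zero, Complex.exp_zero, one_mul]
  rw [show -(Real.pi * t * qform A' B' C' v) = -(Real.pi * t) * qform A' B' C' v by ring, mul_pow]
  ring

/-- The transformation formula of a theta series with harmonic coefficients. -/
lemma tsum_qform_pow_inv {δ : ℝ} (hδ : 0 < δ) {A B C A' B' C' : ℂ}
    (h : FormBound δ A.re B.re C.re)
    (hd : ∀ x : ℂ, 4 * (A + x * A') * (C + x * C') - (B + x * B') ^ 2 = 4) {t : ℝ} (ht : 0 < t)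
    (n : ℕ) :
    ∑' v, qform A' B' C' v ^ n * cexp (-(Real.pi * (t⁻¹ : ℝ) * qform A B C v)) =
      t ^ (1 + 2 * n) * ∑' v, qform A' B' C' v ^ n * cexp (-(Real.pi * t * qform A B C v)) := by
  have hti : 0 < t⁻¹ := inv_pos.2 ht
  have ht0 : (t : ℂ) ≠ 0 := by exact_mod_cast ht.ne'
  have h1 := iteratedDeriv_thetaForm hδ h A' B' C' ht n
  have h2 := iteratedDeriv_thetaForm hδ h A' B' C' hti n
  set K : ℝ := ‖A'‖ + ‖B'‖ + ‖C'‖ + 1 with hK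
  have hK0 : 0 < K := by positivity
  have h3 : (fun x : ℂ => thetaForm ((t⁻¹ : ℝ) * (A + x * A')) ((t⁻¹ : ℝ) * (B + x * B'))
      ((t⁻¹ : ℝ) * (C + x * C'))) =ᶠ[𝓝 0] fun x =>
      t * thetaForm (t * (A + x * A')) (t * (B + x * B')) (t * (C + x * C')) := by
    -- Perturbing by such small `x` costs at most half of `δ`, so inversion applies to the whole
    -- family of forms and both sides can be differentiated at `x = 0`.
    filter_upwards [Metric.ball_mem_nhds (0 : ℂ) (by positivity : 0 < δ / (2 * K))] with x hx
    rw [mem_ball_zero_iff, lt_div_iff₀ (by positivity)] at hx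
    refine thetaForm_inv (half_pos hδ) (fun a b => ?_) (hd x) ht
    have e := h a b
    have eA : -(‖x‖ * ‖A'‖) ≤ (x * A').re := by
      rw [← norm_mul]; exact (abs_le.1 (abs_re_le_norm _)).1
    have eB := abs_re_le_norm (x * B')
    have eC : -(‖x‖ * ‖C'‖) ≤ (x * C').re := by
      rw [← norm_mul]; exact (abs_le.1 (abs_re_le_norm _)).1
    rw [norm_mul] at eB
    have eab : |a * b| ≤ a ^ 2 + b ^ 2 := by
      rw [abs_le]; constructor <;> nlinarith [sq_nonneg (a + b), sq_nonneg (a - b)]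
    have eB' : -(‖x‖ * ‖B'‖ * (a ^ 2 + b ^ 2)) ≤ (x * B').re * (a * b) := by
      have := mul_le_mul eB eab (abs_nonneg _) (by positivity)
      rw [← abs_mul] at this
      exact (abs_le.1 this).1
    have eA' := mul_le_mul_of_nonneg_right eA (sq_nonneg a)
    have eC' := mul_le_mul_of_nonneg_right eC (sq_nonneg b)
    have hx' : ‖x‖ * K * (a ^ 2 + b ^ 2) ≤ δ / 2 * (a ^ 2 + b ^ 2) := by
      gcongr; linarith
    rw [hK] at hx'
    simp only [add_re]
    nlinarith [mul_nonneg (mul_nonneg (norm_nonneg x) (norm_nonneg A')) (sq_nonneg b),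
      mul_nonneg (mul_nonneg (norm_nonneg x) (norm_nonneg C')) (sq_nonneg a),
      mul_nonneg (norm_nonneg x) (sq_nonneg a), mul_nonneg (norm_nonneg x) (sq_nonneg b)]
  have h4 := h3.iteratedDeriv_eq n
  rw [h2, iteratedDeriv_const_mul_field, h1] at h4
  have hp : (Real.pi : ℂ) ≠ 0 := by exact_mod_cast Real.pi_ne_zero
  -- The `n`th derivatives carry the factors `(-π/t)^n` and `(-π t)^n`. Their quotient `t^(2n)`
  -- joins the `t` from the inversion formula.
  have h5 : (-(Real.pi * ((t⁻¹ : ℝ) : ℂ))) ^ n ≠ 0 := by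
    push_cast
    exact pow_ne_zero _ (neg_ne_zero.2 (mul_ne_zero hp (inv_ne_zero ht0)))
  refine mul_left_cancel₀ h5 (h4.trans ?_)
  rw [← mul_assoc, ← mul_assoc]
  congr 1
  rw [pow_add, pow_mul, pow_one, mul_left_comm, ← mul_pow]
  congr 2
  push_cast
  field_simp
end Theta

/-! ### Functions smooth in `(z, s)` and holomorphic in `s`; the Laplacian -/

section JointSmooth
open Filter Topology Set

/-- The open upper half plane as a subset of `ℂ`. -/
def halfPlane : Set ℂ := {w : ℂ | 0 < w.im}

lemma isOpen_halfPlane : IsOpen halfPlane := isOpen_lt continuous_const continuous_im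

/-- Directional derivative. -/
def dirD {E : Type} [NormedAddCommGroup E] [NormedSpace ℝ E] (u : E) (F : E → ℂ) (p : E) : ℂ :=
  fderiv ℝ F p u

section
variable {E : Type} [NormedAddCommGroup E] [NormedSpace ℝ E] {U : Set E} {F G : E → ℂ}

lemma ContDiffOn.dir (hU : IsOpen U) (hF : ContDiffOn ℝ ∞ F U) (u : E) :
    ContDiffOn ℝ ∞ (dirD u F) U :=
  (hF.fderiv_of_isOpen hU (m := ∞) (by simp)).clm_apply contDiffOn_const

lemma ContDiffOn.differentiableAt_of_isOpen (hU : IsOpen U) (hF : ContDiffOn ℝ ∞ F U) {p : E}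
    (hp : p ∈ U) : DifferentiableAt ℝ F p :=
  (hF.contDiffAt (hU.mem_nhds hp)).differentiableAt (by simp)

lemma dirD_comm (hU : IsOpen U) (hF : ContDiffOn ℝ ∞ F U) (u v : E) {p : E} (hp : p ∈ U) :
    dirD u (dirD v F) p = dirD v (dirD u F) p := by
  have hc := hF.contDiffAt (hU.mem_nhds hp)
  have h1 : DifferentiableAt ℝ (fderiv ℝ F) p :=
    ((hF.fderiv_of_isOpen hU (m := ∞) (by simp)).contDiffAt (hU.mem_nhds hp)).differentiableAt
      (by simp)
  have h2 (u v : E) : dirD u (dirD v F) p = fderiv ℝ (fderiv ℝ F) p u v := by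
    unfold dirD
    rw [fderiv_clm_apply h1 (differentiableAt_const _)]
    simp
  rw [h2, h2]
  exact hc.isSymmSndFDerivAt (by rw [minSmoothness_of_isRCLikeNormedField]; exact WithTop.coe_le_coe.2 (le_top : (2 : ℕ∞) ≤ ⊤)) u v

lemma dirD_congr (hU : IsOpen U) (h : EqOn F G U) (u : E) : EqOn (dirD u F) (dirD u G) U := by
  intro p hp
  unfold dirD
  rw [(h.eventuallyEq_of_mem (hU.mem_nhds hp)).fderiv_eq]

lemma dirD_const_mul (c : ℂ) (u p : E) : dirD u (fun q => c * F q) p = c * dirD u F p := by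
  unfold dirD
  have h := congrFun (fderiv_const_smul_field (𝕜 := ℝ) (f := F) c) p
  rw [show (fun q => c * F q) = c • F from rfl, h]
  rfl

end

/-- Smooth functions of `(z, s)` on the product of the upper half plane and `S` that satisfy the
Cauchy-Riemann equations in `s`. -/
structure SmoothHolo (S : Set ℂ) (F : ℂ × ℂ → ℂ) : Prop where
  smooth : ContDiffOn ℝ ∞ F (halfPlane ×ˢ S)
  cauchyRiemann : ∀ p ∈ halfPlane ×ˢ S, dirD (0, Complex.I) F p = Complex.I * dirD (0, 1) F p

variable {S : Set ℂ} {F G : ℂ × ℂ → ℂ}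

lemma dirD_slice {p : ℂ × ℂ} (h : DifferentiableAt ℝ F p) (u : ℂ) :
    dirD u (fun s => F (p.1, s)) p.2 = dirD (0, u) F p := by
  have h1 : HasFDerivAt (fun s : ℂ => (p.1, s)) (ContinuousLinearMap.inr ℝ ℂ ℂ) p.2 :=
    hasFDerivAt_prodMk_right _ _
  have h2 : HasFDerivAt F (fderiv ℝ F p) (p.1, p.2) := h.hasFDerivAt
  have h3 := h2.comp p.2 h1
  unfold dirD
  rw [show (fun s => F (p.1, s)) = F ∘ fun s => (p.1, s) from rfl, h3.fderiv]
  simp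

lemma dirD_slice_left {p : ℂ × ℂ} (h : DifferentiableAt ℝ F p) (u : ℂ) :
    dirD u (fun z => F (z, p.2)) p.1 = dirD (u, 0) F p := by
  have h1 : HasFDerivAt (fun z : ℂ => (z, p.2)) (ContinuousLinearMap.inl ℝ ℂ ℂ) p.1 :=
    hasFDerivAt_prodMk_left _ _
  have h2 : HasFDerivAt F (fderiv ℝ F p) (p.1, p.2) := h.hasFDerivAt
  have h3 := h2.comp p.1 h1
  unfold dirD
  rw [show (fun z => F (z, p.2)) = F ∘ fun z => (z, p.2) from rfl, h3.fderiv]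
  simp

namespace SmoothHolo

lemma differentiableAt (hS : IsOpen S) (h : SmoothHolo S F) {p : ℂ × ℂ}
    (hp : p ∈ halfPlane ×ˢ S) : DifferentiableAt ℝ F p :=
  h.smooth.differentiableAt_of_isOpen (isOpen_halfPlane.prod hS) hp

/-- Derivatives in all real directions commute, so the Cauchy-Riemann equations can themselves be
differentiated. This is what lets `z`-derivatives pass through Taylor coefficients in `s`. -/
lemma dir (hS : IsOpen S) (h : SmoothHolo S F) (u : ℂ × ℂ) : SmoothHolo S (dirD u F) := by
  have hU := isOpen_halfPlane.prod hS
  refine ⟨h.smooth.dir hU u, fun p hp => ?_⟩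
  rw [dirD_comm hU h.smooth _ _ hp, dirD_congr hU h.cauchyRiemann u hp, dirD_const_mul,
    dirD_comm hU h.smooth _ _ hp]

lemma hasDerivAt (hS : IsOpen S) (h : SmoothHolo S F) {z s : ℂ} (hz : z ∈ halfPlane)
    (hs : s ∈ S) : HasDerivAt (fun s => F (z, s)) (dirD (0, 1) F (z, s)) s := by
  have hd := h.differentiableAt hS (p := (z, s)) ⟨hz, hs⟩
  have h1 : HasFDerivAt (fun s : ℂ => (z, s)) (ContinuousLinearMap.inr ℝ ℂ ℂ) s :=
    hasFDerivAt_prodMk_right _ _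
  have h3 := hd.hasFDerivAt.comp s h1
  have h4 : ((fderiv ℝ F (z, s)).comp (ContinuousLinearMap.inr ℝ ℂ ℂ)) =
      (ContinuousLinearMap.toSpanSingleton ℂ
        (dirD (0, 1) F (z, s))).restrictScalars ℝ := by
    refine ContinuousLinearMap.ext fun w => ?_
    have hw : ((0, w) : ℂ × ℂ) = w.re • ((0, 1) : ℂ × ℂ) + w.im • ((0, Complex.I) : ℂ × ℂ) := by
      ext <;> simp
    have hcr := h.cauchyRiemann (z, s) ⟨hz, hs⟩
    unfold dirD at *
    simp only [ContinuousLinearMap.comp_apply, ContinuousLinearMap.inr_apply, hw, map_add,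
      map_smul, hcr, ContinuousLinearMap.coe_restrictScalars',
      ContinuousLinearMap.toSpanSingleton_apply, smul_eq_mul, real_smul]
    linear_combination (fderiv ℝ F (z, s)) (0, 1) * (Complex.re_add_im w)
  have h5 := hasFDerivAt_of_restrictScalars ℝ h3 h4.symm
  exact h5.hasDerivAt.congr_deriv (by simp)

lemma differentiableOn (hS : IsOpen S) (h : SmoothHolo S F) {z : ℂ} (hz : z ∈ halfPlane) :
    DifferentiableOn ℂ (fun s => F (z, s)) S :=
  fun _ hs => (h.hasDerivAt hS hz hs).differentiableAt.differentiableWithinAt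

lemma analyticAt (hS : IsOpen S) (h : SmoothHolo S F) {z s : ℂ} (hz : z ∈ halfPlane)
    (hs : s ∈ S) : AnalyticAt ℂ (fun s => F (z, s)) s :=
  (h.differentiableOn hS hz).analyticAt (hS.mem_nhds hs)

lemma of_differentiableOn (hS : IsOpen S) (h : ContDiffOn ℝ ∞ F (halfPlane ×ˢ S))
    (h' : ∀ z ∈ halfPlane, DifferentiableOn ℂ (fun s => F (z, s)) S) : SmoothHolo S F := by
  refine ⟨h, fun p hp => ?_⟩
  have hd := h.differentiableAt_of_isOpen (isOpen_halfPlane.prod hS) hp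
  have h1 := ((h' p.1 hp.1).differentiableAt (hS.mem_nhds hp.2)).fderiv_restrictScalars ℝ
  rw [← dirD_slice hd, ← dirD_slice hd]
  unfold dirD
  rw [h1]
  simp

lemma iterate_dirD (hS : IsOpen S) (h : SmoothHolo S F) (m : ℕ) :
    SmoothHolo S ((dirD (0, 1))^[m] F) := by
  induction m with
  | zero => exact h
  | succ m ih => rw [Function.iterate_succ_apply']; exact ih.dir hS _

lemma iteratedDeriv_eq (hS : IsOpen S) (h : SmoothHolo S F) {z : ℂ} (hz : z ∈ halfPlane) (m : ℕ) :
    ∀ s ∈ S, iteratedDeriv m (fun s => F (z, s)) s = (dirD (0, 1))^[m] F (z, s) := by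
  induction m with
  | zero => intro s _; simp
  | succ m ih =>
    intro s hs
    rw [iteratedDeriv_succ, Function.iterate_succ_apply',
      (eventuallyEq_of_mem (hS.mem_nhds hs) ih).deriv_eq]
    exact ((h.iterate_dirD hS m).hasDerivAt hS hz hs).deriv

lemma dirD_iterate_comm (hS : IsOpen S) (h : SmoothHolo S F) (u : ℂ × ℂ) (m : ℕ) :
    EqOn (dirD u ((dirD (0, 1))^[m] F)) ((dirD (0, 1))^[m] (dirD u F))
      (halfPlane ×ˢ S) := by
  have hU := isOpen_halfPlane.prod hS
  induction m with
  | zero => intro p _; rfl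
  | succ m ih =>
    intro p hp
    rw [Function.iterate_succ_apply', Function.iterate_succ_apply',
      dirD_comm hU (h.iterate_dirD hS m).smooth _ _ hp]
    exact dirD_congr hU ih _ hp

lemma contDiffOn_iteratedDeriv (hS : IsOpen S) (h : SmoothHolo S F) {s : ℂ} (hs : s ∈ S) (m : ℕ) :
    ContDiffOn ℝ ∞ (fun z => iteratedDeriv m (fun s => F (z, s)) s) halfPlane := by
  have h1 : ContDiffOn ℝ ∞ (fun z => (dirD (0, 1))^[m] F (z, s)) halfPlane :=
    (h.iterate_dirD hS m).smooth.comp (contDiff_prodMk_left s).contDiffOn fun z hz => ⟨hz, hs⟩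
  exact h1.congr fun z hz => h.iteratedDeriv_eq hS hz m s hs

lemma dirD_iteratedDeriv (hS : IsOpen S) (h : SmoothHolo S F) {s : ℂ} (hs : s ∈ S) (m : ℕ)
    (u : ℂ) : EqOn (dirD u (fun z => iteratedDeriv m (fun s => F (z, s)) s))
      (fun z => iteratedDeriv m (fun s => dirD (u, 0) F (z, s)) s) halfPlane := by
  intro z hz
  have h1 : EqOn (fun z => iteratedDeriv m (fun s => F (z, s)) s)
      (fun z => (dirD (0, 1))^[m] F (z, s)) halfPlane :=
    fun z hz => h.iteratedDeriv_eq hS hz m s hs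
  rw [dirD_congr isOpen_halfPlane h1 u hz]
  have h2 := dirD_slice_left ((h.iterate_dirD hS m).differentiableAt hS (p := (z, s)) ⟨hz, hs⟩) u
  simp only at h2 ⊢
  rw [h2, h.dirD_iterate_comm hS _ m ⟨hz, hs⟩, (h.dir hS _).iteratedDeriv_eq hS hz m s hs]

end SmoothHolo

/-- The weight `k` hyperbolic Laplacian for functions on `ℂ`. -/
def cLaplacian (k : ℤ) (g : ℂ → ℂ) (z : ℂ) : ℂ :=
  (z.im : ℂ) ^ 2 * (dirD 1 (dirD 1 g) z + dirD Complex.I (dirD Complex.I g) z) -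
    Complex.I * k * z.im * (dirD 1 g z + Complex.I * dirD Complex.I g z)

lemma eventuallyEq_comp_ofComplex {f : ℍ → ℂ} {g : ℂ → ℂ} (h : ∀ z : ℍ, f z = g z) (z : ℍ) :
    f ∘ ofComplex =ᶠ[𝓝 (z : ℂ)] g := by
  filter_upwards [isOpen_halfPlane.mem_nhds (show (z : ℂ) ∈ halfPlane from z.im_pos)] with w hw
  rw [Function.comp, ofComplex_apply_of_im_pos hw, h]

lemma lineDeriv_ofComplex {f : ℍ → ℂ} {g : ℂ → ℂ} (h : ∀ z : ℍ, f z = g z)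
    (hg : ContDiffOn ℝ ∞ g halfPlane) (u : ℂ) (z : ℍ) :
    lineDeriv ℝ (f ∘ ofComplex) (z : ℂ) u = dirD u g z := by
  rw [(eventuallyEq_comp_ofComplex h z).lineDeriv_eq]
  exact (hg.differentiableAt_of_isOpen isOpen_halfPlane z.im_pos).lineDeriv_eq_fderiv

lemma hypLaplacian_eq {f : ℍ → ℂ} {g : ℂ → ℂ} (h : ∀ z : ℍ, f z = g z)
    (hg : ContDiffOn ℝ ∞ g halfPlane) (k : ℤ) (z : ℍ) : hypLaplacian k f z = cLaplacian k g z := by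
  have h1 := lineDeriv_ofComplex h hg 1
  have h2 := lineDeriv_ofComplex h hg Complex.I
  have h3 := lineDeriv_ofComplex (f := partialX f) h1 (hg.dir isOpen_halfPlane 1) 1 z
  have h4 := lineDeriv_ofComplex (f := partialY f) h2 (hg.dir isOpen_halfPlane Complex.I)
    Complex.I z
  unfold hypLaplacian cLaplacian
  rw [← h3, ← h4, ← h1, ← h2]
  rfl

lemma cLaplacian_congr {f g : ℂ → ℂ} (h : EqOn f g halfPlane) (k : ℤ) :
    EqOn (cLaplacian k f) (cLaplacian k g) halfPlane := by
  intro z hz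
  have h1 (u : ℂ) := dirD_congr isOpen_halfPlane h u
  unfold cLaplacian
  rw [h1 _ hz, h1 _ hz, dirD_congr isOpen_halfPlane (h1 1) _ hz,
    dirD_congr isOpen_halfPlane (h1 Complex.I) _ hz]

/-- The Laplacian in the first variable of a function of `(z, s)`. -/
lemma SmoothHolo.cLaplacian_slice (hS : IsOpen S) (h : SmoothHolo S F) (k : ℤ) {z s : ℂ}
    (hz : z ∈ halfPlane) (hs : s ∈ S) : cLaplacian k (fun z => F (z, s)) z =
      (z.im : ℂ) ^ 2 * (dirD (1, 0) (dirD (1, 0) F) (z, s) +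
        dirD (Complex.I, 0) (dirD (Complex.I, 0) F) (z, s)) -
      Complex.I * k * z.im * (dirD (1, 0) F (z, s) +
        Complex.I * dirD (Complex.I, 0) F (z, s)) := by
  have h1 (u : ℂ) : EqOn (dirD u (fun z => F (z, s))) (fun z => dirD (u, 0) F (z, s))
    halfPlane := fun w hw => dirD_slice_left (h.differentiableAt hS (p := (w, s)) ⟨hw, hs⟩) u
  have h2 (u v : ℂ) : dirD u (fun z => dirD (v, 0) F (z, s)) z =
    dirD (u, 0) (dirD (v, 0) F) (z, s) :=
      dirD_slice_left ((h.dir hS (v, 0)).differentiableAt hS (p := (z, s)) ⟨hz, hs⟩) u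
  unfold cLaplacian
  rw [dirD_congr isOpen_halfPlane (h1 1) _ hz, dirD_congr isOpen_halfPlane (h1 Complex.I) _ hz,
    h1 _ hz, h1 _ hz, h2, h2]

lemma SmoothHolo.differentiableOn_cLaplacian (hS : IsOpen S) (h : SmoothHolo S F) (k : ℤ) {z : ℂ}
    (hz : z ∈ halfPlane) : DifferentiableOn ℂ (fun s => cLaplacian k (fun z => F (z, s)) z) S := by
  have hd (u : ℂ) := (h.dir hS (u, 0)).differentiableOn hS hz
  have hdd (u : ℂ) := ((h.dir hS (u, 0)).dir hS (u, 0)).differentiableOn hS hz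
  refine DifferentiableOn.congr (f := _) ?_ fun s hs => h.cLaplacian_slice hS k hz hs
  exact (((hdd 1).add (hdd Complex.I)).const_mul _).sub
    (((hd 1).add ((hd Complex.I).const_mul _)).const_mul _)

/-- The Laplacian commutes with Taylor coefficients. -/
lemma SmoothHolo.cLaplacian_iteratedDeriv (hS : IsOpen S) (h : SmoothHolo S F) (k : ℤ) {z s : ℂ}
    (hz : z ∈ halfPlane) (hs : s ∈ S) (m : ℕ) :
    cLaplacian k (fun z => iteratedDeriv m (fun s => F (z, s)) s) z =
      iteratedDeriv m (fun s => cLaplacian k (fun z => F (z, s)) z) s := by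
  have h1 (u : ℂ) := h.dirD_iteratedDeriv hS hs m u
  have h2 (u : ℂ) := (h.dir hS (u, 0)).dirD_iteratedDeriv hS hs m u
  have e1 : (fun s => cLaplacian k (fun z => F (z, s)) z) =ᶠ[𝓝 s] fun s =>
      (z.im : ℂ) ^ 2 * (dirD (1, 0) (dirD (1, 0) F) (z, s) +
        dirD (Complex.I, 0) (dirD (Complex.I, 0) F) (z, s)) -
      Complex.I * k * z.im * (dirD (1, 0) F (z, s) +
        Complex.I * dirD (Complex.I, 0) F (z, s)) := by
    filter_upwards [hS.mem_nhds hs] with s hs using h.cLaplacian_slice hS k hz hs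
  rw [e1.iteratedDeriv_eq]
  have hd (u : ℂ) : ContDiffAt ℂ m (fun s => dirD (u, 0) F (z, s)) s :=
    ((h.dir hS (u, 0)).analyticAt hS hz hs).contDiffAt
  have hdd (u : ℂ) : ContDiffAt ℂ m
      (fun s => dirD (u, 0) (dirD (u, 0) F) (z, s)) s :=
    (((h.dir hS (u, 0)).dir hS (u, 0)).analyticAt hS hz hs).contDiffAt
  rw [iteratedDeriv_fun_sub (contDiffAt_const.mul ((hdd 1).add (hdd Complex.I)))
    (contDiffAt_const.mul ((hd 1).add (contDiffAt_const.mul (hd Complex.I)))),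
    iteratedDeriv_const_mul_field, iteratedDeriv_const_mul_field,
    iteratedDeriv_fun_add (hdd 1) (hdd Complex.I),
    iteratedDeriv_fun_add (hd 1) (contDiffAt_const.mul (hd Complex.I)),
    iteratedDeriv_const_mul_field]
  unfold cLaplacian
  rw [dirD_congr isOpen_halfPlane (h1 1) _ hz, dirD_congr isOpen_halfPlane (h1 Complex.I) _ hz,
    h1 _ hz, h1 _ hz, h2 _ hz, h2 _ hz]

lemma SmoothHolo.mul_left (hS : IsOpen S) (h : SmoothHolo S F) {c : ℂ → ℂ}
    (hc : DifferentiableOn ℂ c S) : SmoothHolo S (fun p => c p.2 * F p) := by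
  have h1 : ContDiffOn ℝ ∞ c S := (hc.contDiffOn hS).restrict_scalars ℝ
  exact SmoothHolo.of_differentiableOn hS
    ((h1.comp contDiffOn_snd fun p hp => hp.2).mul h.smooth)
    fun z hz => hc.mul (h.differentiableOn hS hz)

lemma cLaplacian_const_mul (k : ℤ) (c : ℂ) (g : ℂ → ℂ) (z : ℂ) :
    cLaplacian k (fun w => c * g w) z = c * cLaplacian k g z := by
  have h1 (u : ℂ) : dirD u (fun w => c * g w) = fun w => c * dirD u g w :=
    funext fun w => dirD_const_mul c u w
  unfold cLaplacian
  rw [h1, h1, dirD_const_mul, dirD_const_mul]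
  ring

/-- In Leibniz' rule the power `s^(m+1)` is differentiated at most `m` times, so every summand keeps
a factor `s`. -/
lemma iteratedDeriv_pow_mul_eq_zero (m : ℕ) : ∀ g : ℂ → ℂ, AnalyticAt ℂ g 0 →
    iteratedDeriv m (fun s => s ^ (m + 1) * g s) 0 = 0 := by
  intro g hg
  have h1 : (fun s : ℂ => s ^ (m + 1) * g s) = (fun s : ℂ => s ^ (m + 1)) * g := rfl
  rw [h1, iteratedDeriv_mul (by fun_prop) hg.contDiffAt]
  refine Finset.sum_eq_zero fun i hi => ?_
  have : i < m + 1 := Finset.mem_range.1 hi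
  simp [iteratedDeriv_eq_iterate, Nat.sub_ne_zero_of_lt this]

/-- Taylor coefficients of a family of eigenfunctions whose eigenvalue vanishes at `0`. -/
lemma SmoothHolo.hypLaplacian_iterate_eq_zero (hS : IsOpen S) (h0 : (0 : ℂ) ∈ S)
    (h : SmoothHolo S F) (k : ℤ)
    (heig : ∀ z ∈ halfPlane, ∀ s ∈ S, cLaplacian k (fun z => F (z, s)) z =
      s * (s + k - 1) * F (z, s)) (m : ℕ) (c : ℂ) {f : ℍ → ℂ}
    (hf : ∀ z : ℍ, f z = c * iteratedDeriv m (fun s => F ((z : ℂ), s)) 0) :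
    (hypLaplacian k)^[m + 1] f = 0 := by
  have key (n : ℕ) : ∀ z : ℍ, (hypLaplacian k)^[n] f z =
      c * iteratedDeriv m (fun s => (s * (s + k - 1)) ^ n * F ((z : ℂ), s)) 0 := by
    induction n with
    | zero => intro z; simp [hf]
    | succ n ih =>
      intro z
      have hc : DifferentiableOn ℂ (fun s : ℂ => (s * (s + k - 1)) ^ n) S := by fun_prop
      have hG := h.mul_left hS hc
      rw [Function.iterate_succ_apply']
      rw [hypLaplacian_eq (g := fun z => c * iteratedDeriv m
        (fun s => (s * (s + k - 1)) ^ n * F (z, s)) 0) ih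
        (contDiffOn_const.mul (hG.contDiffOn_iteratedDeriv hS h0 m)), cLaplacian_const_mul,
        hG.cLaplacian_iteratedDeriv hS k z.im_pos h0 m]
      congr 1
      refine Filter.EventuallyEq.iteratedDeriv_eq m ?_
      filter_upwards [hS.mem_nhds h0] with s hs
      rw [cLaplacian_const_mul, heig z z.im_pos s hs]
      ring
  funext z
  rw [key]
  simp_rw [mul_pow, mul_assoc]
  rw [iteratedDeriv_pow_mul_eq_zero]
  · simp
  · exact AnalyticAt.mul (by fun_prop) (h.analyticAt hS z.im_pos h0)
end JointSmooth

/-! ### Lattice sums of incomplete Gamma functions: regularity and growth -/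

section LatticeIntegral
open MeasureTheory Filter Topology Set

/-- The vector `α m z + β n` of the lattice `ℤ α z + ℤ β`. -/
def latVec (α β : ℝ) (z : ℂ) (v : ℤ × ℤ) : ℂ := α * v.1 * z + β * v.2

/-- The quadratic form `|α m z + β n|² / (α β y)` of covolume one. -/
def latQ (α β : ℝ) (z : ℂ) (v : ℤ × ℤ) : ℝ := ‖latVec α β z v‖ ^ 2 / (α * β * z.im)

/-- `∫₁^∞ exp(-π r t) t^a dt`. -/
def incGamma (r : ℝ) (a : ℂ) : ℂ := ∫ t in Ioi (1 : ℝ), cexp (-(Real.pi * t * r)) * (t : ℂ) ^ a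

/-- The sum over the nonzero lattice vectors of `(α m ζ + β n)^κ` times an incomplete Gamma
function of the length of `α m z + β n`. -/
def latSum (κ : ℕ) (α β : ℝ) (ζ z a : ℂ) : ℂ :=
  ∑' v : ℤ × ℤ, if v = 0 then 0 else latVec α β ζ v ^ κ * incGamma (latQ α β z v) a

/-- The coefficients of the quadratic form `latQ`. -/
def latCoeff (α β : ℝ) (z : ℂ) : ℝ × ℝ × ℝ :=
  (α * normSq z / (β * z.im), 2 * z.re / z.im, β / (α * z.im))

variable {α β : ℝ} {z : ℂ}

/-- The division by the covolume `α β y` in `latQ` is there to make the form self-dual, as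
`thetaForm_inv` requires. -/
lemma latCoeff_disc (hα : 0 < α) (hβ : 0 < β) (hz : z ∈ halfPlane) :
    4 * (latCoeff α β z).1 * (latCoeff α β z).2.2 - (latCoeff α β z).2.1 ^ 2 = 4 := by
  have hz' : z.im ≠ 0 := ne_of_gt hz
  simp only [latCoeff, normSq_apply]
  field_simp
  ring

lemma latCoeff_pos (hα : 0 < α) (hβ : 0 < β) (hz : z ∈ halfPlane) : 0 < (latCoeff α β z).2.2 := by
  have hz' : 0 < z.im := hz
  simp only [latCoeff]
  positivity

lemma latCoeff_formBound (hα : 0 < α) (hβ : 0 < β) (hz : z ∈ halfPlane) :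
    0 < (latCoeff α β z).1 + (latCoeff α β z).2.2 ∧
    FormBound (1 / ((latCoeff α β z).1 + (latCoeff α β z).2.2)) (latCoeff α β z).1
      (latCoeff α β z).2.1 (latCoeff α β z).2.2 := by
  have hC := latCoeff_pos hα hβ hz
  have hd := latCoeff_disc hα hβ hz
  obtain ⟨hA, h⟩ := formBound_of_disc hC (by rw [hd]; norm_num)
  rw [hd] at h
  refine ⟨by linarith, ?_⟩
  convert h using 1
  field_simp

lemma qform_latCoeff (hα : 0 < α) (hβ : 0 < β) (hz : z ∈ halfPlane) (v : ℤ × ℤ) :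
    qform (latCoeff α β z).1 (latCoeff α β z).2.1 (latCoeff α β z).2.2 v = latQ α β z v := by
  have hz' : z.im ≠ 0 := ne_of_gt hz
  have h1 : ‖latVec α β z v‖ ^ 2 = (α * v.1 * z.re + β * v.2) ^ 2 + (α * v.1 * z.im) ^ 2 := by
    rw [← normSq_eq_norm_sq, normSq_apply]
    simp [latVec]
    ring
  unfold latQ
  rw [h1]
  unfold qform latCoeff
  rw [normSq_apply]
  have hα' : (α : ℂ) ≠ 0 := by exact_mod_cast hα.ne'
  have hβ' : (β : ℂ) ≠ 0 := by exact_mod_cast hβ.ne'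
  have hz'' : (z.im : ℂ) ≠ 0 := by exact_mod_cast hz'
  push_cast
  field_simp
  ring

lemma latQ_pos (hα : 0 < α) (hβ : 0 < β) (hz : z ∈ halfPlane) {v : ℤ × ℤ} (hv : v ≠ 0) :
    0 < latQ α β z v := by
  obtain ⟨h1, h2⟩ := latCoeff_formBound hα hβ hz
  have h3 := congrArg Complex.re (qform_latCoeff hα hβ hz v)
  rw [qform_re] at h3
  simp only [ofReal_re] at h3
  rw [← h3]
  refine lt_of_lt_of_le ?_ (h2 v.1 v.2)
  have := one_le_nrmSq hv
  unfold nrmSq at this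
  positivity

lemma latForm_latCoeff (hα : 0 < α) (hβ : 0 < β) (hz : z ∈ halfPlane) (v : ℤ × ℤ) {t : ℝ}
    (ht : 0 < t) (a : ℂ) :
    cexp (latForm (v, t) ((latCoeff α β z).1, (latCoeff α β z).2.1, (latCoeff α β z).2.2, a)) =
      cexp (-(Real.pi * t * latQ α β z v)) * (t : ℂ) ^ a := by
  have ht' : (t : ℂ) ≠ 0 := by exact_mod_cast ht.ne'
  rw [latForm_apply, Complex.exp_add, ← qform_latCoeff hα hβ hz, cpow_def_of_ne_zero ht',
    ofReal_log ht.le]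
  rfl

lemma norm_latVec_le (hα : 0 < α) (hβ : 0 < β) (ζ : ℂ) (v : ℤ × ℤ) :
    ‖latVec α β ζ v‖ ≤ (α * ‖ζ‖ + β) * nrmSq v := by
  have hi (n : ℤ) : |(n : ℝ)| ≤ (n : ℝ) ^ 2 := by
    have : |n| ≤ n ^ 2 := by
      rw [← sq_abs]
      rcases (abs_nonneg n).eq_or_lt with h | h
      · rw [← h]; simp
      · nlinarith
    exact_mod_cast this
  have h1 : ‖latVec α β ζ v‖ ≤ α * |(v.1 : ℝ)| * ‖ζ‖ + β * |(v.2 : ℝ)| := by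
    refine (norm_add_le _ _).trans (le_of_eq ?_)
    rw [norm_mul, norm_mul, norm_mul, norm_real, norm_real, norm_intCast, norm_intCast,
      Real.norm_of_nonneg hα.le, Real.norm_of_nonneg hβ.le]
  have h2 := hi v.1
  have h3 := hi v.2
  have h4 : α * |(v.1 : ℝ)| * ‖ζ‖ ≤ α * (v.1 : ℝ) ^ 2 * ‖ζ‖ := by gcongr
  have h5 : β * |(v.2 : ℝ)| ≤ β * (v.2 : ℝ) ^ 2 := by gcongr
  have h6 : 0 ≤ α * ‖ζ‖ * (v.2 : ℝ) ^ 2 := by positivity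
  have h7 : 0 ≤ β * (v.1 : ℝ) ^ 2 := by positivity
  unfold nrmSq
  nlinarith

/-- The monomial weights occurring in the expansion of `(α m ζ + β n)^κ`. -/
def latMonomial (i j : ℕ) (a : (ℤ × ℤ) × ℝ) : ℂ := (a.1.1 : ℂ) ^ i * (a.1.2 : ℂ) ^ j

lemma expAdm_latMonomial {A B C σ : ℂ} {δ : ℝ} (hδ : 0 < δ) (h : FormBound δ A.re B.re C.re)
    (i j : ℕ) : ExpAdm latMeas latForm (latMonomial i j) (A, B, C, σ) := by
  refine expAdm_lat (N := i + j) hδ σ h ?_ ?_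
  · exact ((measurable_of_countable fun v : ℤ × ℤ => (v.1 : ℂ) ^ i * (v.2 : ℂ) ^ j).comp
      measurable_fst).aestronglyMeasurable
  · intro a ha
    have hi (n : ℤ) : |(n : ℝ)| ≤ (n : ℝ) ^ 2 := by
      have : |n| ≤ n ^ 2 := by
        rw [← sq_abs]
        rcases (abs_nonneg n).eq_or_lt with h | h
        · rw [← h]; simp
        · nlinarith
      exact_mod_cast this
    have h1 : nrmSq a.1 ≤ latSize a := by
      unfold latSize; nlinarith [one_le_nrmSq ha.1]
    have h2 : |(a.1.1 : ℝ)| ≤ latSize a := by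
      refine (hi _).trans (le_trans ?_ h1)
      unfold nrmSq; nlinarith [sq_nonneg (a.1.2 : ℝ)]
    have h3 : |(a.1.2 : ℝ)| ≤ latSize a := by
      refine (hi _).trans (le_trans ?_ h1)
      unfold nrmSq; nlinarith [sq_nonneg (a.1.1 : ℝ)]
    have h4 : 0 ≤ latSize a := (abs_nonneg _).trans h2
    rw [latMonomial, norm_mul, norm_pow, norm_pow, norm_intCast, norm_intCast, pow_add]
    gcongr

/-- The argument of `expIntegral latMeas latForm` that belongs to a point `z` and exponent `a`. -/
def latArg (α β : ℝ) (z a : ℂ) : ℂ × ℂ × ℂ × ℂ :=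
  ((latCoeff α β z).1, (latCoeff α β z).2.1, (latCoeff α β z).2.2, a)

lemma expAdm_latArg (hα : 0 < α) (hβ : 0 < β) (hz : z ∈ halfPlane) (a : ℂ) (i j : ℕ) :
    ExpAdm latMeas latForm (latMonomial i j) (latArg α β z a) := by
  obtain ⟨h1, h2⟩ := latCoeff_formBound hα hβ hz
  exact expAdm_latMonomial (one_div_pos.2 h1) (by simpa using h2) i j

lemma latVec_pow (α β : ℝ) (ζ : ℂ) (κ : ℕ) (a : (ℤ × ℤ) × ℝ) : latVec α β ζ a.1 ^ κ =
    ∑ i ∈ Finset.range (κ + 1), ((α * ζ) ^ i * β ^ (κ - i) * κ.choose i) *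
      latMonomial i (κ - i) a := by
  rw [latVec, add_pow]
  refine Finset.sum_congr rfl fun i _ => ?_
  unfold latMonomial
  ring

lemma latVec_pow_mul_exp (α β : ℝ) (ζ z a : ℂ) (κ : ℕ) : (fun b : (ℤ × ℤ) × ℝ =>
    cexp (latForm b (latArg α β z a)) * latVec α β ζ b.1 ^ κ) = fun b =>
    ∑ i ∈ Finset.range (κ + 1), ((α * ζ) ^ i * β ^ (κ - i) * κ.choose i) *
      (cexp (latForm b (latArg α β z a)) • latMonomial i (κ - i) b) := by
  funext b
  rw [latVec_pow, Finset.mul_sum]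
  refine Finset.sum_congr rfl fun i _ => ?_
  rw [smul_eq_mul]
  ring

lemma integrable_latVec_pow (hα : 0 < α) (hβ : 0 < β) (hz : z ∈ halfPlane) (ζ a : ℂ) (κ : ℕ) :
    Integrable (fun b : (ℤ × ℤ) × ℝ =>
      cexp (latForm b (latArg α β z a)) * latVec α β ζ b.1 ^ κ) latMeas := by
  rw [latVec_pow_mul_exp]
  exact integrable_finsetSum _ fun i _ =>
    (expAdm_latArg hα hβ hz a i (κ - i)).integrable.const_mul _

lemma latSum_eq_integral (hα : 0 < α) (hβ : 0 < β) (hz : z ∈ halfPlane) (ζ a : ℂ) (κ : ℕ) :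
    latSum κ α β ζ z a = ∫ b : (ℤ × ℤ) × ℝ,
      cexp (latForm b (latArg α β z a)) * latVec α β ζ b.1 ^ κ ∂latMeas := by
  rw [integral_latMeas (integrable_latVec_pow hα hβ hz ζ a κ)]
  refine tsum_congr fun v => ?_
  split_ifs with hv
  · rfl
  · rw [incGamma, ← integral_const_mul]
    refine setIntegral_congr_fun measurableSet_Ioi fun t ht => ?_
    simp only
    rw [latArg, latForm_latCoeff hα hβ hz v (zero_lt_one.trans ht)]
    ring

/-- The binomial expansion moves `ζ` out of the integral. What remains are integrals of fixed
monomials, depending on `(z, a)` only through the linear form, so the general smoothness result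
applies. -/
lemma latSum_eq_sum (hα : 0 < α) (hβ : 0 < β) (hz : z ∈ halfPlane) (ζ a : ℂ) (κ : ℕ) :
    latSum κ α β ζ z a = ∑ i ∈ Finset.range (κ + 1), ((α * ζ) ^ i * β ^ (κ - i) * κ.choose i) *
      expIntegral latMeas latForm (latMonomial i (κ - i)) (latArg α β z a) := by
  rw [latSum_eq_integral hα hβ hz, latVec_pow_mul_exp, integral_finsetSum]
  · simp_rw [integral_const_mul]
    rfl
  · exact fun i _ => (expAdm_latArg hα hβ hz a i (κ - i)).integrable.const_mul _

lemma contDiffOn_latArg (hα : 0 < α) (hβ : 0 < β) :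
    ContDiffOn ℝ ∞ (fun p : ℂ × ℂ => latArg α β p.1 p.2) (halfPlane ×ˢ univ) := by
  have hre : ContDiff ℝ ∞ fun p : ℂ × ℂ => p.1.re := reCLM.contDiff.comp contDiff_fst
  have him : ContDiff ℝ ∞ fun p : ℂ × ℂ => p.1.im := imCLM.contDiff.comp contDiff_fst
  have hof : ContDiff ℝ ∞ (fun x : ℝ => (x : ℂ)) := ofRealCLM.contDiff
  have hne : ∀ p ∈ halfPlane ×ˢ (univ : Set ℂ), p.1.im ≠ 0 := fun p hp => ne_of_gt hp.1
  have hns : ContDiff ℝ ∞ fun p : ℂ × ℂ => normSq p.1 := by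
    simp_rw [normSq_apply]
    exact (hre.mul hre).add (him.mul him)
  have h1 : ContDiffOn ℝ ∞ (fun p : ℂ × ℂ => α * normSq p.1 / (β * p.1.im))
      (halfPlane ×ˢ univ) :=
    (contDiff_const.mul hns).contDiffOn.div (contDiff_const.mul him).contDiffOn
      fun p hp => mul_ne_zero hβ.ne' (hne p hp)
  have h2 : ContDiffOn ℝ ∞ (fun p : ℂ × ℂ => 2 * p.1.re / p.1.im) (halfPlane ×ˢ univ) :=
    (contDiff_const.mul hre).contDiffOn.div him.contDiffOn hne
  have h3 : ContDiffOn ℝ ∞ (fun p : ℂ × ℂ => β / (α * p.1.im)) (halfPlane ×ˢ univ) :=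
    contDiffOn_const.div (contDiff_const.mul him).contDiffOn
      fun p hp => mul_ne_zero hα.ne' (hne p hp)
  exact (hof.comp_contDiffOn h1).prodMk ((hof.comp_contDiffOn h2).prodMk
    ((hof.comp_contDiffOn h3).prodMk contDiffOn_snd))

lemma smoothHolo_latSum (hα : 0 < α) (hβ : 0 < β) (κ : ℕ) {ζ : ℂ → ℂ} (hζ : ContDiff ℝ ∞ ζ)
    {c : ℂ → ℂ} (hc : Differentiable ℂ c) :
    SmoothHolo univ (fun p => latSum κ α β (ζ p.1) p.1 (c p.2)) := by
  have hcs : ContDiff ℝ ∞ c := hc.contDiff.restrict_scalars ℝ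
  refine SmoothHolo.of_differentiableOn isOpen_univ ?_ fun z hz => ?_
  · refine ContDiffOn.congr (f := _) ?_ fun p hp => latSum_eq_sum hα hβ hp.1 _ _ _
    refine ContDiffOn.sum fun i _ => ?_
    have h1 : ContDiff ℝ ∞ fun p : ℂ × ℂ => (α * ζ p.1) ^ i * (β : ℂ) ^ (κ - i) * κ.choose i :=
      (((contDiff_const.mul (hζ.comp contDiff_fst)).pow i).mul contDiff_const).mul contDiff_const
    refine h1.contDiffOn.mul fun p hp => ContDiffAt.contDiffWithinAt ?_
    have h2 : ContDiffAt ℝ ∞ (expIntegral latMeas latForm (latMonomial i (κ - i)))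
        (latArg α β p.1 (c p.2)) :=
      ((expAdm_latArg hα hβ hp.1 (c p.2) i (κ - i)).contDiffAt).restrict_scalars ℝ
    have h3 : ContDiffAt ℝ ∞ (fun p : ℂ × ℂ => latArg α β p.1 p.2) (p.1, c p.2) :=
      (contDiffOn_latArg hα hβ).contDiffAt ((isOpen_halfPlane.prod isOpen_univ).mem_nhds
        ⟨hp.1, mem_univ _⟩)
    have h4 : ContDiffAt ℝ ∞ (fun p : ℂ × ℂ => (p.1, c p.2)) p :=
      (contDiff_fst.prodMk (hcs.comp contDiff_snd)).contDiffAt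
    have h5 : ContDiffAt ℝ ∞ (fun p : ℂ × ℂ => latArg α β p.1 (c p.2)) p :=
      ContDiffAt.comp (g := fun p : ℂ × ℂ => latArg α β p.1 p.2) p h3 h4
    exact (h2.comp p h5 :)
  · refine DifferentiableOn.congr (f := _) ?_ fun s _ => latSum_eq_sum hα hβ hz _ _ _
    refine DifferentiableOn.fun_sum fun i _ => ?_
    dsimp only
    refine DifferentiableOn.const_mul (a := fun s => expIntegral latMeas latForm
      (latMonomial i (κ - i)) (latArg α β z (c s))) (fun s _ =>
      DifferentiableAt.differentiableWithinAt ?_) _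
    have h2 := (expAdm_latArg hα hβ hz (c s) i (κ - i)).hasFDerivAt.differentiableAt
    have h3 : DifferentiableAt ℂ (fun s => latArg α β z (c s)) s :=
      (differentiableAt_const _).prodMk ((differentiableAt_const _).prodMk
        ((differentiableAt_const _).prodMk (hc s)))
    exact (h2.comp s h3 :)

/-- Polynomial growth of `latSum` in vertical strips. -/
lemma norm_latSum_le (hα : 0 < α) (hβ : 0 < β) (κ M : ℕ) (X : ℝ) : ∃ (K : ℝ) (n : ℕ),
    ∀ ζ z a : ℂ, ‖ζ‖ ≤ ‖z‖ → |z.re| ≤ X → 1 ≤ z.im → a.re ≤ M →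
      ‖latSum κ α β ζ z a‖ ≤ K * z.im ^ n := by
  -- The exponential is traded for the power `-n` of `latSize`; after the weights of degree `κ` and
  -- `M`, exactly the integrable power `-2` is left.
  set n := κ + M + 2 with hn
  set L : ℝ := α * (|X| + 1) + β with hL
  set K₀ : ℝ := (α * (X ^ 2 + 1)) / β + β / α with hK₀
  have hL0 : 0 < L := by positivity
  have hK0 : 0 < K₀ := by positivity
  refine ⟨L ^ κ * (n.factorial / (Real.pi * (1 / K₀)) ^ n) * ∫ b, (latSize b ^ 2)⁻¹ ∂latMeas,
    κ + n, fun ζ z a hζ hX hy ha => ?_⟩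
  have hz : z ∈ halfPlane := show 0 < z.im by linarith
  have hy0 : 0 < z.im := hz
  obtain ⟨h1, h2⟩ := latCoeff_formBound hα hβ hz
  -- On the strip with `y ≥ 1` the trace of the form is at most linear in `y`, so the Gaussian rate
  -- decays no faster than `1/y`. This is the source of the power of `y` in the bound.
  have hδ : 1 / (K₀ * z.im) ≤ 1 / ((latCoeff α β z).1 + (latCoeff α β z).2.2) := by
    refine one_div_le_one_div_of_le h1 ?_
    have hx2 : z.re ^ 2 ≤ X ^ 2 := sq_le_sq' (by linarith [(abs_le.1 hX).1]) (abs_le.1 hX).2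
    simp only [latCoeff, normSq_apply, hK₀]
    have e1 : α * (z.re * z.re + z.im * z.im) / (β * z.im) ≤ (α * (X ^ 2 + 1)) / β * z.im := by
      rw [div_mul_eq_mul_div, div_le_div_iff₀ (by positivity) hβ]
      have : z.re * z.re + z.im * z.im ≤ (X ^ 2 + 1) * (z.im * z.im) := by
        nlinarith [mul_nonneg (sq_nonneg X) (by nlinarith : 0 ≤ z.im * z.im - 1)]
      calc α * (z.re * z.re + z.im * z.im) * β ≤ α * ((X ^ 2 + 1) * (z.im * z.im)) * β := by gcongr
        _ = _ := by ring
    have e2 : β / (α * z.im) ≤ β / α * z.im := by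
      rw [div_mul_eq_mul_div, div_le_div_iff₀ (by positivity) hα]
      have : 1 ≤ z.im * z.im := by nlinarith
      calc β * α = β * α * 1 := by ring
        _ ≤ β * α * (z.im * z.im) := by gcongr
        _ = _ := by ring
    linarith
  have h3 : FormBound (1 / (K₀ * z.im)) (latCoeff α β z).1 (latCoeff α β z).2.1
      (latCoeff α β z).2.2 := fun x y => le_trans (by gcongr) (h2 x y)
  have hzn : α * ‖ζ‖ + β ≤ L * z.im := by
    have e1 : ‖z‖ ≤ (|X| + 1) * z.im := by
      have e2 := norm_le_abs_re_add_abs_im z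
      rw [abs_of_pos hy0] at e2
      have e3 : |z.re| ≤ |X| * z.im := (hX.trans (le_abs_self X)).trans
        (le_mul_of_one_le_right (abs_nonneg _) hy)
      linarith
    have e4 : α * ‖ζ‖ ≤ α * ((|X| + 1) * z.im) := by gcongr; exact hζ.trans e1
    have e5 : β ≤ β * z.im := le_mul_of_one_le_right hβ.le hy
    rw [hL]; linarith
  rw [latSum_eq_integral hα hβ hz, mul_comm _ (∫ b, (latSize b ^ 2)⁻¹ ∂latMeas), mul_assoc,
    mul_comm, ← integral_const_mul]
  refine norm_integral_le_of_norm_le (integrable_latSize.const_mul _) ?_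
  filter_upwards [ae_latMeas] with b hb
  have hs := one_le_latSize hb
  have hs0 : 0 < latSize b := by linarith
  have e1 : ‖cexp (latForm b (latArg α β z a))‖ ≤
      Real.exp (-(Real.pi * (1 / (K₀ * z.im)) * latSize b)) * latSize b ^ M := by
    rw [norm_exp]
    exact latForm_re_le (by simpa using h3) hb ha
  have e2 : ‖latVec α β ζ b.1‖ ≤ L * z.im * latSize b := by
    refine (norm_latVec_le hα hβ ζ b.1).trans ?_
    have : nrmSq b.1 ≤ latSize b := by
      unfold latSize; nlinarith [one_le_nrmSq hb.1, hb.2]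
    exact mul_le_mul hzn this (nrmSq_nonneg _) (by positivity)
  have e3 := exp_neg_le_div_pow (c := Real.pi * (1 / (K₀ * z.im))) (by positivity) hs0 n
  rw [norm_mul, norm_pow]
  calc _ ≤ (((n.factorial / (Real.pi * (1 / (K₀ * z.im))) ^ n) * (latSize b ^ n)⁻¹) *
        latSize b ^ M) * (L * z.im * latSize b) ^ κ := by
        gcongr
        exact e1.trans (by gcongr)
    _ = _ := by
        rw [hn]
        simp only [pow_add, mul_pow, one_div, inv_pow]
        field_simp
end LatticeIntegral

/-! ### The Mellin transform of the lattice theta series -/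

section LatticeMellin
open MeasureTheory Filter Topology Set

variable {α β : ℝ} {z ζ : ℂ}

lemma latQ_nonneg (hα : 0 < α) (hβ : 0 < β) (hz : z ∈ halfPlane) (v : ℤ × ℤ) :
    0 ≤ latQ α β z v := by
  have : 0 < z.im := hz
  unfold latQ
  positivity

lemma norm_latVec_sq_le (hα : 0 < α) (hβ : 0 < β) (ζ : ℂ) (v : ℤ × ℤ) :
    ‖latVec α β ζ v‖ ^ 2 ≤ (α * ‖ζ‖ + β) ^ 2 * nrmSq v := by
  have h1 : ‖latVec α β ζ v‖ ≤ α * |(v.1 : ℝ)| * ‖ζ‖ + β * |(v.2 : ℝ)| := by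
    refine (norm_add_le _ _).trans (le_of_eq ?_)
    rw [norm_mul, norm_mul, norm_mul, norm_real, norm_real, norm_intCast, norm_intCast,
      Real.norm_of_nonneg hα.le, Real.norm_of_nonneg hβ.le]
  have h2 : |(v.1 : ℝ)| ≤ √(nrmSq v) := Real.abs_le_sqrt (by unfold nrmSq; nlinarith [sq_nonneg (v.2 : ℝ)])
  have h3 : |(v.2 : ℝ)| ≤ √(nrmSq v) := Real.abs_le_sqrt (by unfold nrmSq; nlinarith [sq_nonneg (v.1 : ℝ)])
  have h4 : ‖latVec α β ζ v‖ ≤ (α * ‖ζ‖ + β) * √(nrmSq v) :=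
    calc _ ≤ α * √(nrmSq v) * ‖ζ‖ + β * √(nrmSq v) := h1.trans (by gcongr)
      _ = _ := by ring
  calc _ ≤ ((α * ‖ζ‖ + β) * √(nrmSq v)) ^ 2 := by gcongr
    _ = _ := by rw [mul_pow, Real.sq_sqrt (nrmSq_nonneg v)]

/-- The theta series of a lattice with the zero vector removed. -/
def latTheta (κ : ℕ) (α β : ℝ) (ζ z : ℂ) (t : ℝ) : ℂ :=
  ∑' v : ℤ × ℤ, if v = 0 then 0 else latVec α β ζ v ^ κ * Real.exp (-(Real.pi * latQ α β z v) * t)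

lemma summable_latTheta (hα : 0 < α) (hβ : 0 < β) (hz : z ∈ halfPlane) (ζ : ℂ) (κ : ℕ) {t : ℝ}
    (ht : 0 < t) : Summable fun v : ℤ × ℤ =>
      latVec α β ζ v ^ κ * (Real.exp (-(Real.pi * latQ α β z v) * t) : ℂ) := by
  obtain ⟨h1, h2⟩ := latCoeff_formBound hα hβ hz
  set δ := 1 / ((latCoeff α β z).1 + (latCoeff α β z).2.2)
  have hδ : 0 < δ := one_div_pos.2 h1
  refine Summable.of_norm_bounded ((summable_nrmSq_pow_mul_exp
    (by positivity : 0 < Real.pi * t * δ) κ).mul_left ((α * ‖ζ‖ + β) ^ κ)) fun v => ?_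
  rw [norm_mul, norm_pow, ← mul_assoc, ← mul_pow]
  have hn := nrmSq_nonneg v
  refine mul_le_mul (pow_le_pow_left₀ (norm_nonneg _) (norm_latVec_le hα hβ ζ v) _) ?_
    (norm_nonneg _) (by positivity)
  · have := norm_exp_qform_le (A := (latCoeff α β z).1) (B := (latCoeff α β z).2.1)
      (C := (latCoeff α β z).2.2) (by simpa using h2) ht v
    rw [qform_latCoeff hα hβ hz] at this
    refine le_trans (le_of_eq ?_) this
    push_cast
    congr 2
    ring

/-- For even `κ` the weight is a power of the square form `(α m ζ + β n)²`. The quadratic equation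
means that `ζ` is `z` or `z̄`, and it makes this form orthogonal to `latQ`, so adding multiples of
it preserves the discriminant. The terms `0 ^ κ` are the zero vector, which counts only for `κ = 0`.
-/
lemma latTheta_inv (hα : 0 < α) (hβ : 0 < β) (hz : z ∈ halfPlane)
    (hζ : ζ ^ 2 - 2 * z.re * ζ + normSq z = 0) {κ : ℕ} (hκ : Even κ) {t : ℝ} (ht : 0 < t) :
    latTheta κ α β ζ z t⁻¹ = t ^ (1 + κ) * (latTheta κ α β ζ z t + 0 ^ κ) - 0 ^ κ := by
  obtain ⟨j, rfl⟩ := hκ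
  have hα' : (α : ℂ) ≠ 0 := by exact_mod_cast hα.ne'
  have hβ' : (β : ℂ) ≠ 0 := by exact_mod_cast hβ.ne'
  have hz'' : (z.im : ℂ) ≠ 0 := by exact_mod_cast (ne_of_gt hz : z.im ≠ 0)
  have key {t : ℝ} (ht : 0 < t) : latTheta (j + j) α β ζ z t + 0 ^ (j + j) =
      ∑' v, qform (α ^ 2 * ζ ^ 2) (2 * α * β * ζ) (β ^ 2) v ^ j *
        cexp (-(Real.pi * t * qform (latCoeff α β z).1 (latCoeff α β z).2.1
          (latCoeff α β z).2.2 v)) := by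
    have h1 := (summable_latTheta hα hβ hz ζ (j + j) ht).tsum_eq_add_tsum_ite 0
    have h2 (v : ℤ × ℤ) : qform (α ^ 2 * ζ ^ 2) (2 * α * β * ζ) (β ^ 2) v ^ j *
        cexp (-(Real.pi * t * qform (latCoeff α β z).1 (latCoeff α β z).2.1
          (latCoeff α β z).2.2 v)) =
        latVec α β ζ v ^ (j + j) * (Real.exp (-(Real.pi * latQ α β z v) * t) : ℂ) := by
      rw [qform_latCoeff hα hβ hz]
      congr 1
      · rw [← two_mul, pow_mul]
        congr 1
        unfold qform latVec
        ring
      · push_cast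
        congr 1
        ring
    simp_rw [h2]
    rw [h1, add_comm]
    congr 1
    simp [latVec, latQ]
  obtain ⟨h1, h2⟩ := latCoeff_formBound hα hβ hz
  have h3 := tsum_qform_pow_inv (A := (latCoeff α β z).1) (B := (latCoeff α β z).2.1)
    (C := (latCoeff α β z).2.2) (A' := α ^ 2 * ζ ^ 2) (B' := 2 * α * β * ζ) (C' := β ^ 2)
    (one_div_pos.2 h1) (by simpa using h2) (fun x => ?_) ht j
  · rw [← key ht, ← key (inv_pos.2 ht), ← two_mul] at h3
    rw [← two_mul, ← h3]
    ring
  · have h4 : (4 * (latCoeff α β z).1 * (latCoeff α β z).2.2 - (latCoeff α β z).2.1 ^ 2 : ℂ) = 4 := by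
      exact_mod_cast latCoeff_disc hα hβ hz
    -- This is the coefficient of `x` in the discriminant, up to a factor 4; the coefficient of `x²`
    -- vanishes because the added form is a square.
    have h5 : (((latCoeff α β z).1 : ℝ) : ℂ) * β ^ 2 + α ^ 2 * ζ ^ 2 * (latCoeff α β z).2.2 -
        (latCoeff α β z).2.1 * (α * β * ζ) = 0 := by
      simp only [latCoeff]
      push_cast
      field_simp
      linear_combination α * β * hζ
    linear_combination h4 + 4 * x * h5

lemma latTheta_integrand (hα : 0 < α) (hβ : 0 < β) (hz : z ∈ halfPlane) (ζ a : ℂ) (κ : ℕ) {t : ℝ}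
    (ht : 0 < t) : (∑' v : ℤ × ℤ, if v = 0 then 0 else
      cexp (latForm (v, t) (latArg α β z a)) * latVec α β ζ v ^ κ) =
      (t : ℂ) ^ a * latTheta κ α β ζ z t := by
  rw [latTheta, ← tsum_mul_left]
  refine tsum_congr fun v => ?_
  split_ifs with hv
  · simp
  · rw [latArg, latForm_latCoeff hα hβ hz v ht]
    push_cast
    rw [show -(Real.pi * t * latQ α β z v : ℂ) = -(Real.pi * latQ α β z v) * t by ring]
    ring

lemma integrableOn_latTheta (hα : 0 < α) (hβ : 0 < β) (hz : z ∈ halfPlane) (ζ a : ℂ) (κ : ℕ) :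
    IntegrableOn (fun t : ℝ => (t : ℂ) ^ a * latTheta κ α β ζ z t) (Ioi 1) :=
  (integrableOn_latMeas (integrable_latVec_pow hα hβ hz ζ a κ)).congr_fun
    (fun _ ht => latTheta_integrand hα hβ hz ζ a κ (zero_lt_one.trans ht)) measurableSet_Ioi

lemma integral_latTheta (hα : 0 < α) (hβ : 0 < β) (hz : z ∈ halfPlane) (ζ a : ℂ) (κ : ℕ) :
    ∫ t in Ioi (1 : ℝ), (t : ℂ) ^ a * latTheta κ α β ζ z t = latSum κ α β ζ z a := by
  rw [latSum_eq_integral hα hβ hz, integral_latMeas' (integrable_latVec_pow hα hβ hz ζ a κ)]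
  exact setIntegral_congr_fun measurableSet_Ioi fun t ht =>
    (latTheta_integrand hα hβ hz ζ a κ (zero_lt_one.trans ht)).symm

lemma integral_polar_part (κ : ℕ) {s : ℂ} (hs : 1 + (κ : ℝ) / 2 < s.re) :
    IntegrableOn (fun u : ℝ => (0 : ℂ) ^ κ * ((u : ℂ) ^ (κ - s) - (u : ℂ) ^ (-s - 1))) (Ioi 1) ∧
    ∫ u in Ioi (1 : ℝ), (0 : ℂ) ^ κ * ((u : ℂ) ^ (κ - s) - (u : ℂ) ^ (-s - 1)) =
      if κ = 0 then 1 / (s - 1) - 1 / s else 0 := by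
  by_cases hκ : κ = 0
  · subst hκ
    simp only [Nat.cast_zero, zero_div, add_zero] at hs
    have h1 : ((0 : ℕ) - s : ℂ).re < -1 := by simp; linarith
    have h2 : (-s - 1 : ℂ).re < -1 := by simp; linarith
    have i1 := integrableOn_Ioi_cpow_of_lt h1 zero_lt_one
    have i2 := integrableOn_Ioi_cpow_of_lt h2 zero_lt_one
    simp only [pow_zero, one_mul, if_true]
    refine ⟨i1.sub i2, ?_⟩
    rw [integral_sub i1 i2, integral_Ioi_cpow_of_lt h1 zero_lt_one,
      integral_Ioi_cpow_of_lt h2 zero_lt_one]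
    have hs1 : s - 1 ≠ 0 := fun h => by
      have := congrArg Complex.re h
      simp at this; linarith
    have hs0 : s ≠ 0 := fun h => by simp [h] at hs; linarith
    have hs2 : 1 - s ≠ 0 := fun h => hs1 (by linear_combination -h)
    simp only [ofReal_one, one_cpow, Nat.cast_zero]
    rw [show (0 - s + 1 : ℂ) = -(s - 1) by ring, show (-s - 1 + 1 : ℂ) = -s by ring]
    field_simp
  · simp [hκ]

/-- The Mellin transform of the theta series, evaluated in two ways. -/
lemma hasSum_latSum (hα : 0 < α) (hβ : 0 < β) (hz : z ∈ halfPlane)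
    (hζ : ζ ^ 2 - 2 * z.re * ζ + normSq z = 0) {κ : ℕ} (hκ : Even κ) {s : ℂ}
    (hs : 1 + (κ : ℝ) / 2 < s.re) :
    HasSum (fun v : ℤ × ℤ => if v = 0 then 0 else
        Gamma s * latVec α β ζ v ^ κ / ((Real.pi * latQ α β z v : ℝ) : ℂ) ^ s)
      (latSum κ α β ζ z (s - 1) + latSum κ α β ζ z (κ - s) +
        if κ = 0 then 1 / (s - 1) - 1 / s else 0) := by
  have hs0 : 0 < s.re := by
    have : (0 : ℝ) ≤ (κ : ℝ) / 2 := by positivity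
    linarith
  have hmel : mellin (latTheta κ α β ζ z) s = latSum κ α β ζ z (s - 1) +
      latSum κ α β ζ z (κ - s) + if κ = 0 then 1 / (s - 1) - 1 / s else 0 := by
    -- The part of the Mellin integral over `(0, 1)` is carried to `(1, ∞)` by `t = 1/u`, where the
    -- inversion formula turns it into the dual integral plus the polar terms.
    have himg : (fun x : ℝ => x⁻¹) '' Ioi 1 = Ioo 0 1 := by
      rw [Set.image_inv_eq_inv, Set.inv_Ioi₀ zero_lt_one, inv_one]
    have hder : ∀ x ∈ Ioi (1 : ℝ), HasDerivWithinAt (fun x : ℝ => x⁻¹) (-(x ^ 2)⁻¹) (Ioi 1) x :=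
      fun x hx => (hasDerivAt_inv (zero_lt_one.trans hx).ne').hasDerivWithinAt
    have hinj : InjOn (fun x : ℝ => x⁻¹) (Ioi 1) := inv_injective.injOn
    obtain ⟨p1, p2⟩ := integral_polar_part κ hs
    have hpt : ∀ u ∈ Ioi (1 : ℝ), |(-(u ^ 2)⁻¹ : ℝ)| • (((u⁻¹ : ℝ) : ℂ) ^ (s - 1) *
        latTheta κ α β ζ z u⁻¹) = (u : ℂ) ^ (κ - s) * latTheta κ α β ζ z u +
          (0 : ℂ) ^ κ * ((u : ℂ) ^ (κ - s) - (u : ℂ) ^ (-s - 1)) := by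
      intro u hu
      have hu0 : 0 < u := zero_lt_one.trans hu
      have hu' : (u : ℂ) ≠ 0 := by exact_mod_cast hu0.ne'
      rw [latTheta_inv hα hβ hz hζ hκ hu0, abs_neg, abs_of_pos (by positivity), real_smul]
      have e1 : (((u ^ 2)⁻¹ : ℝ) : ℂ) * ((u⁻¹ : ℝ) : ℂ) ^ (s - 1) = (u : ℂ) ^ (-s - 1) := by
        rw [ofReal_inv u, inv_cpow _ _ (by
          rw [arg_ofReal_of_nonneg hu0.le]; exact Real.pi_pos.ne), ← cpow_neg]
        push_cast
        rw [← cpow_natCast, ← cpow_neg, ← cpow_add _ _ hu']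
        congr 1
        push_cast
        ring
      have e2 : (u : ℂ) ^ (κ - s) = (u : ℂ) ^ (-s - 1) * (u : ℂ) ^ (1 + κ) := by
        rw [← cpow_natCast, ← cpow_add _ _ hu']
        congr 1
        push_cast
        ring
      rw [← mul_assoc, e1, e2]
      ring
    have hi0 : IntegrableOn (fun t : ℝ => (t : ℂ) ^ (s - 1) * latTheta κ α β ζ z t)
        (Ioo 0 1) := by
      rw [← himg, integrableOn_image_iff_integrableOn_abs_deriv_smul measurableSet_Ioi hder hinj]
      exact ((integrableOn_latTheta hα hβ hz ζ (κ - s) κ).add p1).congr_fun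
        (fun u hu => (hpt u hu).symm) measurableSet_Ioi
    have hint0 : ∫ t in Ioo (0 : ℝ) 1, (t : ℂ) ^ (s - 1) * latTheta κ α β ζ z t =
        latSum κ α β ζ z (κ - s) + if κ = 0 then 1 / (s - 1) - 1 / s else 0 := by
      rw [← himg, integral_image_eq_integral_abs_deriv_smul measurableSet_Ioi hder hinj,
        setIntegral_congr_fun measurableSet_Ioi hpt,
        integral_add (integrableOn_latTheta hα hβ hz ζ (κ - s) κ) p1, p2,
        integral_latTheta hα hβ hz]
    unfold mellin
    simp only [smul_eq_mul]
    rw [← Ioc_union_Ioi_eq_Ioi (zero_le_one' ℝ), setIntegral_union Ioc_disjoint_Ioi_same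
      measurableSet_Ioi ((integrableOn_Ioc_iff_integrableOn_Ioo).2 hi0)
      (integrableOn_latTheta hα hβ hz ζ (s - 1) κ), integral_Ioc_eq_integral_Ioo, hint0,
      integral_latTheta hα hβ hz]
    ring
  rw [← hmel]
  have h := hasSum_mellin (ι := ℤ × ℤ) (a := fun v => if v = 0 then 0 else latVec α β ζ v ^ κ)
    (p := fun v => Real.pi * latQ α β z v) (F := latTheta κ α β ζ z) (s := s) ?_ hs0 ?_ ?_
  · refine h.congr_fun fun v => ?_
    by_cases hv : v = 0 <;> simp [hv]
  · intro v
    by_cases hv : v = 0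
    · simp [hv]
    · exact Or.inr (mul_pos Real.pi_pos (latQ_pos hα hβ hz hv))
  · intro t ht
    have h1 := (summable_latTheta hα hβ hz ζ κ ht)
    have h2 : Summable fun v : ℤ × ℤ => if v = 0 then 0 else
        latVec α β ζ v ^ κ * (Real.exp (-(Real.pi * latQ α β z v) * t) : ℂ) := by
      refine (h1.indicator {0}ᶜ).congr fun v => ?_
      by_cases hv : v = 0 <;> simp [hv]
    refine h2.hasSum.congr_fun fun v => ?_
    by_cases hv : v = 0 <;> simp [hv]
  · obtain ⟨j, rfl⟩ := hκ
    obtain ⟨h1, h2⟩ := latCoeff_formBound hα hβ hz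
    set δ := 1 / ((latCoeff α β z).1 + (latCoeff α β z).2.2)
    have hδ : 0 < δ := one_div_pos.2 h1
    -- The weight has size `|v|^(2j)`, which lowers the exponent of `nrmSq v` from `Re s` to `Re s -
    -- j`.
    have hσ : 1 < s.re - j := by push_cast at hs; linarith
    refine ((summable_nrmSq_rpow hσ).mul_left
      (((α * ‖ζ‖ + β) ^ 2) ^ j / (Real.pi * δ) ^ s.re)).of_nonneg_of_le
      (fun v => div_nonneg (norm_nonneg _) (Real.rpow_nonneg
        (mul_nonneg Real.pi_pos.le (latQ_nonneg hα hβ hz v)) _)) fun v => ?_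
    by_cases hv : v = 0
    · simp [hv]
    · have hn : 0 < nrmSq v := zero_lt_one.trans_le (one_le_nrmSq hv)
      rw [if_neg hv, if_neg hv, norm_pow, ← two_mul, pow_mul]
      have e1 := norm_latVec_sq_le hα hβ ζ v
      have e2 : δ * nrmSq v ≤ latQ α β z v := by
        have h3 := congrArg Complex.re (qform_latCoeff hα hβ hz v)
        rw [qform_re] at h3
        simp only [ofReal_re] at h3
        rw [← h3]
        exact h2 v.1 v.2
      calc (‖latVec α β ζ v‖ ^ 2) ^ j / (Real.pi * latQ α β z v) ^ s.re
          ≤ ((α * ‖ζ‖ + β) ^ 2 * nrmSq v) ^ j / (Real.pi * (δ * nrmSq v)) ^ s.re := by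
            gcongr
        _ = _ := by
            rw [← mul_assoc Real.pi δ, Real.mul_rpow (by positivity) hn.le, mul_pow, neg_sub, Real.rpow_sub hn,
              Real.rpow_natCast]
            ring
end LatticeMellin

/-! ### Wirtinger derivatives of a single term -/

section Eigenfunction
open Filter Topology Set ComplexConjugate

/-- The real linear map `u ↦ d₁ u + d₂ ū`. -/
def wirtinger (d₁ d₂ : ℂ) : ℂ →L[ℝ] ℂ :=
  d₁ • ContinuousLinearMap.id ℝ ℂ + d₂ • (conjCLE : ℂ →L[ℝ] ℂ)

@[simp] lemma wirtinger_apply (d₁ d₂ u : ℂ) : wirtinger d₁ d₂ u = d₁ * u + d₂ * conj u := by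
  simp [wirtinger]

lemma norm_wirtinger_le (d₁ d₂ : ℂ) : ‖wirtinger d₁ d₂‖ ≤ ‖d₁‖ + ‖d₂‖ := by
  refine ContinuousLinearMap.opNorm_le_bound _ (by positivity) fun u => ?_
  rw [wirtinger_apply, add_mul]
  refine (norm_add_le _ _).trans (le_of_eq ?_)
  rw [norm_mul, norm_mul, RCLike.norm_conj]

lemma hasFDerivAt_wirtinger_mul {f g : ℂ → ℂ} {a b c d z : ℂ}
    (hf : HasFDerivAt f (wirtinger a b) z) (hg : HasFDerivAt g (wirtinger c d) z) :
    HasFDerivAt (fun z => f z * g z) (wirtinger (a * g z + f z * c) (b * g z + f z * d)) z := by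
  refine (hf.mul hg).congr_fderiv ?_
  ext u
  simp
  ring

lemma hasFDerivAt_wirtinger_add {f g : ℂ → ℂ} {a b c d z : ℂ}
    (hf : HasFDerivAt f (wirtinger a b) z) (hg : HasFDerivAt g (wirtinger c d) z) :
    HasFDerivAt (fun z => f z + g z) (wirtinger (a + c) (b + d)) z := by
  refine (hf.add hg).congr_fderiv ?_
  ext u
  simp
  ring

lemma hasFDerivAt_wirtinger_const_mul {f : ℂ → ℂ} {a b z : ℂ} (c : ℂ)
    (hf : HasFDerivAt f (wirtinger a b) z) :
    HasFDerivAt (fun z => c * f z) (wirtinger (c * a) (c * b)) z := by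
  refine (hf.const_mul c).congr_fderiv ?_
  ext u
  simp
  ring

/-- Wirtinger derivatives of a function that is holomorphic in `z` and `z̄` separately. -/
lemma hasFDerivAt_wirtinger_of_prod {G : ℂ × ℂ → ℂ} {d₁ d₂ z : ℂ}
    (h : HasFDerivAt G (d₁ • ContinuousLinearMap.fst ℂ ℂ ℂ + d₂ • ContinuousLinearMap.snd ℂ ℂ ℂ)
      (z, conj z)) : HasFDerivAt (fun z => G (z, conj z)) (wirtinger d₁ d₂) z := by
  have h1 : HasFDerivAt (fun z : ℂ => (z, conj z))
      ((ContinuousLinearMap.id ℝ ℂ).prod (conjCLE : ℂ →L[ℝ] ℂ)) z :=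
    (hasFDerivAt_id z).prodMk (conjCLE : ℂ →L[ℝ] ℂ).hasFDerivAt
  refine ((h.restrictScalars ℝ).comp z h1).congr_fderiv ?_
  ext u
  simp

/-- This is `Δ_k = 4 y² ∂∂̄ - 2 i k y ∂̄`, with `4 ∂∂̄` kept in the symmetric form `2 (∂̄∂ + ∂∂̄)`
so that equality of mixed derivatives is not needed. -/
lemma cLaplacian_eq_of_wirtinger {g g₁ g₂ : ℂ → ℂ} {a b c d z : ℂ} (hz : z ∈ halfPlane)
    (h : ∀ w ∈ halfPlane, HasFDerivAt g (wirtinger (g₁ w) (g₂ w)) w)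
    (h₁ : HasFDerivAt g₁ (wirtinger a b) z) (h₂ : HasFDerivAt g₂ (wirtinger c d) z) (k : ℤ) :
    cLaplacian k g z = 2 * (z.im : ℂ) ^ 2 * (b + c) - 2 * Complex.I * k * z.im * g₂ z := by
  have e1 : EqOn (dirD 1 g) (fun w => g₁ w + g₂ w) halfPlane := fun w hw => by
    rw [dirD, (h w hw).fderiv]; simp
  have e2 : EqOn (dirD Complex.I g) (fun w => Complex.I * g₁ w + -Complex.I * g₂ w) halfPlane :=
    fun w hw => by
      rw [dirD, (h w hw).fderiv]
      simp
      ring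
  unfold cLaplacian
  rw [dirD_congr isOpen_halfPlane e1 _ hz, dirD_congr isOpen_halfPlane e2 _ hz, e1 hz, e2 hz,
    dirD, dirD, (hasFDerivAt_wirtinger_add h₁ h₂).fderiv, (hasFDerivAt_wirtinger_add
      (hasFDerivAt_wirtinger_const_mul Complex.I h₁)
      (hasFDerivAt_wirtinger_const_mul (-Complex.I) h₂)).fderiv]
  simp only [wirtinger_apply, map_one, conj_I]
  linear_combination ((z.im : ℂ) ^ 2 * (a - b - c + d) -
    Complex.I * k * z.im * (g₁ z - g₂ z)) * Complex.I_sq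

lemma hasFDerivAt_im_inv {z : ℂ} (hz : z ∈ halfPlane) :
    HasFDerivAt (fun z : ℂ => ((z.im : ℂ))⁻¹) (wirtinger (Complex.I / 2 * ((z.im : ℂ)⁻¹) ^ 2)
      (-(Complex.I / 2) * ((z.im : ℂ)⁻¹) ^ 2)) z := by
  have hz' : (z.im : ℂ) ≠ 0 := by exact_mod_cast (ne_of_gt hz : z.im ≠ 0)
  have h1 : HasFDerivAt (fun z : ℂ => (z.im : ℂ)) (ofRealCLM.comp imCLM) z :=
    (ofRealCLM.comp imCLM).hasFDerivAt
  have h2 := ((hasDerivAt_inv hz').hasFDerivAt.restrictScalars ℝ).comp z h1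
  refine h2.congr_fderiv ?_
  ext u
  have hu : (u.im : ℂ) = -(Complex.I / 2) * (u - conj u) := by
    rw [sub_conj]
    push_cast
    linear_combination (u.im : ℂ) * Complex.I_sq
  simp [hu]
  ring

/-- The shift `(k, s) ↦ (k + 2, s - 1)` and its inverse are the weight raising and lowering moves.
They preserve `s + k/2`, hence convergence, and express derivatives of terms as terms of
neighbouring weights. -/
lemma eisTerm_add_two {k : ℤ} {y : ℝ} (hy : 0 < y) {w : ℂ} (hw : w ≠ 0) (s : ℂ) :
    eisTerm (k + 2) y w (s - 1) = conj w / (w * y) * eisTerm k y w s := by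
  have hy' : (y : ℂ) ≠ 0 := by exact_mod_cast hy.ne'
  have hn : ((‖w‖ : ℝ) : ℂ) ≠ 0 := by simpa using hw
  have hc : conj w ≠ 0 := by simpa using hw
  have h1 : ((‖w‖ : ℝ) : ℂ) ^ 2 = w * conj w := by
    rw [mul_conj, normSq_eq_norm_sq]; push_cast; rfl
  unfold eisTerm
  rw [cpow_sub _ _ hy', cpow_one, show 2 * (s - 1) = 2 * s - (2 : ℕ) by push_cast; ring,
    cpow_sub _ _ hn, cpow_natCast, zpow_add₀ hw, h1]
  have h2 : ((‖w‖ : ℝ) : ℂ) ^ (2 * s) ≠ 0 := by simp [cpow_eq_zero_iff, hw]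
  have h3 : w ^ k ≠ 0 := zpow_ne_zero _ hw
  have h4 : w ^ (2 : ℤ) = w ^ 2 := by norm_cast
  rw [h4]
  field_simp

lemma eisTerm_sub_two {k : ℤ} {y : ℝ} (hy : 0 < y) {w : ℂ} (hw : w ≠ 0) (s : ℂ) :
    eisTerm (k - 2) y w (s + 1) = y * w / conj w * eisTerm k y w s := by
  have hy' : (y : ℂ) ≠ 0 := by exact_mod_cast hy.ne'
  have hc : conj w ≠ 0 := by simpa using hw
  have h := eisTerm_add_two (k := k - 2) hy hw (s + 1)
  rw [sub_add_cancel, add_sub_cancel_right] at h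
  rw [h]
  field_simp

lemma norm_eisTerm {k : ℤ} {y : ℝ} (hy : 0 < y) {w : ℂ} (hw : w ≠ 0) (s : ℂ) :
    ‖eisTerm k y w s‖ = y ^ s.re * (‖w‖ ^ 2) ^ (-(s.re + k / 2)) := by
  have hn : 0 < ‖w‖ := norm_pos_iff.2 hw
  unfold eisTerm
  rw [norm_div, norm_mul, norm_cpow_eq_rpow_re_of_pos hy, norm_cpow_eq_rpow_re_of_pos hn, norm_zpow,
    div_eq_mul_inv, ← Real.rpow_natCast, ← Real.rpow_mul hn.le, ← Real.rpow_intCast,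
    ← Real.rpow_add hn, ← Real.rpow_neg hn.le]
  congr 2
  simp
  ring

/-- Substituting `y = -(i/2)(z - z̄)` and `|w|² = w w̄` makes the term holomorphic in `z` and `z̄`
as independent variables. The bases of the complex powers are positive reals on the diagonal, so the
principal branch is differentiable there. -/
lemma hasFDerivAt_eisTerm (k : ℤ) (s : ℂ) (α β : ℝ) (v : ℤ × ℤ) {z : ℂ} (hz : z ∈ halfPlane)
    (hw : latVec α β z v ≠ 0) :
    HasFDerivAt (fun z : ℂ => eisTerm k z.im (latVec α β z v) s)
      (wirtinger (-(Complex.I / 2) * (-k * ((z.im : ℂ)⁻¹ * eisTerm k z.im (latVec α β z v) s) +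
        (s + k) * eisTerm (k + 2) z.im (latVec α β z v) (s - 1)))
        (Complex.I / 2 * s * (((z.im : ℂ)⁻¹ * (z.im : ℂ)⁻¹) *
          eisTerm (k - 2) z.im (latVec α β z v) (s + 1)))) z := by
  have hz0 : 0 < z.im := hz
  have hz' : (z.im : ℂ) ≠ 0 := by exact_mod_cast hz0.ne'
  set A : ℂ := α * v.1 with hA
  set B : ℂ := β * v.2 with hB
  have hcA : conj A = A := by simp [hA]
  have hcB : conj B = B := by simp [hB]
  have hwe (z : ℂ) : latVec α β z v = A * z + B := rfl
  have hwc (z : ℂ) : conj (latVec α β z v) = A * conj z + B := by rw [hwe]; simp [hcA, hcB]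
  have hc : conj (latVec α β z v) ≠ 0 := by simpa using hw
  have hyc (z : ℂ) : (z.im : ℂ) = -(Complex.I / 2) * (z - conj z) := by
    rw [sub_conj]
    push_cast
    linear_combination (z.im : ℂ) * Complex.I_sq
  have hns (z : ℂ) : (((‖latVec α β z v‖ : ℝ) : ℂ)) ^ 2 = (A * z + B) * (A * conj z + B) := by
    rw [← hwc, ← hwe, mul_conj, normSq_eq_norm_sq]; push_cast; rfl
  rw [eisTerm_add_two hz0 hw, eisTerm_sub_two hz0 hw]
  set G : ℂ × ℂ → ℂ := fun p => (-(Complex.I / 2) * (p.1 - p.2)) ^ s *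
    ((A * p.1 + B) * (A * p.2 + B)) ^ (-s) * (A * p.1 + B) ^ (-k) with hG
  have hGe {z : ℂ} (hw : latVec α β z v ≠ 0) :
      eisTerm k z.im (latVec α β z v) s = G (z, conj z) := by
    have hn : ((‖latVec α β z v‖ : ℝ) : ℂ) ≠ 0 := by simpa using hw
    simp only [hG, eisTerm]
    rw [← hyc, ← hns, ← hwe, _root_.zpow_neg, cpow_neg, div_eq_mul_inv, mul_inv, mul_assoc, sq,
      mul_cpow_ofReal_nonneg (norm_nonneg _) (norm_nonneg _), ← cpow_add _ _ hn, two_mul]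
  have hev : (fun z : ℂ => eisTerm k z.im (latVec α β z v) s) =ᶠ[𝓝 z] fun z => G (z, conj z) := by
    have hcont : Continuous fun z => latVec α β z v := by unfold latVec; fun_prop
    filter_upwards [hcont.continuousAt.eventually_ne hw] with z hz using hGe hz
  refine HasFDerivAt.congr_of_eventuallyEq ?_ hev
  refine hasFDerivAt_wirtinger_of_prod ?_
  rw [hGe hw]
  set w := latVec α β z v with hwdef
  set c := conj w with hcdef
  have f1 : HasFDerivAt (fun p : ℂ × ℂ => -(Complex.I / 2) * (p.1 - p.2)) (-(Complex.I / 2) •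
    (ContinuousLinearMap.fst ℂ ℂ ℂ - ContinuousLinearMap.snd ℂ ℂ ℂ)) (z, conj z) :=
    (hasFDerivAt_fst.sub hasFDerivAt_snd).const_mul _
  have f2 : HasFDerivAt (fun p : ℂ × ℂ => A * p.1 + B) (A • ContinuousLinearMap.fst ℂ ℂ ℂ)
    (z, conj z) := (hasFDerivAt_fst.const_mul A).add_const B
  have f3 : HasFDerivAt (fun p : ℂ × ℂ => A * p.2 + B) (A • ContinuousLinearMap.snd ℂ ℂ ℂ)
    (z, conj z) := (hasFDerivAt_snd.const_mul A).add_const B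
  have g1 := HasDerivAt.comp_hasFDerivAt (z, conj z)
    ((hasDerivAt_id (-(Complex.I / 2) * (z - conj z))).cpow_const (c := s) (by
      rw [id, ← hyc]; exact ofReal_mem_slitPlane.2 hz0)) f1
  have g2 := HasDerivAt.comp_hasFDerivAt (z, conj z)
    ((hasDerivAt_id ((A * z + B) * (A * conj z + B))).cpow_const (c := -s) (by
      rw [id, ← hns, ← ofReal_pow]; exact ofReal_mem_slitPlane.2 (by
        have := norm_pos_iff.2 hw; positivity))) (f2.mul f3)
  have g3 := HasDerivAt.comp_hasFDerivAt (z, conj z)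
    (hasDerivAt_zpow (-k) (A * z + B) (Or.inl hw)) f2
  have h := (g1.mul g2).mul g3
  refine h.congr_fderiv ?_
  have hwc0 : A * conj z + B = c := (hwc z).symm
  have hw0 : A * z + B = w := rfl
  -- Since `w - w̄ = 2 i A y`, the coefficient `A` can be eliminated; the remaining identity is
  -- rational in `w`, `w̄` and `y`.
  have hA' : A = -(Complex.I / 2) * (w - c) / z.im := by
    rw [eq_div_iff hz', hyc z, ← hwc0, ← hw0]
    ring
  simp only [Function.comp, id, Pi.mul_apply, hwc0, hw0, ← hyc, hG]
  rw [cpow_sub _ _ hz', cpow_sub _ _ (mul_ne_zero hw hc), cpow_one, cpow_one,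
    zpow_sub_one₀ hw]
  generalize (z.im : ℂ) ^ s = P
  generalize (w * c) ^ (-s) = N
  generalize w ^ (-k) = W
  refine ContinuousLinearMap.ext fun p => ?_
  simp
  rw [hA']
  field_simp
  ring
end Eigenfunction

/-! ### The Eisenstein series of a lattice as an eigenfunction -/

section LatticeEisenstein
open Filter Topology Set ComplexConjugate

variable {α β : ℝ} {z : ℂ}

/-- The term of the Eisenstein series of the lattice `ℤ α z + ℤ β`, zero at the zero vector. -/
def latTerm (k : ℤ) (α β : ℝ) (s : ℂ) (v : ℤ × ℤ) (z : ℂ) : ℂ :=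
  if v = 0 then 0 else eisTerm k z.im (latVec α β z v) s

/-- The Eisenstein series of the lattice `ℤ α z + ℤ β`. -/
def latEis (k : ℤ) (α β : ℝ) (s z : ℂ) : ℂ := ∑' v : ℤ × ℤ, latTerm k α β s v z

lemma latVec_ne_zero (hα : 0 < α) (hβ : 0 < β) (hz : z ∈ halfPlane) {v : ℤ × ℤ} (hv : v ≠ 0) :
    latVec α β z v ≠ 0 := fun h => by
  have := latQ_pos hα hβ hz hv
  simp [latQ, h] at this

lemma le_norm_latVec_sq (hα : 0 < α) (hβ : 0 < β) (hz : z ∈ halfPlane) (v : ℤ × ℤ) :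
    (α * β * z.im) ^ 2 / (α ^ 2 * ‖z‖ ^ 2 + β ^ 2) * nrmSq v ≤ ‖latVec α β z v‖ ^ 2 := by
  have hz0 : 0 < z.im := hz
  obtain ⟨h1, h2⟩ := latCoeff_formBound hα hβ hz
  have h3 := congrArg Complex.re (qform_latCoeff hα hβ hz v)
  rw [qform_re] at h3
  simp only [ofReal_re] at h3
  have h4 := h2 v.1 v.2
  rw [h3] at h4
  have h5 : ‖latVec α β z v‖ ^ 2 = (α * β * z.im) * latQ α β z v := by
    unfold latQ; field_simp
  have h6 : (α * β * z.im) ^ 2 / (α ^ 2 * ‖z‖ ^ 2 + β ^ 2) =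
      (α * β * z.im) * (1 / ((latCoeff α β z).1 + (latCoeff α β z).2.2)) := by
    have : (latCoeff α β z).1 + (latCoeff α β z).2.2 =
        (α ^ 2 * ‖z‖ ^ 2 + β ^ 2) / (α * β * z.im) := by
      simp only [latCoeff, normSq_eq_norm_sq]
      field_simp
    rw [this]
    field_simp
  rw [h5, h6, mul_assoc]
  gcongr
  exact h4

/-- The neighbourhood is fixed before `k` and `s`, so that one set serves the series and both
neighbours `(k ± 2, s ∓ 1)` occurring in its derivative. -/
lemma exists_locally_bound (hα : 0 < α) (hβ : 0 < β) {z₀ : ℂ} (hz₀ : z₀ ∈ halfPlane) :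
    ∃ t : Set ℂ, IsOpen t ∧ IsPreconnected t ∧ z₀ ∈ t ∧ t ⊆ halfPlane ∧
      (∃ c > 0, ∀ z ∈ t, c ≤ z.im) ∧
      ∀ (k : ℤ) (s : ℂ), 1 < s.re + k / 2 → ∃ C, 0 ≤ C ∧ ∀ z ∈ t, ∀ v,
        ‖latTerm k α β s v z‖ ≤ C * if v = 0 then 0 else nrmSq v ^ (-(s.re + k / 2)) := by
  have hy : 0 < z₀.im := hz₀
  have him : ∀ z ∈ Metric.ball z₀ (z₀.im / 2), z₀.im / 2 ≤ z.im ∧ z.im ≤ 2 * z₀.im ∧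
      ‖z‖ ≤ ‖z₀‖ + z₀.im := by
    intro z hz
    rw [mem_ball_iff_norm] at hz
    have h1 := (abs_im_le_norm (z - z₀)).trans hz.le
    rw [sub_im, abs_le] at h1
    refine ⟨by linarith [h1.1], by linarith [h1.2], ?_⟩
    have := norm_sub_norm_le z z₀
    linarith
  have hsub : Metric.ball z₀ (z₀.im / 2) ⊆ halfPlane := fun z hz =>
    lt_of_lt_of_le (half_pos hy) (him z hz).1
  refine ⟨Metric.ball z₀ (z₀.im / 2), Metric.isOpen_ball, (convex_ball _ _).isPreconnected,
    Metric.mem_ball_self (half_pos hy), hsub, ⟨_, half_pos hy, fun z hz => (him z hz).1⟩,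
    fun k s hs => ?_⟩
  set c := z₀.im / 2
  set δ := (α * β * c) ^ 2 / (α ^ 2 * (‖z₀‖ + z₀.im) ^ 2 + β ^ 2) with hδ
  have hc : 0 < c := half_pos hy
  have hδ0 : 0 < δ := by positivity
  refine ⟨(c ^ s.re + (2 * z₀.im) ^ s.re) * δ ^ (-(s.re + k / 2)), by positivity,
    fun z hz v => ?_⟩
  unfold latTerm
  split_ifs with hv
  · simp
  · obtain ⟨h1, h2, h3⟩ := him z hz
    have hz0 : 0 < z.im := hsub hz
    have hn : 0 < nrmSq v := zero_lt_one.trans_le (one_le_nrmSq hv)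
    rw [norm_eisTerm hz0 (latVec_ne_zero hα hβ (hsub hz) hv), mul_assoc]
    have e1 : δ * nrmSq v ≤ ‖latVec α β z v‖ ^ 2 := by
      refine le_trans ?_ (le_norm_latVec_sq hα hβ (hsub hz) v)
      rw [hδ]
      gcongr
    have e2 : z.im ^ s.re ≤ c ^ s.re + (2 * z₀.im) ^ s.re := by
      rcases le_total 0 s.re with h | h
      · have := Real.rpow_le_rpow hz0.le h2 h
        have : 0 ≤ c ^ s.re := by positivity
        linarith
      · have := Real.rpow_le_rpow_of_nonpos hc h1 h
        have : 0 ≤ (2 * z₀.im) ^ s.re := by positivity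
        linarith
    rw [← Real.mul_rpow hδ0.le hn.le]
    refine mul_le_mul e2 (Real.rpow_le_rpow_of_nonpos (by positivity) e1 (by linarith))
      (by positivity) (by positivity)

lemma summable_latTerm (hα : 0 < α) (hβ : 0 < β) (hz : z ∈ halfPlane) {k : ℤ} {s : ℂ}
    (hs : 1 < s.re + k / 2) : Summable fun v => latTerm k α β s v z := by
  obtain ⟨t, -, -, ht, -, -, hb⟩ := exists_locally_bound hα hβ hz
  obtain ⟨C, -, hC⟩ := hb k s hs
  exact Summable.of_norm_bounded ((summable_nrmSq_rpow hs).mul_left C) fun v => hC z ht v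

lemma hasFDerivAt_latEis (hα : 0 < α) (hβ : 0 < β) (hz : z ∈ halfPlane) {k : ℤ} {s : ℂ}
    (hs : 1 < s.re + k / 2) : HasFDerivAt (latEis k α β s)
      (wirtinger (-(Complex.I / 2) * (-k * ((z.im : ℂ)⁻¹ * latEis k α β s z) +
        (s + k) * latEis (k + 2) α β (s - 1) z))
        (Complex.I / 2 * s * (((z.im : ℂ)⁻¹ * (z.im : ℂ)⁻¹) *
          latEis (k - 2) α β (s + 1) z))) z := by
  have hs1 : 1 < (s - 1).re + ((k + 2 : ℤ) : ℝ) / 2 := by push_cast; simp; linarith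
  have hs2 : 1 < (s + 1).re + ((k - 2 : ℤ) : ℝ) / 2 := by push_cast; simp; linarith
  have hs1' : (s - 1).re + ((k + 2 : ℤ) : ℝ) / 2 = s.re + k / 2 := by push_cast; simp; ring
  have hs2' : (s + 1).re + ((k - 2 : ℤ) : ℝ) / 2 = s.re + k / 2 := by push_cast; simp; ring
  obtain ⟨t, ho, hp, ht, hsub, ⟨c, hc, hcy⟩, hb⟩ := exists_locally_bound hα hβ hz
  obtain ⟨C, hC0, hC⟩ := hb k s hs
  obtain ⟨C₁, hC10, hC1⟩ := hb (k + 2) (s - 1) hs1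
  obtain ⟨C₂, hC20, hC2⟩ := hb (k - 2) (s + 1) hs2
  rw [hs1'] at hC1
  rw [hs2'] at hC2
  set u : ℤ × ℤ → ℝ := fun v => if v = 0 then 0 else nrmSq v ^ (-(s.re + k / 2)) with hu
  set f' : ℤ × ℤ → ℂ → ℂ →L[ℝ] ℂ := fun v z =>
    wirtinger (-(Complex.I / 2) * (-k * ((z.im : ℂ)⁻¹ * latTerm k α β s v z) +
        (s + k) * latTerm (k + 2) α β (s - 1) v z))
        (Complex.I / 2 * s * (((z.im : ℂ)⁻¹ * (z.im : ℂ)⁻¹) *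
          latTerm (k - 2) α β (s + 1) v z)) with hf'
  have hder : ∀ v z, z ∈ t → HasFDerivAt (latTerm k α β s v) (f' v z) z := by
    intro v z hz
    simp only [hf']
    by_cases hv : v = 0
    · subst hv
      have : latTerm k α β s 0 = fun _ => 0 := by funext z; simp [latTerm]
      rw [this]
      refine (hasFDerivAt_const (0 : ℂ) z).congr_fderiv ?_
      ext u
      simp [latTerm]
    · have := hasFDerivAt_eisTerm k s α β v (hsub hz) (latVec_ne_zero hα hβ (hsub hz) hv)
      have hfun : latTerm k α β s v = fun z => eisTerm k z.im (latVec α β z v) s := by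
        funext z; simp [latTerm, hv]
      rw [hfun]
      simpa [latTerm, hv] using this
  have hbound : ∀ v z, z ∈ t → ‖f' v z‖ ≤ (‖(k : ℂ)‖ * (c⁻¹ * C) + ‖s + k‖ * C₁ +
      ‖s‖ * ((c⁻¹ * c⁻¹) * C₂)) * u v := by
    intro v z hz
    have hu0 : 0 ≤ u v := by
      simp only [hu]; split_ifs
      exacts [le_rfl, Real.rpow_nonneg (nrmSq_nonneg v) _]
    have hy : ‖((z.im : ℂ))⁻¹‖ ≤ c⁻¹ := by
      rw [norm_inv, norm_real, Real.norm_of_nonneg (hc.le.trans (hcy z hz))]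
      exact inv_anti₀ hc (hcy z hz)
    have hI : ‖(Complex.I / 2 : ℂ)‖ ≤ 1 := by simp; norm_num
    refine (norm_wirtinger_le _ _).trans ?_
    have e1 : ‖-(Complex.I / 2) * (-k * ((z.im : ℂ)⁻¹ * latTerm k α β s v z) +
        (s + k) * latTerm (k + 2) α β (s - 1) v z)‖ ≤
        1 * (‖(k : ℂ)‖ * (c⁻¹ * (C * u v)) + ‖s + k‖ * (C₁ * u v)) := by
      rw [norm_mul, norm_neg]
      refine mul_le_mul hI ((norm_add_le _ _).trans ?_) (norm_nonneg _) zero_le_one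
      rw [norm_mul, norm_mul, norm_mul, norm_neg]
      gcongr
      exacts [hC z hz v, hC1 z hz v]
    have e2 : ‖Complex.I / 2 * s * (((z.im : ℂ)⁻¹ * (z.im : ℂ)⁻¹) *
          latTerm (k - 2) α β (s + 1) v z)‖ ≤ 1 * ‖s‖ * ((c⁻¹ * c⁻¹) * (C₂ * u v)) := by
      rw [norm_mul, norm_mul, norm_mul, norm_mul]
      gcongr
      exact hC2 z hz v
    linarith
  have hsum := hasFDerivAt_tsum_of_isPreconnected ((summable_nrmSq_rpow hs).mul_left _) ho hp hder
    hbound ht (summable_latTerm hα hβ hz hs) ht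
  refine hsum.congr_fderiv (HasSum.tsum_eq ?_)
  have h0 := (summable_latTerm hα hβ hz hs).hasSum
  have h1 := (summable_latTerm hα hβ hz hs1).hasSum
  have h2 := (summable_latTerm hα hβ hz hs2).hasSum
  exact ((((((h0.mul_left _).mul_left _).add (h1.mul_left _)).mul_left _).smul_const
    (ContinuousLinearMap.id ℝ ℂ)).add (((h2.mul_left _).mul_left _).smul_const
      (conjCLE : ℂ →L[ℝ] ℂ)))

/-- The Eisenstein series is an eigenfunction of the Laplacian. -/
lemma cLaplacian_latEis (hα : 0 < α) (hβ : 0 < β) (hz : z ∈ halfPlane) {k : ℤ} {s : ℂ}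
    (hs : 1 < s.re + k / 2) :
    cLaplacian k (latEis k α β s) z = s * (s + k - 1) * latEis k α β s z := by
  have hs1 : 1 < (s - 1).re + ((k + 2 : ℤ) : ℝ) / 2 := by push_cast; simp; linarith
  have hs2 : 1 < (s + 1).re + ((k - 2 : ℤ) : ℝ) / 2 := by push_cast; simp; linarith
  have hz' : (z.im : ℂ) ≠ 0 := by exact_mod_cast (ne_of_gt hz : z.im ≠ 0)
  have f0 := hasFDerivAt_latEis hα hβ hz hs
  have f1 := hasFDerivAt_latEis hα hβ hz hs1
  have f2 := hasFDerivAt_latEis hα hβ hz hs2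
  have fy := hasFDerivAt_im_inv hz
  -- Lowering the series of weight `k + 2`, or raising that of weight `k - 2`, returns to the
  -- original `(k, s)`.
  rw [add_sub_cancel_right, sub_add_cancel] at f1
  rw [sub_add_cancel, add_sub_cancel_right] at f2
  have h₁ := hasFDerivAt_wirtinger_const_mul (-(Complex.I / 2)) (hasFDerivAt_wirtinger_add
    (hasFDerivAt_wirtinger_const_mul (-k : ℂ) (hasFDerivAt_wirtinger_mul fy f0))
    (hasFDerivAt_wirtinger_const_mul (s + k) f1))
  have h₂ := hasFDerivAt_wirtinger_const_mul (Complex.I / 2 * s) (hasFDerivAt_wirtinger_mul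
    (hasFDerivAt_wirtinger_mul fy fy) f2)
  rw [cLaplacian_eq_of_wirtinger hz (fun w hw => hasFDerivAt_latEis hα hβ hw hs) h₁ h₂ k]
  have hI : Complex.I ^ 2 = -1 := Complex.I_sq
  push_cast
  field_simp
  ring_nf
  simp only [hI]
  ring
end LatticeEisenstein

/-! ### Arithmetic of the two index sets -/

section IndexSets
open Set

/-- The map `(a, b) ↦ (a, p b)`. -/
def scaleSnd (p : ℕ) (v : ℤ × ℤ) : ℤ × ℤ := (v.1, p * v.2)

/-- The map `(a, b) ↦ (p a, b)`. -/
def scaleFst (p : ℕ) (v : ℤ × ℤ) : ℤ × ℤ := (p * v.1, v.2)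

lemma eisSetL_swap {p : ℕ} {v : ℤ × ℤ} : v.swap ∈ eisSetL p ↔ v ∈ eisSetR p := by
  simp only [eisSetL, eisSetR, mem_ofPred_eq, Prod.fst_swap, Prod.snd_swap]
  refine exists_congr fun t => ?_
  rw [Int.gcd_comm]
  tauto

lemma mem_eisSetL_iff {p : ℕ} (v : ℤ × ℤ) : v ∈ eisSetL p ↔
    v ≠ 0 ∧ ((p * v.1).gcd v.2 : ℤ) ∣ v.1 := by
  constructor
  · rintro ⟨t, ht, h1, h2, h3⟩
    refine ⟨?_, h3 ▸ h1⟩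
    rintro rfl
    simp at h3
    omega
  · rintro ⟨h0, h1⟩
    refine ⟨_, Nat.pos_of_ne_zero fun h => h0 ?_, h1, Int.gcd_dvd_right _ _, rfl⟩
    rw [Int.gcd_eq_zero_iff] at h
    rw [Int.gcd_eq_zero_iff.2 h] at h1
    exact Prod.ext (by simpa using h1) h.2

lemma mem_eisSetR_iff {p : ℕ} (v : ℤ × ℤ) : v ∈ eisSetR p ↔
    v ≠ 0 ∧ (v.1.gcd (p * v.2) : ℤ) ∣ v.2 := by
  rw [← eisSetL_swap, mem_eisSetL_iff, Prod.fst_swap, Prod.snd_swap, Int.gcd_comm]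
  refine and_congr_left fun _ => not_congr ?_
  rw [← Prod.swap_inj, Prod.swap_swap]
  rfl

/-- A nonzero vector outside `eisSetL` is of the form `(a, p b)` with `(a, b)` in `eisSetR`. -/
lemma ne_zero_iff_eisSetL {p : ℕ} (hp : p.Prime) (v : ℤ × ℤ) :
    v ≠ 0 ∧ v ∉ eisSetL p ↔ v ∈ scaleSnd p '' eisSetR p := by
  have hp0 : (p : ℤ) ≠ 0 := by exact_mod_cast hp.ne_zero
  constructor
  · rintro ⟨h0, h1⟩
    rw [mem_eisSetL_iff, not_and] at h1
    have h2 := h1 h0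
    obtain ⟨a, b⟩ := v
    simp only at h2
    have hg : 0 < Int.gcd a b := Int.gcd_pos_iff.2 (by
      by_contra! h
      exact h0 (Prod.ext h.1 h.2))
    obtain ⟨a', b', hco, ha, hb⟩ := Int.exists_gcd_one hg
    set g := Int.gcd a b
    -- Here `a = a' g` and `b = b' g` with `a'`, `b'` coprime. If `p ∤ b'`, then `gcd (p a, b) = g`
    -- divides `a`, which is membership in `eisSetL p`.
    have hb' : (p : ℤ) ∣ b' := by
      by_contra hnd
      apply h2
      have hc : IsCoprime (p * a' : ℤ) b' := by
        refine IsCoprime.mul_left ?_ (Int.isCoprime_iff_gcd_eq_one.2 hco)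
        exact (Nat.prime_iff_prime_int.1 hp).coprime_iff_not_dvd.2 hnd
      have : Int.gcd (p * a) b = g := by
        rw [ha, hb, ← mul_assoc, Int.gcd_mul_right, Int.isCoprime_iff_gcd_eq_one.1 hc]
        simp
      rw [this]
      exact Int.gcd_dvd_left _ _
    obtain ⟨b'', rfl⟩ := hb'
    refine ⟨(a, b'' * g), ?_, ?_⟩
    · rw [mem_eisSetR_iff]
      have hbb : (p : ℤ) * (b'' * g) = b := by rw [hb]; ring
      refine ⟨fun h => h0 ?_, ?_⟩
      · have h3 := congrArg Prod.fst h
        have h4 := congrArg Prod.snd h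
        simp only [Prod.fst_zero, Prod.snd_zero] at h3 h4
        exact Prod.ext h3 (by simp [← hbb, h4])
      · simp only [hbb]
        exact Dvd.intro_left _ rfl
    · simp only [scaleSnd]
      rw [hb]
      congr 1
      ring
  · rintro ⟨⟨a, b⟩, h, rfl⟩
    rw [mem_eisSetR_iff] at h
    obtain ⟨h0, h1⟩ := h
    simp only at h1
    simp only [scaleSnd]
    have h0' : ((a, p * b) : ℤ × ℤ) ≠ 0 := fun h => h0 (by
      have h3 := congrArg Prod.fst h
      have h4 := congrArg Prod.snd h
      simp only [Prod.fst_zero, Prod.snd_zero, mul_eq_zero, hp0, false_or] at h3 h4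
      exact Prod.ext h3 h4)
    refine ⟨h0', fun h2 => ?_⟩
    rw [mem_eisSetL_iff] at h2
    have h3 := h2.2
    simp only at h3
    rw [Int.gcd_mul_left] at h3
    set g := Int.gcd a (p * b) with hg
    -- Membership in `eisSetR p` gives `g ∣ gcd (a, b)`, while membership of `(a, p b)` in `eisSetL
    -- p` would give `p gcd (a, b) ∣ g`; these are incompatible.
    have hgb : (g : ℤ) ∣ (Int.gcd a b : ℤ) := Int.dvd_coe_gcd (Int.gcd_dvd_left _ _) h1
    have h4 : ((Int.natAbs p * Int.gcd a b : ℕ) : ℤ) ∣ g := by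
      refine Int.dvd_coe_gcd h3 ?_
      rw [Int.natAbs_natCast]
      push_cast
      exact mul_dvd_mul_left _ (Int.gcd_dvd_right _ _)
    have h5 : ((Int.natAbs p * Int.gcd a b : ℕ) : ℤ) ∣ (Int.gcd a b : ℤ) := h4.trans hgb
    rw [Int.natCast_dvd_natCast, Int.natAbs_natCast] at h5
    have hpos : 0 < Int.gcd a b := Int.gcd_pos_iff.2 (by
      by_contra! h
      exact h0 (Prod.ext h.1 h.2))
    have := Nat.le_of_dvd hpos h5
    have h2p := hp.two_le
    nlinarith

lemma ne_zero_iff_eisSetR {p : ℕ} (hp : p.Prime) (v : ℤ × ℤ) :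
    v ≠ 0 ∧ v ∉ eisSetR p ↔ v ∈ scaleFst p '' eisSetL p := by
  have h := ne_zero_iff_eisSetL hp v.swap
  rw [eisSetL_swap] at h
  have h0 : v.swap ≠ 0 ↔ v ≠ 0 := not_congr (by rw [← Prod.swap_inj, Prod.swap_swap]; rfl)
  rw [h0] at h
  rw [h]
  constructor
  · rintro ⟨w, hw, he⟩
    refine ⟨w.swap, eisSetL_swap.2 hw, ?_⟩
    rw [← Prod.swap_swap v, ← he]
    rfl
  · rintro ⟨w, hw, he⟩
    refine ⟨w.swap, eisSetL_swap.1 (by rwa [Prod.swap_swap]), ?_⟩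
    rw [← he]
    rfl
end IndexSets

/-! ### Uniqueness of meromorphic continuation -/

section Continuation
open Filter Topology Set

/-- The difference vanishes on a half plane, so its order is infinite at one point and by
connectedness at every point. Two normal forms that agree on a punctured neighbourhood also agree at
its centre. -/
lemma IsMeromorphicContinuation.unique {c : ℝ} {f F G : ℂ → ℂ}
    (hF : IsMeromorphicContinuation c f F) (hG : IsMeromorphicContinuation c f G) : F = G := by
  have hmF : MeromorphicOn F univ := hF.1.meromorphicOn
  have hmG : MeromorphicOn G univ := hG.1.meromorphicOn
  set x₀ : ℂ := ((c + 1 : ℝ) : ℂ)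
  have hx₀ : meromorphicOrderAt (F - G) x₀ = ⊤ := by
    rw [meromorphicOrderAt_eq_top_iff]
    have ho : IsOpen {s : ℂ | c < s.re} := isOpen_lt continuous_const continuous_re
    filter_upwards [mem_nhdsWithin_of_mem_nhds (ho.mem_nhds (show c < x₀.re by simp [x₀]))]
      with s hs
    simp [hF.2 s hs, hG.2 s hs]
  funext x
  have hx : meromorphicOrderAt (F - G) x = ⊤ := by
    by_contra h
    exact (hmF.sub hmG).meromorphicOrderAt_ne_top_of_isPreconnected isPreconnected_univ
      (mem_univ x) (mem_univ x₀) h hx₀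
  rw [meromorphicOrderAt_eq_top_iff] at hx
  have h1 : F =ᶠ[𝓝[≠] x] G := by
    filter_upwards [hx] with s hs
    exact sub_eq_zero.1 hs
  exact ((hF.1 (mem_univ x)).eventuallyEq_nhdsNE_iff_eventuallyEq_nhds
    (hG.1 (mem_univ x))).1 h1 |>.self_of_nhds

lemma toMeromorphicNFOn_eventuallyEq {g : ℂ → ℂ} (hg : MeromorphicOn g univ) {x : ℂ}
    (hx : AnalyticAt ℂ g x) : toMeromorphicNFOn g univ =ᶠ[𝓝 x] g := by
  have h1 : toMeromorphicNFOn g univ =ᶠ[𝓝[≠] x] g :=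
    hg.toMeromorphicNFOn_eq_self_on_nhdsNE (mem_univ x)
  exact ((meromorphicNFOn_toMeromorphicNFOn g univ
    (mem_univ x)).eventuallyEq_nhdsNE_iff_eventuallyEq_nhds hx.meromorphicNFAt).1 h1

lemma isMeromorphicContinuation_toMeromorphicNFOn {c : ℝ} {f g : ℂ → ℂ}
    (hg : MeromorphicOn g univ) (ha : ∀ s : ℂ, c < s.re → AnalyticAt ℂ g s)
    (h : ∀ s : ℂ, c < s.re → g s = f s) :
    IsMeromorphicContinuation c f (toMeromorphicNFOn g univ) :=
  ⟨meromorphicNFOn_toMeromorphicNFOn g univ, fun s hs => by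
    rw [(toMeromorphicNFOn_eventuallyEq hg (ha s hs)).self_of_nhds, h s hs]⟩

lemma IsMeromorphicContinuation.meromorphicContinuation_eq {c : ℝ} {f F : ℂ → ℂ}
    (hF : IsMeromorphicContinuation c f F) : meromorphicContinuation c f = F :=
  (Classical.epsilon_spec (p := IsMeromorphicContinuation c f) ⟨F, hF⟩).unique hF

end Continuation

/-! ### From the series of `R(p)` to lattice series -/

section LatticeDecomposition
open Set

variable {p : ℕ} {k : ℤ} {z : ℂ} {s : ℂ}

lemma cpow_add_half_even (hp : 0 < p) (hk : Even k) (s : ℂ) :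
    (p : ℂ) ^ (s + k / 2) = (√(p : ℝ) : ℂ) ^ (2 * s) * (√(p : ℝ) : ℂ) ^ k := by
  have hp' : (0 : ℝ) < p := by exact_mod_cast hp
  have h1 : (√(p : ℝ) : ℂ) ≠ 0 := by
    exact_mod_cast (Real.sqrt_pos.2 hp').ne'
  have h2 : (p : ℂ) ≠ 0 := by exact_mod_cast hp.ne'
  obtain ⟨j, rfl⟩ := hk
  rw [← cpow_intCast, ← cpow_add _ _ h1, cpow_def_of_ne_zero h1, cpow_def_of_ne_zero h2,
    ← ofReal_log (Real.sqrt_nonneg _), Real.log_sqrt hp'.le, ← ofReal_natCast,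
    ← ofReal_log hp'.le]
  congr 1
  push_cast
  ring

lemma eisTerm_sqrt_mul (hp : 0 < p) (hk : Even k) (y : ℝ) (w : ℂ) :
    eisTerm k y (√(p : ℝ) * w) s = ((p : ℂ) ^ (s + k / 2))⁻¹ * eisTerm k y w s := by
  rw [cpow_add_half_even hp hk]
  unfold eisTerm
  rw [norm_mul, norm_real, Real.norm_of_nonneg (Real.sqrt_nonneg _), ofReal_mul,
    mul_cpow_ofReal_nonneg (Real.sqrt_nonneg _) (norm_nonneg _), mul_zpow, div_eq_mul_inv,
    div_eq_mul_inv, mul_inv, mul_inv, mul_inv, mul_inv]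
  ring

lemma scaleSnd_injective (hp : 0 < p) : Function.Injective (scaleSnd p) := by
  intro v w h
  have h1 := congrArg Prod.fst h
  have h2 := congrArg Prod.snd h
  simp only [scaleSnd] at h1 h2
  have : (p : ℤ) ≠ 0 := by exact_mod_cast hp.ne'
  exact Prod.ext h1 (mul_left_cancel₀ this h2)

lemma scaleFst_injective (hp : 0 < p) : Function.Injective (scaleFst p) := by
  intro v w h
  have h1 := congrArg Prod.fst h
  have h2 := congrArg Prod.snd h
  simp only [scaleFst] at h1 h2
  have : (p : ℤ) ≠ 0 := by exact_mod_cast hp.ne'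
  exact Prod.ext (mul_left_cancel₀ this h1) h2

lemma tsum_eq_tsum_add_tsum_image {f : ℤ × ℤ → ℂ} (hf : Summable f) (hf0 : f 0 = 0)
    {A B : Set (ℤ × ℤ)} (hA0 : (0 : ℤ × ℤ) ∉ A) {g : ℤ × ℤ → ℤ × ℤ} (hg : Function.Injective g)
    (h : ∀ v, v ≠ 0 ∧ v ∉ A ↔ v ∈ g '' B) :
    ∑' v, f v = ∑' v : A, f v + ∑' v : B, f (g v) := by
  rw [← tsum_image f hg.injOn, tsum_subtype, tsum_subtype,
    ← (hf.indicator _).tsum_add (hf.indicator _)]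
  refine tsum_congr fun v => ?_
  by_cases h0 : v = 0
  · subst h0
    have : (0 : ℤ × ℤ) ∉ g '' B := fun h' => ((h 0).2 h').1 rfl
    rw [indicator_of_notMem hA0, indicator_of_notMem this, hf0, add_zero]
  · by_cases hA : v ∈ A
    · have : v ∉ g '' B := fun h' => ((h v).2 h').2 hA
      rw [indicator_of_mem hA, indicator_of_notMem this, add_zero]
    · rw [indicator_of_notMem hA, indicator_of_mem ((h v).1 ⟨h0, hA⟩), zero_add]

lemma zero_notMem_eisSetL : (0 : ℤ × ℤ) ∉ eisSetL p := fun h => ((mem_eisSetL_iff 0).1 h).1 rfl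

lemma zero_notMem_eisSetR : (0 : ℤ × ℤ) ∉ eisSetR p := fun h => ((mem_eisSetR_iff 0).1 h).1 rfl

lemma latTerm_of_ne_zero {α β : ℝ} {v : ℤ × ℤ} (hv : v ≠ 0) :
    latTerm k α β s v z = eisTerm k z.im (latVec α β z v) s := if_neg hv

/-- On the complement of `eisSetL p` the lattice vector is `√p a z + p b = √p (a z + √p b)`, and
pulling out `√p` scales the term by `p^(-(s+k/2))`. -/
lemma latEis_sqrt_one (hp : p.Prime) (hk : Even k) (z : ℍ) (hs : 1 < s.re + k / 2) :
    latEis k √(p : ℝ) 1 s z =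
      2 * eisGL p k z s + ((p : ℂ) ^ (s + k / 2))⁻¹ * (2 * eisGR p k z s) := by
  have hp0 : 0 < √(p : ℝ) := Real.sqrt_pos.2 (by exact_mod_cast hp.pos)
  have hsum := summable_latTerm hp0 one_pos (z := z) z.im_pos hs
  rw [latEis, tsum_eq_tsum_add_tsum_image hsum (by simp [latTerm]) zero_notMem_eisSetL
    (scaleSnd_injective hp.pos) (ne_zero_iff_eisSetL hp), eisGL, eisGR, ← mul_assoc 2, ← mul_assoc 2,
    mul_one_div_cancel two_ne_zero, one_mul, one_mul, ← tsum_mul_left]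
  congr 1
  · refine tsum_congr fun v => ?_
    rw [latTerm_of_ne_zero (ne_of_mem_of_not_mem v.2 zero_notMem_eisSetL)]
    simp [latVec]
  · refine tsum_congr fun v => ?_
    rw [latTerm_of_ne_zero ((ne_zero_iff_eisSetL hp _).2 ⟨v, v.2, rfl⟩).1,
      ← eisTerm_sqrt_mul hp.pos hk]
    congr 1
    have h2 : (√(p : ℝ) : ℂ) * √(p : ℝ) = p := by
      rw [← ofReal_mul, Real.mul_self_sqrt (Nat.cast_nonneg p), ofReal_natCast]
    simp only [latVec, scaleSnd]
    push_cast
    linear_combination (-(v.1.2 : ℂ)) * h2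

lemma latEis_one_sqrt (hp : p.Prime) (hk : Even k) (z : ℍ) (hs : 1 < s.re + k / 2) :
    latEis k 1 √(p : ℝ) s z =
      2 * eisGR p k z s + ((p : ℂ) ^ (s + k / 2))⁻¹ * (2 * eisGL p k z s) := by
  have hp0 : 0 < √(p : ℝ) := Real.sqrt_pos.2 (by exact_mod_cast hp.pos)
  have hsum := summable_latTerm one_pos hp0 (z := z) z.im_pos hs
  rw [latEis, tsum_eq_tsum_add_tsum_image hsum (by simp [latTerm]) zero_notMem_eisSetR
    (scaleFst_injective hp.pos) (ne_zero_iff_eisSetR hp), eisGL, eisGR, ← mul_assoc 2, ← mul_assoc 2,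
    mul_one_div_cancel two_ne_zero, one_mul, one_mul, ← tsum_mul_left]
  congr 1
  · refine tsum_congr fun v => ?_
    rw [latTerm_of_ne_zero (ne_of_mem_of_not_mem v.2 zero_notMem_eisSetR)]
    simp [latVec]
  · refine tsum_congr fun v => ?_
    rw [latTerm_of_ne_zero ((ne_zero_iff_eisSetR hp _).2 ⟨v, v.2, rfl⟩).1,
      ← eisTerm_sqrt_mul hp.pos hk]
    congr 1
    have h2 : (√(p : ℝ) : ℂ) * √(p : ℝ) = p := by
      rw [← ofReal_mul, Real.mul_self_sqrt (Nat.cast_nonneg p), ofReal_natCast]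
    simp only [latVec, scaleFst]
    push_cast
    linear_combination (-(v.1.1 : ℂ) * z) * h2

/-- The denominator relating the Eisenstein series of `R(p)` to those of lattices. -/
def eisDen (p : ℕ) (k : ℤ) (s : ℂ) : ℂ :=
  (1 + (p : ℂ) ^ (s + k / 2 - 1)) * (1 + (p : ℂ) ^ (-(s + k / 2)))

lemma one_add_cpow_ne_zero (hp : 1 < p) {a : ℂ} (ha : a.re ≠ 0) :
    1 + (p : ℂ) ^ a ≠ 0 ∧ 1 - (p : ℂ) ^ a ≠ 0 := by
  have h1 : ‖(p : ℂ) ^ a‖ ≠ 1 := by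
    rw [norm_natCast_cpow_of_pos (zero_lt_one.trans hp)]
    have hp' : (1 : ℝ) < p := by exact_mod_cast hp
    intro h
    rcases lt_or_gt_of_ne ha with h' | h'
    · exact (Real.rpow_lt_one_of_one_lt_of_neg hp' h').ne h
    · exact (Real.one_lt_rpow hp' h').ne' h
  constructor
  · intro h
    apply h1
    rw [eq_neg_of_add_eq_zero_right h]
    simp
  · intro h
    apply h1
    rw [← sub_eq_zero.1 h]
    simp

lemma eisDen_ne_zero (hp : p.Prime) (hs : 1 < s.re + k / 2) : eisDen p k s ≠ 0 := by
  have hre : (s + k / 2).re = s.re + k / 2 := by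
    rw [add_re, show (k : ℂ) / 2 = ((k / 2 : ℝ) : ℂ) by push_cast; rfl, ofReal_re]
  refine mul_ne_zero (one_add_cpow_ne_zero hp.one_lt ?_).1 (one_add_cpow_ne_zero hp.one_lt ?_).1
  · rw [sub_re, hre, one_re]; linarith
  · rw [neg_re, hre]; linarith

lemma eisDen_zero_ne_zero : eisDen p k 0 ≠ 0 := by
  have h (x : ℝ) : 1 + (p : ℂ) ^ (x : ℂ) ≠ 0 := by
    have h1 : (0 : ℝ) < 1 + (p : ℝ) ^ x := by positivity
    have h2 : (1 + (p : ℂ) ^ (x : ℂ)) = ((1 + (p : ℝ) ^ x : ℝ) : ℂ) := by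
      rw [ofReal_add, ofReal_cpow (Nat.cast_nonneg p)]
      simp
    rw [h2]
    exact_mod_cast h1.ne'
  refine mul_ne_zero ?_ ?_
  · convert h (k / 2 - 1) using 3
    push_cast; ring
  · convert h (-(k / 2)) using 3
    push_cast; ring

/-- With `A = p^(s+k/2-1)` one has `f_p = (1 - A) / (1 - A²) = 1 / (1 + A)`, the division being
legitimate since `|A| > 1`. The sum of the two decompositions is `2 (1 + p^(-(s+k/2))) G`. -/
lemma eisF_mul_eisG (hp : p.Prime) (hk : Even k) (z : ℍ) (hs : 1 < s.re + k / 2) :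
    eisF p k s * eisG p k z s =
      (eisDen p k s)⁻¹ * (1 / 2 * (latEis k √(p : ℝ) 1 s z + latEis k 1 √(p : ℝ) s z)) := by
  have hp0 : (p : ℂ) ≠ 0 := by exact_mod_cast hp.ne_zero
  have hre : (s + k / 2).re = s.re + k / 2 := by
    rw [add_re, show (k : ℂ) / 2 = ((k / 2 : ℝ) : ℂ) by push_cast; rfl, ofReal_re]
  have hA := one_add_cpow_ne_zero hp.one_lt (a := s + k / 2 - 1)
    (by rw [sub_re, hre, one_re]; linarith)
  have hq := (one_add_cpow_ne_zero hp.one_lt (a := -(s + k / 2)) (by rw [neg_re, hre]; linarith)).1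
  have h2 : (p : ℂ) ^ (2 * s + k - 2) = (p : ℂ) ^ (s + k / 2 - 1) * (p : ℂ) ^ (s + k / 2 - 1) := by
    rw [← cpow_add _ _ hp0]; congr 1; ring
  rw [latEis_sqrt_one hp hk z hs, latEis_one_sqrt hp hk z hs, ← cpow_neg, eisF, eisG, eisDen,
    hp.primeFactors, Finset.card_singleton, Finset.prod_singleton, h2,
    show s - 1 + (k : ℂ) / 2 = s + k / 2 - 1 by ring]
  set A := (p : ℂ) ^ (s + k / 2 - 1)
  set q := (p : ℂ) ^ (-(s + k / 2))
  have h3 : 1 - A * A = (1 + A) * (1 - A) := by ring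
  rw [h3]
  have := hA.1
  have := hA.2
  field_simp
  ring

end LatticeDecomposition

/-! ### The completed series as an entire function of `s` -/

section Completion
open Filter Topology Set ComplexConjugate

variable {p : ℕ} {k : ℤ} {z s : ℂ} {α β : ℝ}

/-- `conj z` for nonnegative weights and `z` for negative ones. -/
def weightConj (k : ℤ) (z : ℂ) : ℂ := if 0 ≤ k then conj z else z

lemma contDiff_weightConj (k : ℤ) : ContDiff ℝ ∞ (weightConj k) := by
  unfold weightConj
  split_ifs
  · exact (conjCLE : ℂ →L[ℝ] ℂ).contDiff
  · exact contDiff_id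

lemma norm_weightConj (k : ℤ) (z : ℂ) : ‖weightConj k z‖ = ‖z‖ := by
  unfold weightConj; split_ifs <;> simp

lemma weightConj_quadratic (k : ℤ) (z : ℂ) :
    weightConj k z ^ 2 - 2 * z.re * weightConj k z + normSq z = 0 := by
  have h1 : (2 * z.re : ℂ) = z + conj z := by rw [add_conj]; push_cast; rfl
  rw [h1, ← mul_conj]
  unfold weightConj
  split_ifs <;> ring

lemma latVec_weightConj (k : ℤ) (v : ℤ × ℤ) :
    latVec α β (weightConj k z) v = weightConj k (latVec α β z v) := by
  unfold weightConj
  split_ifs <;> simp [latVec]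

lemma cpow_scale {a r y : ℝ} (ha : 0 < a) (hr : 0 < r) (hy : 0 < y) (s : ℂ) :
    ((a * r ^ 2 / y : ℝ) : ℂ) ^ s = (a : ℂ) ^ s * (r : ℂ) ^ (2 * s) * ((y : ℂ) ^ s)⁻¹ := by
  have ha' : (a : ℂ) ≠ 0 := by exact_mod_cast ha.ne'
  have hr' : (r : ℂ) ≠ 0 := by exact_mod_cast hr.ne'
  have hy' : (y : ℂ) ≠ 0 := by exact_mod_cast hy.ne'
  have h0 : (0 : ℝ) < a * r ^ 2 / y := by positivity
  have h0' : ((a * r ^ 2 / y : ℝ) : ℂ) ≠ 0 := by exact_mod_cast h0.ne'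
  rw [cpow_def_of_ne_zero ha', cpow_def_of_ne_zero hr', cpow_def_of_ne_zero hy',
    cpow_def_of_ne_zero h0', ← Complex.exp_neg, ← Complex.exp_add, ← Complex.exp_add,
    ← ofReal_log ha.le, ← ofReal_log hr.le, ← ofReal_log hy.le, ← ofReal_log h0.le,
    Real.log_div (by positivity) hy.ne', Real.log_mul ha.ne' (by positivity), Real.log_pow]
  congr 1
  push_cast
  ring

/-- The exponent `s + max(k, 0)` in terms of `s + k/2`. -/
lemma add_toNat_eq (hk : Even k) (s : ℂ) :
    s + (k.toNat : ℂ) = s + k / 2 + ((k.natAbs / 2 : ℕ) : ℂ) := by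
  obtain ⟨j, rfl⟩ := hk
  rcases le_total 0 j with h | h
  · lift j to ℕ using h
    have h1 : ((j : ℤ) + j).toNat = j + j := by omega
    have h2 : ((j : ℤ) + j).natAbs / 2 = j := by omega
    rw [h1, h2]
    push_cast
    ring
  · obtain ⟨i, rfl⟩ : ∃ i : ℕ, j = -i := ⟨j.natAbs, by omega⟩
    have h1 : (-(i : ℤ) + -i).toNat = 0 := by omega
    have h2 : (-(i : ℤ) + -i).natAbs / 2 = i := by omega
    rw [h1, h2]
    push_cast
    ring

/-- For `k ≥ 0` write `w^(-k) = w̄^k / |w|^(2k)`; for `k < 0` the power is already polynomial.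
Either way the weight becomes a polynomial of degree `|k|`, as the theta series needs. -/
lemma eisTerm_eq_weightConj {w : ℂ} (hw : w ≠ 0) (y : ℝ) (s : ℂ) :
    eisTerm k y w s = (y : ℂ) ^ s * weightConj k w ^ k.natAbs *
      ((‖w‖ : ℂ) ^ (2 * (s + (k.toNat : ℂ))))⁻¹ := by
  have hn : (‖w‖ : ℂ) ≠ 0 := by exact_mod_cast norm_ne_zero_iff.2 hw
  unfold eisTerm weightConj
  split_ifs with h
  · lift k to ℕ using h
    have h1 : (‖w‖ : ℂ) ^ (2 * (s + (k : ℂ))) = (‖w‖ : ℂ) ^ (2 * s) * (w * conj w) ^ k := by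
      rw [mul_add, cpow_add _ _ hn, mul_conj, normSq_eq_norm_sq, mul_comm (2 : ℂ) k, ofReal_pow,
        cpow_nat_mul]
      congr 2
      exact cpow_ofNat _ _
    have hw' : conj w ≠ 0 := (map_ne_zero _).2 hw
    rw [Int.toNat_natCast, Int.natAbs_natCast, h1, zpow_natCast, mul_pow, mul_inv, mul_inv,
      div_eq_mul_inv, mul_inv]
    have h2 : conj w ^ k * (conj w ^ k)⁻¹ = 1 := mul_inv_cancel₀ (pow_ne_zero _ hw')
    linear_combination (-((y : ℂ) ^ s * ((‖w‖ : ℂ) ^ (2 * s))⁻¹ * (w ^ k)⁻¹)) * h2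
  · obtain ⟨i, rfl⟩ : ∃ i : ℕ, k = -i := ⟨k.natAbs, by omega⟩
    rw [show (-(i : ℤ)).toNat = 0 by omega, show (-(i : ℤ)).natAbs = i by omega, _root_.zpow_neg,
      zpow_natCast, div_eq_mul_inv, mul_inv, inv_inv]
    push_cast
    rw [add_zero]
    ring

/-- The entire completion of the Eisenstein series of a lattice, without its polar part. -/
def latComp (k : ℤ) (α β : ℝ) (z s : ℂ) : ℂ :=
  latSum k.natAbs α β (weightConj k z) z (s + k.toNat - 1) +
    latSum k.natAbs α β (weightConj k z) z (k.natAbs - (s + k.toNat))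

lemma add_half_re (k : ℤ) (s : ℂ) : (s + (k : ℂ) / 2).re = s.re + k / 2 := by
  rw [add_re, show (k : ℂ) / 2 = ((k / 2 : ℝ) : ℂ) by push_cast; rfl, ofReal_re]

/-- This is `hasSum_latSum` at the shifted exponent `s + max(k, 0) = s + k/2 + |k|/2`, which
explains the Gamma factor of the completion. The hypothesis on `Re s` becomes exactly the range of
the Mellin identity. -/
lemma latEis_eq_latComp (hα : 0 < α) (hβ : 0 < β) (hz : z ∈ halfPlane) (hk : Even k)
    (hs : 1 < s.re + k / 2) :
    ((Real.pi / (α * β) : ℝ) : ℂ) ^ (-s - (k : ℂ) / 2) * Gamma (s + k.toNat) * latEis k α β s z =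
      ((Real.pi / (α * β) : ℝ) : ℂ) ^ (k.natAbs / 2) * ((z.im : ℂ) ^ k.toNat)⁻¹ *
        (latComp k α β z s +
          if k = 0 then 1 / (s + k / 2 - 1) - 1 / (s + k / 2) else 0) := by
  have hz0 : 0 < z.im := hz
  have hy : (z.im : ℂ) ≠ 0 := by exact_mod_cast hz0.ne'
  set a : ℝ := Real.pi / (α * β) with ha
  have ha0 : 0 < a := by positivity
  have ha' : (a : ℂ) ≠ 0 := by exact_mod_cast ha0.ne'
  have hev : Even k.natAbs := Int.natAbs_even.2 hk
  have hre : (s + (k.toNat : ℂ)).re = s.re + k / 2 + ((k.natAbs / 2 : ℕ) : ℝ) := by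
    rw [add_toNat_eq hk, add_re, add_half_re, natCast_re]
  have h2 : ((k.natAbs / 2 : ℕ) : ℝ) = (k.natAbs : ℝ) / 2 := by
    rw [Nat.cast_div hev.two_dvd two_ne_zero]; simp
  have key := hasSum_latSum hα hβ hz (weightConj_quadratic k z) hev (s := s + k.toNat)
    (by rw [hre, h2]; linarith)
  have h3 : (if k.natAbs = 0 then 1 / (s + (k.toNat : ℂ) - 1) - 1 / (s + (k.toNat : ℂ)) else 0) =
      if k = 0 then 1 / (s + (k : ℂ) / 2 - 1) - 1 / (s + (k : ℂ) / 2) else 0 := by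
    by_cases hk0 : k = 0
    · subst hk0; simp
    · rw [if_neg hk0, if_neg (by simpa using hk0)]
  rw [h3] at key
  rw [latComp, ← key.tsum_eq, latEis, ← tsum_mul_left, ← tsum_mul_left]
  refine tsum_congr fun v => ?_
  unfold latTerm
  split_ifs with hv
  · simp
  · have hw := latVec_ne_zero hα hβ hz hv
    have hn : 0 < ‖latVec α β z v‖ := norm_pos_iff.2 hw
    have hn' : (‖latVec α β z v‖ : ℂ) ≠ 0 := by exact_mod_cast hn.ne'
    have hq : Real.pi * latQ α β z v = a * ‖latVec α β z v‖ ^ 2 / z.im := by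
      unfold latQ; rw [ha]; field_simp
    rw [hq, cpow_scale ha0 hn hz0, latVec_weightConj, eisTerm_eq_weightConj hw]
    have e1 : (a : ℂ) ^ (-s - (k : ℂ) / 2) =
        (a : ℂ) ^ (k.natAbs / 2) * ((a : ℂ) ^ (s + (k.toNat : ℂ)))⁻¹ := by
      rw [add_toNat_eq hk, ← cpow_neg, ← cpow_natCast, ← cpow_add _ _ ha']
      congr 1
      ring
    have e2 : (z.im : ℂ) ^ (s + (k.toNat : ℂ)) = (z.im : ℂ) ^ s * (z.im : ℂ) ^ k.toNat := by
      rw [cpow_add _ _ hy, cpow_natCast]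
    rw [e1, e2]
    have n1 : (a : ℂ) ^ (s + (k.toNat : ℂ)) ≠ 0 := by simp [cpow_eq_zero_iff, ha']
    have n2 : (z.im : ℂ) ^ s ≠ 0 := by simp [cpow_eq_zero_iff, hy]
    have n3 : (‖latVec α β z v‖ : ℂ) ^ (2 * (s + (k.toNat : ℂ))) ≠ 0 := by
      simp [cpow_eq_zero_iff, hw]
    field_simp

/-- The function of `(z, s)`, entire in `s`, whose quotient by `eisDen p k s` is the
doubly-completed Eisenstein series. -/
def eisEntire (p : ℕ) (k : ℤ) (q : ℂ × ℂ) : ℂ :=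
  1 / 2 * ((Real.pi / √(p : ℝ) : ℝ) : ℂ) ^ (k.natAbs / 2) * ((q.1.im : ℂ) ^ k.toNat)⁻¹ *
    ((q.2 + k / 2) * (q.2 + k / 2 - 1) *
      (latComp k √(p : ℝ) 1 q.1 q.2 + latComp k 1 √(p : ℝ) q.1 q.2) + if k = 0 then 2 else 0)

lemma eisEntire_eq (hp : 0 < p) (hk : Even k) (hz : z ∈ halfPlane) (hs : 1 < s.re + k / 2) :
    eisEntire p k (z, s) = (s + k / 2) * (s + k / 2 - 1) *
      (((Real.pi / √(p : ℝ) : ℝ) : ℂ) ^ (-s - (k : ℂ) / 2) * Gamma (s + k.toNat)) *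
        (1 / 2 * (latEis k √(p : ℝ) 1 s z + latEis k 1 √(p : ℝ) s z)) := by
  have hp0 : 0 < √(p : ℝ) := Real.sqrt_pos.2 (by exact_mod_cast hp)
  have h1 := latEis_eq_latComp hp0 one_pos hz hk hs
  have h2 := latEis_eq_latComp one_pos hp0 hz hk hs
  rw [mul_one] at h1
  rw [one_mul] at h2
  have hs0 : s + k / 2 ≠ 0 := fun h => by
    have := congrArg Complex.re h
    rw [add_half_re, zero_re] at this
    linarith
  have hs1 : s + k / 2 - 1 ≠ 0 := fun h => by
    have := congrArg Complex.re h
    rw [sub_re, add_half_re, zero_re, one_re] at this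
    linarith
  -- The polynomial factor turns the polar part into the constant 1. Each of the two lattices
  -- contributes one, whence the 2 in `eisEntire`.
  have h3 : (s + k / 2) * (s + k / 2 - 1) *
      (if k = 0 then 1 / (s + (k : ℂ) / 2 - 1) - 1 / (s + (k : ℂ) / 2) else 0) =
      if k = 0 then 1 else 0 := by
    by_cases hk0 : k = 0
    · rw [if_pos hk0, if_pos hk0, mul_sub, mul_assoc, mul_one_div_cancel hs1, mul_right_comm,
        mul_one_div_cancel hs0]
      ring
    · rw [if_neg hk0, if_neg hk0, mul_zero]
  have h4 : (if k = 0 then (2 : ℂ) else 0) = 2 * if k = 0 then 1 else 0 := by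
    split_ifs <;> simp
  unfold eisEntire
  simp only
  rw [h4]
  set A := ((Real.pi / √(p : ℝ) : ℝ) : ℂ) ^ (k.natAbs / 2) * ((z.im : ℂ) ^ k.toNat)⁻¹
  linear_combination (-(1 / 2) * (s + k / 2) * (s + k / 2 - 1)) * (h1 + h2) - A * h3

lemma eisGTilde_eq (hp : p.Prime) (hk : Even k) (z : ℍ) (hs : 1 < s.re + k / 2) :
    eisGTilde p k z s = (eisDen p k s)⁻¹ * eisEntire p k (z, s) := by
  have h1 : s + (k : ℂ) / 2 + ((|k| : ℤ) : ℂ) / 2 = s + k.toNat := by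
    rw [add_toNat_eq hk, Nat.cast_div (Int.natAbs_even.2 hk).two_dvd two_ne_zero]
    rw [Int.abs_eq_natAbs, Int.cast_natCast]
    rfl
  rw [eisEntire_eq hp.pos hk z.im_pos hs, eisGTilde, eisGHat, mul_assoc (_ * _) (eisF p k s),
    eisF_mul_eisG hp hk z hs, h1]
  ring

lemma cLaplacian_add {f g : ℂ → ℂ} (hf : ContDiffOn ℝ ∞ f halfPlane)
    (hg : ContDiffOn ℝ ∞ g halfPlane) (k : ℤ) (hz : z ∈ halfPlane) :
    cLaplacian k (fun w => f w + g w) z = cLaplacian k f z + cLaplacian k g z := by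
  have hU := isOpen_halfPlane
  have h1 (f g : ℂ → ℂ) (hf : ContDiffOn ℝ ∞ f halfPlane) (hg : ContDiffOn ℝ ∞ g halfPlane)
      (u : ℂ) : EqOn (dirD u (fun w => f w + g w)) (fun w => dirD u f w + dirD u g w)
        halfPlane := fun w hw => by
    unfold dirD
    rw [fderiv_fun_add (hf.differentiableAt_of_isOpen hU hw) (hg.differentiableAt_of_isOpen hU hw)]
    rfl
  have h2 (u : ℂ) : dirD u (dirD u (fun w => f w + g w)) z =
      dirD u (dirD u f) z + dirD u (dirD u g) z := by
    rw [dirD_congr hU (h1 f g hf hg u) u hz, h1 _ _ (hf.dir hU u) (hg.dir hU u) u hz]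
  unfold cLaplacian
  rw [h2, h2, h1 f g hf hg 1 hz, h1 f g hf hg Complex.I hz]
  ring

lemma smoothHolo_latComp (hα : 0 < α) (hβ : 0 < β) (k : ℤ) :
    SmoothHolo univ (fun q => latComp k α β q.1 q.2) := by
  have hs := contDiff_weightConj k
  have a1 := smoothHolo_latSum hα hβ k.natAbs hs
    (show Differentiable ℂ fun s : ℂ => s + k.toNat - 1 by fun_prop)
  have a2 := smoothHolo_latSum hα hβ k.natAbs hs
    (show Differentiable ℂ fun s : ℂ => (k.natAbs : ℂ) - (s + k.toNat) by fun_prop)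
  exact SmoothHolo.of_differentiableOn isOpen_univ (a1.smooth.add a2.smooth) fun z hz =>
    (a1.differentiableOn isOpen_univ hz).add (a2.differentiableOn isOpen_univ hz)

lemma contDiffOn_im_pow_inv (n : ℕ) :
    ContDiffOn ℝ ∞ (fun z : ℂ => ((z.im : ℂ) ^ n)⁻¹) halfPlane :=
  ContDiffOn.inv (f := fun z : ℂ => (z.im : ℂ) ^ n)
    ((ofRealCLM.contDiff.comp imCLM.contDiff).pow n).contDiffOn fun z hz => pow_ne_zero _
    (by exact_mod_cast (ne_of_gt hz : z.im ≠ 0))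

lemma smoothHolo_eisEntire (hp : 0 < p) (k : ℤ) : SmoothHolo univ (eisEntire p k) := by
  have hp0 : 0 < √(p : ℝ) := Real.sqrt_pos.2 (by exact_mod_cast hp)
  have a := smoothHolo_latComp hp0 one_pos k
  have b := smoothHolo_latComp one_pos hp0 k
  refine SmoothHolo.of_differentiableOn isOpen_univ ?_ fun z hz => ?_
  · have hsnd : ContDiff ℝ ∞ fun q : ℂ × ℂ => (q.2 + k / 2) * (q.2 + k / 2 - 1) := by fun_prop
    have him : ContDiffOn ℝ ∞ (fun q : ℂ × ℂ => ((q.1.im : ℂ) ^ k.toNat)⁻¹) (halfPlane ×ˢ univ) :=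
      (contDiffOn_im_pow_inv k.toNat).comp contDiffOn_fst fun q hq => hq.1
    exact (contDiffOn_const.mul him).mul ((hsnd.contDiffOn.mul
      (a.smooth.add b.smooth)).add contDiffOn_const)
  · have hpoly : DifferentiableOn ℂ (fun s : ℂ => (s + k / 2) * (s + k / 2 - 1)) univ := by
      fun_prop
    have h := hpoly.fun_mul ((a.differentiableOn isOpen_univ hz).fun_add
      (b.differentiableOn isOpen_univ hz))
    exact (h.add_const (if k = 0 then 2 else 0)).const_mul
      (1 / 2 * ((Real.pi / √(p : ℝ) : ℝ) : ℂ) ^ (k.natAbs / 2) * ((z.im : ℂ) ^ k.toNat)⁻¹)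

/-- The Gamma factor and the power do not vanish in the region of convergence, so smoothness of the
lattice series in `z` can be read off from `latComp` without differentiating the series repeatedly.
-/
lemma exists_latEis_eq (hα : 0 < α) (hβ : 0 < β) (hk : Even k) (hs : 1 < s.re + k / 2) :
    ∃ c a d : ℂ, c ≠ 0 ∧ ∀ z ∈ halfPlane, c * latEis k α β s z =
      a * ((z.im : ℂ) ^ k.toNat)⁻¹ * (latComp k α β z s + d) := by
  refine ⟨_, _, _, ?_, fun z hz => latEis_eq_latComp hα hβ hz hk hs⟩
  have ha : ((Real.pi / (α * β) : ℝ) : ℂ) ≠ 0 :=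
    ofReal_ne_zero.2 (div_ne_zero Real.pi_ne_zero (mul_ne_zero hα.ne' hβ.ne'))
  refine mul_ne_zero (fun h => ha (cpow_eq_zero_iff _ _ |>.1 h).1)
    (Gamma_ne_zero_of_re_pos ?_)
  rw [add_toNat_eq hk, add_re, add_half_re, natCast_re]
  have := Nat.cast_nonneg (α := ℝ) (k.natAbs / 2)
  linarith

lemma contDiffOn_latEis (hα : 0 < α) (hβ : 0 < β) (hk : Even k) (hs : 1 < s.re + k / 2) :
    ContDiffOn ℝ ∞ (latEis k α β s) halfPlane := by
  obtain ⟨c, a, d, hc, h⟩ := exists_latEis_eq hα hβ hk hs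
  have h1 : ContDiffOn ℝ ∞ (fun z => latComp k α β z s) halfPlane := by
    simpa using (smoothHolo_latComp hα hβ k).contDiffOn_iteratedDeriv isOpen_univ (mem_univ s) 0
  have h2 : ContDiffOn ℝ ∞ (fun z => c⁻¹ * (a * ((z.im : ℂ) ^ k.toNat)⁻¹ *
      (latComp k α β z s + d))) halfPlane :=
    contDiffOn_const.mul
      ((contDiffOn_const.mul (contDiffOn_im_pow_inv k.toNat)).mul (h1.add contDiffOn_const))
  refine h2.congr fun z hz => ?_
  rw [← h z hz, inv_mul_cancel_left₀ hc]

/-- Both sides are entire in `s` and agree where the lattice series converge; the identity theorem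
does the rest. -/
lemma cLaplacian_eisEntire (hp : 0 < p) (hk : Even k) (hz : z ∈ halfPlane) (s : ℂ) :
    cLaplacian k (fun z => eisEntire p k (z, s)) z = s * (s + k - 1) * eisEntire p k (z, s) := by
  have hp0 : 0 < √(p : ℝ) := Real.sqrt_pos.2 (by exact_mod_cast hp)
  have hE := smoothHolo_eisEntire hp k
  have h1 := hE.differentiableOn_cLaplacian isOpen_univ k hz
  have h2 : DifferentiableOn ℂ (fun s => s * (s + k - 1) * eisEntire p k (z, s)) univ :=
    DifferentiableOn.mul (by fun_prop) (hE.differentiableOn isOpen_univ hz)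
  set s₀ : ℂ := ((2 - k / 2 : ℝ) : ℂ)
  refine (h1.analyticOnNhd isOpen_univ).eqOn_of_preconnected_of_eventuallyEq
    (h2.analyticOnNhd isOpen_univ) isPreconnected_univ (mem_univ s₀) ?_ (mem_univ s)
  have ho : IsOpen {s : ℂ | 1 - (k : ℝ) / 2 < s.re} := isOpen_lt continuous_const continuous_re
  filter_upwards [ho.mem_nhds (show 1 - (k : ℝ) / 2 < s₀.re by
    rw [ofReal_re]; linarith)] with s hs
  have hs' : 1 < s.re + k / 2 := by
    have : 1 - (k : ℝ) / 2 < s.re := hs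
    linarith
  have he : EqOn (fun z => eisEntire p k (z, s)) _ halfPlane := fun w hw =>
    eisEntire_eq hp hk hw hs'
  rw [cLaplacian_congr he k hz, eisEntire_eq hp hk hz hs', cLaplacian_const_mul, cLaplacian_const_mul,
    cLaplacian_add (contDiffOn_latEis hp0 one_pos hk hs') (contDiffOn_latEis one_pos hp0 hk hs') k
      hz, cLaplacian_latEis hp0 one_pos hz hs', cLaplacian_latEis one_pos hp0 hz hs']
  ring

end Completion

/-! ### The continuation near `s = 0` -/

section TaylorCoefficients
open Filter Topology Set

variable {p : ℕ} {k : ℤ}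

/-- The continuation of the doubly-completed Eisenstein series, as a function of `(z, s)`. -/
def eisCont (p : ℕ) (k : ℤ) (q : ℂ × ℂ) : ℂ := (eisDen p k q.2)⁻¹ * eisEntire p k q

/-- The open set of all `s` at which `eisDen p k` does not vanish. -/
def eisRegSet (p : ℕ) (k : ℤ) : Set ℂ := {s | eisDen p k s ≠ 0}

lemma differentiable_eisDen (hp : 0 < p) (k : ℤ) : Differentiable ℂ (eisDen p k) := by
  have hp' : (p : ℂ) ≠ 0 := by exact_mod_cast hp.ne'
  intro s
  unfold eisDen
  refine DifferentiableAt.mul ?_ ?_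
  · exact (DifferentiableAt.const_cpow (by fun_prop) (Or.inl hp')).const_add _
  · exact (DifferentiableAt.const_cpow (by fun_prop) (Or.inl hp')).const_add _

lemma isOpen_eisRegSet (hp : 0 < p) (k : ℤ) : IsOpen (eisRegSet p k) :=
  isOpen_ne_fun (differentiable_eisDen hp k).continuous continuous_const

lemma zero_mem_eisRegSet : (0 : ℂ) ∈ eisRegSet p k := eisDen_zero_ne_zero

lemma smoothHolo_eisCont (hp : 0 < p) (k : ℤ) : SmoothHolo (eisRegSet p k) (eisCont p k) := by
  have h := smoothHolo_eisEntire hp k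
  have h1 : SmoothHolo (eisRegSet p k) (eisEntire p k) :=
    ⟨h.smooth.mono (prod_mono_right (subset_univ _)), fun q hq => h.cauchyRiemann q ⟨hq.1, trivial⟩⟩
  exact h1.mul_left (isOpen_eisRegSet hp k)
    ((differentiable_eisDen hp k).differentiableOn.inv fun s hs => hs)

lemma cLaplacian_eisCont (hp : 0 < p) (hk : Even k) {z : ℂ} (hz : z ∈ halfPlane) (s : ℂ) :
    cLaplacian k (fun z => eisCont p k (z, s)) z = s * (s + k - 1) * eisCont p k (z, s) := by
  have h := cLaplacian_const_mul k (eisDen p k s)⁻¹ (fun z => eisEntire p k (z, s)) z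
  rw [cLaplacian_eisEntire hp hk hz] at h
  refine h.trans ?_
  rw [eisCont]
  ring

lemma meromorphicOn_eisCont (hp : 0 < p) (z : ℍ) :
    MeromorphicOn (fun s => eisCont p k ((z : ℂ), s)) univ := by
  intro s _
  have h1 : MeromorphicAt (eisDen p k) s :=
    ((differentiable_eisDen hp k).analyticAt s).meromorphicAt
  have h2 : MeromorphicAt (fun s => eisEntire p k ((z : ℂ), s)) s :=
    ((smoothHolo_eisEntire hp k).analyticAt isOpen_univ z.im_pos (mem_univ s)).meromorphicAt
  exact h1.inv.mul h2

lemma mem_eisRegSet (hp : p.Prime) {s : ℂ} (hs : 1 - (k : ℝ) / 2 < s.re) : s ∈ eisRegSet p k :=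
  eisDen_ne_zero hp (by linarith)

lemma isMeromorphicContinuation_eisCont (hp : p.Prime) (hk : Even k) (z : ℍ) :
    IsMeromorphicContinuation (1 - (k : ℝ) / 2) (eisGTilde p k z)
      (toMeromorphicNFOn (fun s => eisCont p k ((z : ℂ), s)) univ) :=
  isMeromorphicContinuation_toMeromorphicNFOn (meromorphicOn_eisCont hp.pos z)
    (fun _ hs => (smoothHolo_eisCont hp.pos k).analyticAt (isOpen_eisRegSet hp.pos k) z.im_pos
      (mem_eisRegSet hp hs))
    fun s hs => (eisGTilde_eq hp hk z (by linarith)).symm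

lemma eisGTildeCont_eventuallyEq (hp : p.Prime) (hk : Even k) (z : ℍ) :
    eisGTildeCont p k z =ᶠ[𝓝 0] fun s => eisCont p k ((z : ℂ), s) := by
  rw [eisGTildeCont, (isMeromorphicContinuation_eisCont hp hk z).meromorphicContinuation_eq]
  exact toMeromorphicNFOn_eventuallyEq (meromorphicOn_eisCont hp.pos z)
    ((smoothHolo_eisCont hp.pos k).analyticAt (isOpen_eisRegSet hp.pos k) z.im_pos
      zero_mem_eisRegSet)

lemma analyticAt_eisGTildeCont (hp : p.Prime) (hk : Even k) (z : ℍ) :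
    AnalyticAt ℂ (eisGTildeCont p k z) 0 :=
  ((smoothHolo_eisCont hp.pos k).analyticAt (isOpen_eisRegSet hp.pos k) z.im_pos
    zero_mem_eisRegSet).congr (eisGTildeCont_eventuallyEq hp hk z).symm

lemma eisTaylor_eq (hp : p.Prime) (hk : Even k) (m : ℕ) (z : ℍ) :
    eisTaylor p m k z =
      (m.factorial : ℂ)⁻¹ * iteratedDeriv m (fun s => eisCont p k ((z : ℂ), s)) 0 := by
  rw [eisTaylor, (eisGTildeCont_eventuallyEq hp hk z).iteratedDeriv_eq m, div_eq_inv_mul]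

end TaylorCoefficients

/-! ### Transformation under `R(p)` -/

section Invariance
open ComplexConjugate

variable {p : ℕ} {k : ℤ} {α β α' β' : ℝ} {z z' j s : ℂ}

lemma slash_specialLinear (f : ℍ → ℂ) (k : ℤ) (γ : SL(2, ℝ)) (z : ℍ) :
    (f ∣[k] (γ : GL (Fin 2) ℝ)) z = f (γ • z) * (γ 1 0 * z + γ 1 1) ^ (-k) := by
  rw [ModularForm.slash_apply]
  have : σ (γ : GL (Fin 2) ℝ) = ContinuousAlgEquiv.refl ℝ ℂ := by simp [σ]
  rw [this]
  simp [denom]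
  left
  rfl

lemma coe_specialLinear_smul (γ : SL(2, ℝ)) (z : ℍ) :
    ((γ • z : ℍ) : ℂ) = (γ 0 0 * z + γ 0 1) / (γ 1 0 * z + γ 1 1) := by
  rw [UpperHalfPlane.specialLinearGroup_apply]
  simp

lemma specialLinear_denom_ne_zero (γ : SL(2, ℝ)) (z : ℍ) : (γ 1 0 * z + γ 1 1 : ℂ) ≠ 0 := by
  have := denom_ne_zero (γ : GL (Fin 2) ℝ) z
  simpa [denom] using this

lemma im_specialLinear_smul (γ : SL(2, ℝ)) (z : ℍ) :
    (γ • z).im = z.im / normSq (γ 1 0 * z + γ 1 1) := by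
  have := im_smul_eq_div_normSq (γ : GL (Fin 2) ℝ) z
  have hd : ((GeneralLinearGroup.det (γ : GL (Fin 2) ℝ) : ℝˣ) : ℝ) = 1 := by simp
  rw [hd, abs_one, one_mul] at this
  exact this

/-- The right action on row vectors of an integer matrix of determinant one. -/
def rowEquiv (a b c d : ℤ) (h : a * d - b * c = 1) : ℤ × ℤ ≃ ℤ × ℤ where
  toFun v := (v.1 * a + v.2 * c, v.1 * b + v.2 * d)
  invFun v := (v.1 * d - v.2 * c, v.2 * a - v.1 * b)
  left_inv v := Prod.ext (by linear_combination v.1 * h) (by linear_combination v.2 * h)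
  right_inv v := Prod.ext (by linear_combination v.1 * h) (by linear_combination v.2 * h)

lemma weightConj_div (k : ℤ) (a b : ℂ) : weightConj k (a / b) = weightConj k a / weightConj k b := by
  unfold weightConj; split_ifs <;> simp

/-- Dividing a lattice by `j` does not change lengths normalised by the covolume, so the incomplete
Gamma functions are merely permuted and only the polynomial weight sees `j`. -/
lemma latComp_of_equiv (hj : j ≠ 0) (hαβ : α * β = α' * β') (him : z'.im = z.im / normSq j)
    (e : ℤ × ℤ ≃ ℤ × ℤ) (he0 : e 0 = 0) (he : ∀ v, latVec α β z' v = latVec α' β' z (e v) / j) :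
    latComp k α β z' s = (weightConj k j ^ k.natAbs)⁻¹ * latComp k α' β' z s := by
  have hj' : normSq j ≠ 0 := by simpa using hj
  have hQ (v) : latQ α β z' v = latQ α' β' z (e v) := by
    unfold latQ
    rw [he, norm_div, div_pow, hαβ, him, ← normSq_eq_norm_sq j]
    field_simp
  have h (a : ℂ) : latSum k.natAbs α β (weightConj k z') z' a =
      (weightConj k j ^ k.natAbs)⁻¹ * latSum k.natAbs α' β' (weightConj k z) z a := by
    unfold latSum
    rw [← tsum_mul_left, ← e.tsum_eq fun v => (weightConj k j ^ k.natAbs)⁻¹ *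
      if v = 0 then 0 else latVec α' β' (weightConj k z) v ^ k.natAbs * incGamma (latQ α' β' z v) a]
    refine tsum_congr fun v => ?_
    have hv : e v = 0 ↔ v = 0 := by
      rw [← e.apply_eq_iff_eq (x := v), he0]
    simp only [hv]
    split_ifs
    · simp
    · rw [latVec_weightConj, latVec_weightConj, he, weightConj_div, div_pow, hQ]
      ring
  rw [latComp, latComp, h, h, mul_add]

lemma normSq_pow_toNat (k : ℤ) (hj : j ≠ 0) :
    ((normSq j : ℂ) ^ k.toNat) * (weightConj k j ^ k.natAbs)⁻¹ = j ^ k := by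
  unfold weightConj
  split_ifs with h
  · lift k to ℕ using h
    have : conj j ≠ 0 := (map_ne_zero _).2 hj
    rw [Int.toNat_natCast, Int.natAbs_natCast, ← mul_conj, mul_pow, zpow_natCast]
    field_simp
  · obtain ⟨i, rfl⟩ : ∃ i : ℕ, k = -i := ⟨k.natAbs, by omega⟩
    rw [show (-(i : ℤ)).toNat = 0 by omega, show (-(i : ℤ)).natAbs = i by omega, _root_.zpow_neg,
      zpow_natCast, pow_zero, one_mul]

lemma eisEntire_of_latComp (hj : j ≠ 0) (him : z'.im = z.im / normSq j)
    (h : latComp k √(p : ℝ) 1 z' s + latComp k 1 √(p : ℝ) z' s = (weightConj k j ^ k.natAbs)⁻¹ *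
      (latComp k √(p : ℝ) 1 z s + latComp k 1 √(p : ℝ) z s)) :
    eisEntire p k (z', s) = j ^ k * eisEntire p k (z, s) := by
  have hj' : (normSq j : ℂ) ≠ 0 := by simpa using hj
  -- The constant term transforms with the right factor because it is present only in weight 0,
  -- where that factor is 1.
  have h0 : (if k = 0 then (2 : ℂ) else 0) =
      (weightConj k j ^ k.natAbs)⁻¹ * (if k = 0 then 2 else 0) := by
    split_ifs with hk <;> simp [hk]
  unfold eisEntire
  simp only
  rw [h, him, ← normSq_pow_toNat k hj]
  nth_rewrite 1 [h0]
  have h1 : (((z.im / normSq j : ℝ) : ℂ) ^ k.toNat)⁻¹ =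
      (normSq j : ℂ) ^ k.toNat * ((z.im : ℂ) ^ k.toNat)⁻¹ := by
    rw [ofReal_div, div_pow, inv_div, div_eq_mul_inv]
  rw [h1]
  ring

/-- An element of `RPlus` acts on each of the two lattices by an integer matrix of determinant one,
up to division by `cz + d`. An element of `RMinus` exchanges the lattices, so only the sum is
invariant under the whole group. -/
lemma eisEntire_smul {γ : SL(2, ℝ)} (hγ : γ ∈ RGroup p) (z : ℍ) (s : ℂ) :
    eisEntire p k (((γ • z : ℍ) : ℂ), s) =
      (γ 1 0 * z + γ 1 1) ^ k * eisEntire p k ((z : ℂ), s) := by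
  have hj := specialLinear_denom_ne_zero γ z
  have him := im_specialLinear_smul γ z
  have hN : √(p : ℝ) * √(p : ℝ) = p := Real.mul_self_sqrt (Nat.cast_nonneg p)
  have hNC : (√(p : ℝ) : ℂ) * √(p : ℝ) = p := by exact_mod_cast hN
  have hdet : γ 0 0 * γ 1 1 - γ 0 1 * γ 1 0 = 1 := by
    rw [← Matrix.det_fin_two]; exact γ.2
  refine eisEntire_of_latComp hj him ?_
  have hv (α β : ℝ) (v : ℤ × ℤ) : latVec α β ((γ • z : ℍ) : ℂ) v =
      (α * v.1 * (γ 0 0 * z + γ 0 1) + β * v.2 * (γ 1 0 * z + γ 1 1)) /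
        (γ 1 0 * z + γ 1 1) := by
    rw [latVec, coe_specialLinear_smul, eq_div_iff hj, add_mul, mul_assoc _ (_ / _),
      div_mul_cancel₀ _ hj]
  rcases hγ with ⟨a, b, c, d, h1, h2, h3, h4⟩ | ⟨a, b, c, d, h1, h2, h3, h4⟩
  · have hd : a * d - p * (b * c) = 1 := by
      have : (a * d - p * (b * c) : ℝ) = 1 := by
        rw [← hdet, h1, h2, h3, h4]; linear_combination (b * c : ℝ) * hN
      exact_mod_cast this
    rw [mul_add, latComp_of_equiv hj rfl him (rowEquiv a (p * b) c d (by linarith)) ?_ fun v => ?_,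
      latComp_of_equiv hj rfl him (rowEquiv a b (p * c) d (by linarith)) ?_ fun v => ?_]
    · simp [rowEquiv]
    · rw [hv, h1, h2, h3, h4]
      congr 1
      simp only [latVec, rowEquiv, Equiv.coe_fn_mk]
      push_cast
      linear_combination (v.2 * c * z : ℂ) * hNC
    · simp [rowEquiv]
    · rw [hv, h1, h2, h3, h4]
      congr 1
      simp only [latVec, rowEquiv, Equiv.coe_fn_mk]
      push_cast
      linear_combination (v.1 * b : ℂ) * hNC
  · have hd : p * (a * d) - b * c = 1 := by
      have : (p * (a * d) - b * c : ℝ) = 1 := by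
        rw [← hdet, h1, h2, h3, h4]; linear_combination (-(a * d : ℝ)) * hN
      exact_mod_cast this
    rw [mul_add, latComp_of_equiv hj (mul_comm _ _) him
        (rowEquiv (p * a) b c d (by linarith)) ?_ fun v => ?_,
      latComp_of_equiv hj (mul_comm _ _) him (rowEquiv a b c (p * d) (by linarith)) ?_ fun v => ?_,
      add_comm]
    · simp [rowEquiv]
    · rw [hv, h1, h2, h3, h4]
      congr 1
      simp only [latVec, rowEquiv, Equiv.coe_fn_mk]
      push_cast
      linear_combination (v.2 * d : ℂ) * hNC
    · simp [rowEquiv]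
    · rw [hv, h1, h2, h3, h4]
      congr 1
      simp only [latVec, rowEquiv, Equiv.coe_fn_mk]
      push_cast
      linear_combination (v.1 * a * z : ℂ) * hNC

end Invariance

/-! ### Smoothness, modularity and polyharmonicity of the coefficients -/

section Slash
open Filter Topology

variable {p : ℕ} {k : ℤ}

lemma eisTaylor_smul (hp : p.Prime) (hk : Even k) (m : ℕ) {γ : SL(2, ℝ)} (hγ : γ ∈ RGroup p)
    (z : ℍ) : eisTaylor p m k (γ • z) = (γ 1 0 * z + γ 1 1) ^ k * eisTaylor p m k z := by
  have h : (fun s => eisCont p k (((γ • z : ℍ) : ℂ), s)) =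
      fun s => (γ 1 0 * z + γ 1 1 : ℂ) ^ k * eisCont p k ((z : ℂ), s) := by
    funext s
    unfold eisCont
    rw [eisEntire_smul hγ]
    ring
  rw [eisTaylor_eq hp hk, eisTaylor_eq hp hk, h, iteratedDeriv_const_mul_field]
  ring

lemma eisTaylor_slash (hp : p.Prime) (hk : Even k) (m : ℕ) {γ : SL(2, ℝ)} (hγ : γ ∈ RGroup p) :
    eisTaylor p m k ∣[k] (γ : GL (Fin 2) ℝ) = eisTaylor p m k := by
  funext z
  rw [slash_specialLinear, eisTaylor_smul hp hk m hγ, mul_right_comm,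
    ← zpow_add₀ (specialLinear_denom_ne_zero γ z), add_neg_cancel, zpow_zero, one_mul]

lemma contDiffOn_eisTaylor (hp : p.Prime) (hk : Even k) (m : ℕ) :
    ContDiffOn ℝ ∞ (eisTaylor p m k ∘ ofComplex) {w : ℂ | 0 < w.im} := by
  have h := (smoothHolo_eisCont hp.pos k).contDiffOn_iteratedDeriv (isOpen_eisRegSet hp.pos k)
    zero_mem_eisRegSet m
  refine (contDiffOn_const (c := (m.factorial : ℂ)⁻¹) |>.mul h).congr fun w hw => ?_
  rw [Function.comp, ofComplex_apply_of_im_pos hw, eisTaylor_eq hp hk]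

lemma hypLaplacian_eisTaylor (hp : p.Prime) (hk : Even k) (m : ℕ) :
    (hypLaplacian k)^[m + 1] (eisTaylor p m k) = 0 :=
  (smoothHolo_eisCont hp.pos k).hypLaplacian_iterate_eq_zero (isOpen_eisRegSet hp.pos k)
    zero_mem_eisRegSet k (fun _ hz s _ => cLaplacian_eisCont hp.pos hk hz s) m _
    (eisTaylor_eq hp hk m)

end Slash

/-! ### Moderate growth at all cusps -/

section Growth
open Filter Topology Set Asymptotics

variable {p : ℕ} {k : ℤ}

lemma norm_latComp_le {α β : ℝ} (hα : 0 < α) (hβ : 0 < β) (k : ℤ) (X : ℝ) : ∃ (K : ℝ) (n : ℕ),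
    0 ≤ K ∧ ∀ z s : ℂ, |z.re| ≤ X → 1 ≤ z.im → ‖s‖ ≤ 1 → ‖latComp k α β z s‖ ≤ K * z.im ^ n := by
  obtain ⟨K, n, h⟩ := norm_latSum_le hα hβ k.natAbs (k.natAbs + k.toNat + 2) X
  refine ⟨2 * |K|, n, by positivity, fun z s hX hz hs => ?_⟩
  have hz' := (norm_weightConj k z).le
  have hs' := abs_le.1 ((abs_re_le_norm s).trans hs)
  have h0 := Nat.cast_nonneg (α := ℝ) k.natAbs
  have h0' := Nat.cast_nonneg (α := ℝ) k.toNat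
  have h1 := h _ z (s + k.toNat - 1) hz' hX hz (by
    simp only [sub_re, add_re, natCast_re, one_re]
    push_cast
    linarith)
  have h2 := h _ z (k.natAbs - (s + k.toNat)) hz' hX hz (by
    simp only [sub_re, add_re, natCast_re]
    push_cast
    linarith)
  have h3 : K * z.im ^ n ≤ |K| * z.im ^ n :=
    mul_le_mul_of_nonneg_right (le_abs_self K) (by positivity)
  refine (norm_add_le _ _).trans ?_
  linarith

lemma norm_eisEntire_le (hp : 0 < p) (k : ℤ) (X : ℝ) : ∃ (K : ℝ) (n : ℕ), 0 ≤ K ∧ ∀ z s : ℂ,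
    |z.re| ≤ X → 1 ≤ z.im → ‖s‖ ≤ 1 → ‖eisEntire p k (z, s)‖ ≤ K * z.im ^ n := by
  have hp0 : 0 < √(p : ℝ) := Real.sqrt_pos.2 (by exact_mod_cast hp)
  obtain ⟨K₁, n₁, hK₁, h₁⟩ := norm_latComp_le hp0 one_pos k X
  obtain ⟨K₂, n₂, hK₂, h₂⟩ := norm_latComp_le one_pos hp0 k X
  set c := ‖(k : ℂ) / 2‖
  set B := ‖1 / 2 * ((Real.pi / √(p : ℝ) : ℝ) : ℂ) ^ (k.natAbs / 2)‖
  have hc : 0 ≤ c := norm_nonneg _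
  have hB : 0 ≤ B := norm_nonneg _
  refine ⟨B * ((1 + c) * (1 + c + 1) * (K₁ + K₂) + 2), n₁ + n₂, by positivity,
    fun z s hX hz hs => ?_⟩
  have hz0 : 0 < z.im := zero_lt_one.trans_le hz
  have e1 : ‖s + k / 2‖ ≤ 1 + c := (norm_add_le _ _).trans (by linarith)
  have e2 : ‖s + k / 2 - 1‖ ≤ 1 + c + 1 := (norm_sub_le _ _).trans (by rw [norm_one]; linarith)
  have e3 : ‖((z.im : ℂ) ^ k.toNat)⁻¹‖ ≤ 1 := by
    rw [norm_inv, norm_pow, norm_real, Real.norm_of_nonneg hz0.le]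
    exact inv_le_one_of_one_le₀ (one_le_pow₀ hz)
  have e4 : ‖if k = 0 then (2 : ℂ) else 0‖ ≤ 2 * z.im ^ (n₁ + n₂) := by
    have : (1 : ℝ) ≤ z.im ^ (n₁ + n₂) := one_le_pow₀ hz
    split_ifs
    · simpa using this
    · rw [norm_zero]; positivity
  have e5 : ‖latComp k √(p : ℝ) 1 z s + latComp k 1 √(p : ℝ) z s‖ ≤
      (K₁ + K₂) * z.im ^ (n₁ + n₂) := by
    refine (norm_add_le _ _).trans ?_
    rw [add_mul]
    refine add_le_add ((h₁ z s hX hz hs).trans ?_) ((h₂ z s hX hz hs).trans ?_)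
    · exact mul_le_mul_of_nonneg_left (pow_le_pow_right₀ hz (Nat.le_add_right _ _)) hK₁
    · exact mul_le_mul_of_nonneg_left (pow_le_pow_right₀ hz (Nat.le_add_left _ _)) hK₂
  unfold eisEntire
  simp only
  rw [norm_mul, norm_mul _ ((z.im : ℂ) ^ k.toNat)⁻¹, mul_assoc B _ (z.im ^ _)]
  refine mul_le_mul (mul_le_of_le_one_right hB e3) ?_ (norm_nonneg _) hB
  refine (norm_add_le _ _).trans ((add_le_add ?_ e4).trans (add_mul _ _ _).ge)
  rw [norm_mul, norm_mul, mul_assoc _ (K₁ + K₂)]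
  exact mul_le_mul (mul_le_mul e1 e2 (norm_nonneg _) (by positivity)) e5 (norm_nonneg _)
    (by positivity)

/-- Cauchy's estimate on one circle around `0`, independent of `z`, transfers the bound from the
function to its Taylor coefficient. The radius is at most 1 for the bound on `eisEntire`, and small
enough to avoid the zeros of `eisDen`. -/
lemma norm_eisTaylor_le_of_re_le (hp : p.Prime) (hk : Even k) (m : ℕ) (X : ℝ) :
    ∃ (K : ℝ) (n : ℕ), 0 ≤ K ∧ ∀ z : ℍ, |z.re| ≤ X → 1 ≤ z.im →
      ‖eisTaylor p m k z‖ ≤ K * z.im ^ n := by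
  obtain ⟨K, n, hK, h⟩ := norm_eisEntire_le hp.pos k X
  obtain ⟨ε, hε, hεS⟩ := Metric.isOpen_iff.1 (isOpen_eisRegSet hp.pos k) 0 zero_mem_eisRegSet
  set r := min 1 (ε / 2)
  have hr : 0 < r := lt_min one_pos (half_pos hε)
  have hrS : Metric.closedBall (0 : ℂ) r ⊆ eisRegSet p k :=
    (Metric.closedBall_subset_ball ((min_le_right _ _).trans_lt (half_lt_self hε))).trans hεS
  have hcont : ContinuousOn (fun s => (eisDen p k s)⁻¹) (Metric.closedBall 0 r) :=
    (differentiable_eisDen hp.pos k).continuous.continuousOn.inv₀ fun s hs => hrS hs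
  obtain ⟨D, hD⟩ := (isCompact_closedBall (0 : ℂ) r).exists_bound_of_continuousOn hcont
  have hD0 : 0 ≤ D := (norm_nonneg _).trans (hD 0 (Metric.mem_closedBall_self hr.le))
  refine ⟨D * K / r ^ m, n, by positivity, fun z hX hz => ?_⟩
  have hdiff : DiffContOnCl ℂ (fun s => eisCont p k ((z : ℂ), s)) (Metric.ball 0 r) :=
    ((smoothHolo_eisCont hp.pos k).differentiableOn (isOpen_eisRegSet hp.pos k)
      z.im_pos).diffContOnCl_ball hrS
  have hb : ∀ s ∈ Metric.sphere (0 : ℂ) r, ‖eisCont p k ((z : ℂ), s)‖ ≤ D * (K * z.im ^ n) := by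
    intro s hs
    have hs' : ‖s‖ ≤ 1 := by
      rw [mem_sphere_zero_iff_norm.1 hs]; exact min_le_left _ _
    rw [eisCont, norm_mul]
    exact mul_le_mul (hD s (Metric.sphere_subset_closedBall hs)) (h z s hX hz hs') (norm_nonneg _)
      hD0
  have key := norm_iteratedDeriv_le_of_forall_mem_sphere_norm_le m hr hdiff hb
  have hm : (0 : ℝ) < m.factorial := by exact_mod_cast m.factorial_pos
  rw [eisTaylor_eq hp hk, norm_mul, norm_inv, norm_natCast]
  calc (m.factorial : ℝ)⁻¹ * _ ≤ (m.factorial : ℝ)⁻¹ *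
        (m.factorial * (D * (K * z.im ^ n)) / r ^ m) := by gcongr
    _ = D * K / r ^ m * z.im ^ n := by field_simp

/-- The translation by `n √p`. -/
def sqrtTranslation (p : ℕ) (n : ℤ) : SL(2, ℝ) :=
  ⟨!![1, n * √(p : ℝ); 0, 1], by simp [Matrix.det_fin_two]⟩

lemma sqrtTranslation_mem (n : ℤ) : sqrtTranslation p n ∈ RGroup p :=
  Or.inl ⟨1, n, 0, 1, by simp [sqrtTranslation], by simp [sqrtTranslation],
    by simp [sqrtTranslation], by simp [sqrtTranslation]⟩

lemma coe_sqrtTranslation_smul (n : ℤ) (z : ℍ) :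
    ((sqrtTranslation p n • z : ℍ) : ℂ) = z + n * √(p : ℝ) := by
  rw [coe_specialLinear_smul]
  simp [sqrtTranslation]

lemma norm_eisTaylor_le (hp : p.Prime) (hk : Even k) (m : ℕ) :
    ∃ (K : ℝ) (n : ℕ), 0 ≤ K ∧ ∀ z : ℍ, 1 ≤ z.im → ‖eisTaylor p m k z‖ ≤ K * z.im ^ n := by
  have hp0 : 0 < √(p : ℝ) := Real.sqrt_pos.2 (by exact_mod_cast hp.pos)
  obtain ⟨K, n, hK, h⟩ := norm_eisTaylor_le_of_re_le hp hk m √(p : ℝ)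
  refine ⟨K, n, hK, fun z hz => ?_⟩
  -- Translation by `-l √p` lies in `R(p)` and brings the real part into `[0, √p]`, which upgrades
  -- the strip bound to one uniform in `x`.
  set l := ⌊z.re / √(p : ℝ)⌋
  have hc := coe_sqrtTranslation_smul (p := p) (-l) z
  have hre : (sqrtTranslation p (-l) • z).re = z.re - l * √(p : ℝ) := by
    have := congrArg Complex.re hc
    simpa [sub_eq_add_neg] using this
  have him : (sqrtTranslation p (-l) • z).im = z.im := by
    have := congrArg Complex.im hc
    simpa using this
  have h1 : eisTaylor p m k (sqrtTranslation p (-l) • z) = eisTaylor p m k z := by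
    rw [eisTaylor_smul hp hk m (sqrtTranslation_mem _)]
    simp [sqrtTranslation]
  rw [← h1, ← him]
  refine h _ ?_ (by rw [him]; exact hz)
  rw [hre, abs_le]
  have f1 := (le_div_iff₀ hp0).1 (Int.floor_le (z.re / √(p : ℝ)))
  have f2 := (div_lt_iff₀ hp0).1 (Int.lt_floor_add_one (z.re / √(p : ℝ)))
  constructor <;> linarith

lemma hasModerateGrowth_of_norm_le {f : ℍ → ℂ} {K A : ℝ} {n : ℕ}
    (h : ∀ z : ℍ, A ≤ z.im → ‖f z‖ ≤ K * z.im ^ n) : HasModerateGrowth f := by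
  refine ⟨n, IsBigO.of_bound K ?_⟩
  refine (atImInfty_mem _).2 ⟨A, fun z hz => ?_⟩
  have := h z hz
  rwa [Set.mem_ofPred_eq, Real.rpow_natCast, Real.norm_of_nonneg (pow_nonneg z.im_pos.le _)]

lemma hasModerateGrowth_eisTaylor (hp : p.Prime) (hk : Even k) (m : ℕ) :
    HasModerateGrowth (eisTaylor p m k) := by
  obtain ⟨K, n, -, h⟩ := norm_eisTaylor_le hp hk m
  exact hasModerateGrowth_of_norm_le h

lemma hasModerateGrowth_slash_upperTriangular {f : ℍ → ℂ} {K : ℝ} {n : ℕ}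
    (h : ∀ z : ℍ, 1 ≤ z.im → ‖f z‖ ≤ K * z.im ^ n) {τ : SL(2, ℝ)} (hτ : τ 1 0 = 0) (k : ℤ) :
    HasModerateGrowth (f ∣[k] (τ : GL (Fin 2) ℝ)) := by
  set d := τ 1 1
  have hd : d ≠ 0 := by
    intro hd
    have := specialLinear_denom_ne_zero τ UpperHalfPlane.I
    rw [hτ, show τ 1 1 = 0 from hd] at this
    simp at this
  have hd2 : 0 < d ^ 2 := by positivity
  refine hasModerateGrowth_of_norm_le (A := d ^ 2) (n := n)
    (K := K / (d ^ 2) ^ n * ‖(d : ℂ) ^ (-k)‖) fun z hz => ?_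
  have him : (τ • z).im = z.im / d ^ 2 := by
    rw [im_specialLinear_smul, hτ, ofReal_zero, zero_mul, zero_add, normSq_ofReal, sq]
  have h1 := h (τ • z) (by rwa [him, one_le_div hd2])
  rw [slash_specialLinear, hτ, ofReal_zero, zero_mul, zero_add, norm_mul]
  rw [him, div_pow] at h1
  calc ‖f (τ • z)‖ * ‖(d : ℂ) ^ (-k)‖ ≤ K * (z.im ^ n / (d ^ 2) ^ n) * ‖(d : ℂ) ^ (-k)‖ := by
        gcongr
    _ = _ := by ring

lemma specialLinear_smul_infty {γ : SL(2, ℝ)} (h : γ 1 0 ≠ 0) :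
    (γ : GL (Fin 2) ℝ) • (OnePoint.infty : OnePoint ℝ) = ((γ 0 0 / γ 1 0 : ℝ) : OnePoint ℝ) := by
  rw [OnePoint.smul_infty_eq_ite]
  exact if_neg h

lemma exists_specialLinear {a b c d : ℝ} (h : a * d - b * c = 1) :
    ∃ γ : SL(2, ℝ), γ 0 0 = a ∧ γ 0 1 = b ∧ γ 1 0 = c ∧ γ 1 1 = d :=
  ⟨⟨!![a, b; c, d], by rw [Matrix.det_fin_two_of, h]⟩, rfl, rfl, rfl, rfl⟩

/-- Every multiple of `√p` by a rational number is equivalent to `∞` under `R(p)`. -/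
lemma exists_smul_infty_eq_sqrt_mul (hp : p.Prime) (x : ℚ) : ∃ γ ∈ RGroup p,
    (γ : GL (Fin 2) ℝ) • (OnePoint.infty : OnePoint ℝ) = ((√(p : ℝ) * x : ℝ) : OnePoint ℝ) := by
  have hp0 : 0 < √(p : ℝ) := Real.sqrt_pos.2 (by exact_mod_cast hp.pos)
  have hN : √(p : ℝ) * √(p : ℝ) = p := Real.mul_self_sqrt (Nat.cast_nonneg p)
  have hx : (x : ℝ) = x.num / x.den := by exact_mod_cast (Rat.num_div_den x).symm
  have hp1 : (p : ℝ) ≠ 0 := by exact_mod_cast hp.ne_zero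
  have hq0 : (x.den : ℝ) ≠ 0 := by exact_mod_cast x.den_ne_zero
  have hco : IsCoprime x.num (x.den : ℤ) := by
    rw [Int.isCoprime_iff_gcd_eq_one]
    exact x.reduced
  -- The image of `∞` is the ratio of the first column. If `den x = p q`, then `√p x = num / (q √p)`
  -- is such a ratio for `RPlus`; otherwise `p num` and `den` are coprime and `num √p / den` is one
  -- for `RMinus`.
  by_cases hd : p ∣ x.den
  · obtain ⟨q, hq⟩ := hd
    obtain ⟨u, v, huv⟩ := hco
    have hqR : (q : ℝ) ≠ 0 := by
      intro h
      apply hq0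
      rw [hq]
      push_cast
      rw [h, mul_zero]
    have hdet : (x.num : ℝ) * u - (-v * √(p : ℝ)) * (q * √(p : ℝ)) = 1 := by
      have : (u : ℝ) * x.num + v * (p * q) = 1 := by
        rw [hq] at huv; exact_mod_cast huv
      linear_combination this + v * q * hN
    obtain ⟨γ, h1, h2, h3, h4⟩ := exists_specialLinear hdet
    refine ⟨γ, Or.inl ⟨x.num, -v, q, u, h1, by rw [h2]; push_cast; rfl, by rw [h3]; rfl, h4⟩, ?_⟩
    rw [specialLinear_smul_infty (by rw [h3]; exact mul_ne_zero hqR hp0.ne'), h1, h3, hx, hq]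
    congr 1
    push_cast
    field_simp
    rw [Real.sq_sqrt (Nat.cast_nonneg p)]
  · have hco' : IsCoprime ((p : ℤ) * x.num) (x.den : ℤ) := by
      refine IsCoprime.mul_left ?_ hco
      exact (Nat.prime_iff_prime_int.1 hp).coprime_iff_not_dvd.2 (by exact_mod_cast hd)
    obtain ⟨u, v, huv⟩ := hco'
    have hdet : (x.num * √(p : ℝ)) * (u * √(p : ℝ)) - (-v : ℝ) * x.den = 1 := by
      have : (u : ℝ) * (p * x.num) + v * x.den = 1 := by exact_mod_cast huv
      linear_combination this + x.num * u * hN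
    obtain ⟨γ, h1, h2, h3, h4⟩ := exists_specialLinear hdet
    refine ⟨γ, Or.inr ⟨x.num, -v, x.den, u, h1, by rw [h2]; push_cast; rfl, by rw [h3]; rfl, h4⟩,
      ?_⟩
    rw [specialLinear_smul_infty (by rw [h3]; exact hq0), h1, h3, hx]
    congr 1
    ring

/-- A cusp is the fixed point of a parabolic element, namely `∞` or half the difference of the
diagonal entries over the lower left entry. For both types of element the finite value is a rational
multiple of `√p`. -/
lemma exists_smul_infty_eq_cusp (hp : p.Prime) {c : OnePoint ℝ}
    (hc : IsCusp c ((RGroup p).map SpecialLinearGroup.toGL)) :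
    ∃ γ ∈ RGroup p, (γ : GL (Fin 2) ℝ) • (OnePoint.infty : OnePoint ℝ) = c := by
  obtain ⟨_, ⟨g, hg, rfl⟩, hpar, hfix⟩ := hc
  have hp0 : 0 < √(p : ℝ) := Real.sqrt_pos.2 (by exact_mod_cast hp.pos)
  have hp1 : (p : ℝ) ≠ 0 := by exact_mod_cast hp.ne_zero
  rw [hpar.smul_eq_self_iff, GeneralLinearGroup.parabolicFixedPoint] at hfix
  split_ifs at hfix with h0
  · exact ⟨1, one_mem _, by rw [hfix]; simp⟩
  · rw [hfix]
    rcases hg with ⟨a, b, c, d, h1, h2, h3, h4⟩ | ⟨a, b, c, d, h1, h2, h3, h4⟩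
    · have hc' : (c : ℝ) ≠ 0 := fun h => h0 (h3.trans (by rw [h, zero_mul]))
      convert exists_smul_infty_eq_sqrt_mul hp ((a - d) / (2 * p * c)) using 4
      refine congrArg _ ?_
      change (g 0 0 - g 1 1) / (2 * g 1 0) = _
      rw [h1, h3, h4]
      push_cast
      field_simp
      rw [Real.sq_sqrt (Nat.cast_nonneg p)]
    · have hc' : (c : ℝ) ≠ 0 := fun h => h0 (h3.trans h)
      convert exists_smul_infty_eq_sqrt_mul hp ((a - d) / (2 * c)) using 4
      refine congrArg _ ?_
      change (g 0 0 - g 1 1) / (2 * g 1 0) = _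
      rw [h1, h3, h4]
      push_cast
      field_simp

lemma hasModerateGrowth_eisTaylor_slash (hp : p.Prime) (hk : Even k) (m : ℕ) {c : OnePoint ℝ}
    (hc : IsCusp c ((RGroup p).map SpecialLinearGroup.toGL)) {σ : SL(2, ℝ)}
    (hσ : (σ : GL (Fin 2) ℝ) • c = OnePoint.infty) :
    HasModerateGrowth (eisTaylor p m k ∣[k] ((σ⁻¹ : SL(2, ℝ)) : GL (Fin 2) ℝ)) := by
  obtain ⟨γ, hγ, rfl⟩ := exists_smul_infty_eq_cusp hp hc
  obtain ⟨K, n, -, h⟩ := norm_eisTaylor_le hp hk m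
  have h1 : ((σ * γ : SL(2, ℝ)) : GL (Fin 2) ℝ) • (OnePoint.infty : OnePoint ℝ) =
      OnePoint.infty := by rw [map_mul, mul_smul, hσ]
  rw [OnePoint.smul_infty_eq_self_iff] at h1
  have h2 : (σ * γ)⁻¹ 1 0 = 0 := by
    have h1' : (σ * γ) 1 0 = 0 := h1
    rw [SpecialLinearGroup.SL2_inv_expl]
    simpa using h1'
  -- The factor `γ` is absorbed by modularity, and `σ γ` fixes `∞`, so only an upper triangular
  -- slash remains.
  have h3 : ((σ⁻¹ : SL(2, ℝ)) : GL (Fin 2) ℝ) = γ * ((σ * γ)⁻¹ : SL(2, ℝ)) := by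
    rw [← map_mul]
    congr 1
    group
  rw [h3, SlashAction.slash_mul, eisTaylor_slash hp hk m hγ]
  exact hasModerateGrowth_slash_upperTriangular h h2 k

end Growth

end

theorem mainTheorem8 (p : ℕ) (hp : p.Prime) (m : ℕ) (k : ℤ) (hk : Even k) :
    (∀ z : ℍ, (∃! F : ℂ → ℂ, IsMeromorphicContinuation (1 - (k : ℝ) / 2) (eisGTilde p k z) F) ∧
      AnalyticAt ℂ (eisGTildeCont p k z) 0) ∧
    HasModerateGrowth (eisTaylor p m k) ∧
    IsPolyharmonicMaassForm (RGroup p) k (m + 1) (eisTaylor p m k) :=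
  ⟨fun z => ⟨⟨_, isMeromorphicContinuation_eisCont hp hk z,
      fun _ hG => hG.unique (isMeromorphicContinuation_eisCont hp hk z)⟩,
      analyticAt_eisGTildeCont hp hk z⟩,
    hasModerateGrowth_eisTaylor hp hk m,
    { smooth := contDiffOn_eisTaylor hp hk m
      slash_eq := fun _ hγ => eisTaylor_slash hp hk m hγ
      polyharmonic := hypLaplacian_eisTaylor hp hk m
      growth := fun _ hc _ hσ => hasModerateGrowth_eisTaylor_slash hp hk m hc hσ }⟩
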